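/- For $S\subseteq\mathbb Z_{\ge 0}$ and $j\in\mathbb Z_{\ge 0}$ let $\mathrm{Val}_S(j)=s-j$, where $s$ is the least element of $S$ with $s\ge j$, and $\mathrm{Val}_S(j)=\infty$ if there is no such $s$. A tropical (non-linear) differential equation in $n$ variables is an expression $$\min_{P}\Big\{a_P+\sum_{(i,j)\in P}x_i^{(j)}\Big\},$$ where $P$ ranges over a finite family of (distinct) finite multisets of pairs $(i,j)$ with $1\le i\le n$, $j\in\mathbb Z_{\ge0}$, and $a_P\in\mathbb Z_{\ge0}$. Sets $S_1,\dots,S_n\subseteq\mathbb Z_{\ge0}$ solve it if, after substituting $x_i^{(j)}=\mathrm{Val}_{S_i}(j)$, the minimum is infinite or is attained for at least two different $P$. A finite system is solvable if some $S_1,\dots,S_n$ solve all its equations. As input of a decision problem, a system is written as a word over a finite alphabet by giving $n$ in unary and, for every equation, the list of its terms, each with $a_P$ in binary and the list of the elements $(i,j)$ of $P$ (with repetition), $i$ and $j$ in binary. **Proposition.** 1. The problem of solvability of systems of tropical non-linear differential equations, the number $n$ of variables being part of the input, belongs to $\mathrm{NP}$. 2. If a system in $n$ variables with $|P|\le d$,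 $0\le a_P\le M$ and $0\le j\le r$ throughout, where $d\ge 2$, is solvable, then it has a solution $S_1,\dots,S_n$ such that for every $i$ either $S_i\subseteq[0,r-1]$, or $S_i\cap[r,\infty)=\{s: s\ge m_i\}$ for some $m_i$ with $r\le m_i\le n!\,(M+rd)\,d^n$. 3. Such solutions provide certificates. Let a certificate be given by finite lists $A_1,\dots,A_n$ of non-negative integers and, for some of the $i$, a number $m_i$ (all written in binary); it describes the sets $S_i=A_i\cup[m_i,\infty)$, or $S_i=A_i$ if $m_i$ is not given. It is decidable in polynomial time whether a given word is the code of a certificate that describes a solution of the system encoded by another given word. There is a polynomial $p$ such that every solvable system with a code of length $\ell$ has a solution described by a certificate of length at most $p(\ell)$ that satisfies $A_i\subseteq[0,r]$ for all $i$, and $m_i\le n!\,(M+rd)\,d^n$ whenever $m_i$ is given, for all $d\ge2$, $M$, $r$ that bound the system as in part 2. -/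

import Mathlib

/-! ### Polynomial time and NP, over Mathlib's multi-stack Turing machines -/

namespace Complexity

open Computability Turing

/-- The binary relation `R` between words over two finite alphabets is decidable in polynomial
time: some Turing machine, started on the word `w` followed by the word `c` (written with the
symbols of the disjoint union of the two alphabets), answers `R w c` within a number of steps
polynomial in the total length `|w| + |c|`. -/
def PolyTimeDecidable {Γ Δ : Type} [Fintype Γ] [Fintype Δ]
    (R : List Γ → List Δ → Prop) : Prop :=
  ∃ V : List Γ × List Δ → Bool,
    Nonempty (TM2ComputableInPolyTime
      (encodingProd (encodingList Γ) (encodingList Δ)).encode encodeBool V) ∧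
    ∀ w c, V (w, c) = true ↔ R w c

/-- The class NP: a word belongs to `L` iff it has a certificate of polynomially bounded length
that is accepted by a polynomial time verifier. -/
def InNP {Γ : Type} [Fintype Γ] (L : Set (List Γ)) : Prop :=
  ∃ (Δ : Type) (_ : Fintype Δ) (R : List Γ → List Δ → Prop) (p : Polynomial ℕ),
    PolyTimeDecidable R ∧
    ∀ w, w ∈ L ↔ ∃ c : List Δ, c.length ≤ p.eval w.length ∧ R w c

end Complexity

/-! ### Tropical non-linear differential equations -/

namespace TropDiff

/-- A monomial `∑_{(i,j) ∈ P} x_i^{(j)}` is given by the finite multiset `P` of pairs `(i, j)`;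
its degree is `Multiset.card P`. -/
abbrev Monomial (n : ℕ) : Type := Multiset (Fin n × ℕ)

/-- A tropical differential equation `min_P { a_P + ∑_{(i,j) ∈ P} x_i^{(j)} }` in `n` variables,
with `P` in a finite family of monomials. Only the values of `coeff` on `family` matter. -/
structure Equation (n : ℕ) where
  family : Finset (Monomial n)
  coeff : Monomial n → ℕ

/-- A (finite) system of tropical differential equations in `n` variables. -/
abbrev System (n : ℕ) : Type := List (Equation n)

/-- The valuation `Val_S(j)`: it is `s - j` for the least `s ∈ S` with `s ≥ j`, and `∞` if there is
no such `s`. -/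
noncomputable def val (S : Set ℕ) (j : ℕ) : ℕ∞ :=
  ⨅ s ∈ {s ∈ S | j ≤ s}, ((s - j : ℕ) : ℕ∞)

namespace Equation

variable {n : ℕ}

/-- The value `a_P + ∑_{(i,j) ∈ P} Val_{S_i}(j)` of the monomial `P`. -/
noncomputable def value (e : Equation n) (S : Fin n → Set ℕ) (P : Monomial n) : ℕ∞ :=
  (e.coeff P : ℕ∞) + (P.map fun q => val (S q.1) q.2).sum

/-- The minimum of the values of the monomials (`∞` for the empty family). -/
noncomputable def minValue (e : Equation n) (S : Fin n → Set ℕ) : ℕ∞ :=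
  ⨅ P ∈ e.family, e.value S P

/-- `S_1, …, S_n` solve the equation: the minimum is infinite or is attained at least twice. -/
def IsSolution (e : Equation n) (S : Fin n → Set ℕ) : Prop :=
  e.minValue S = ⊤ ∨
    ∃ P ∈ e.family, ∃ Q ∈ e.family, P ≠ Q ∧
      e.value S P = e.minValue S ∧ e.value S Q = e.minValue S

/-- The list `l` of pairs (coefficient, factors of the monomial) lists the equation `e`: each
monomial of the family exactly once, with its coefficient, the factors in any order. -/
def IsListing (e : Equation n) (l : List (ℕ × List (Fin n × ℕ))) : Prop :=
  (l.map fun t => (t.2 : Monomial n)).Nodup ∧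
  (∀ P, P ∈ e.family ↔ ∃ t ∈ l, (t.2 : Monomial n) = P) ∧
  ∀ t ∈ l, e.coeff (t.2 : Monomial n) = t.1

end Equation

namespace System

variable {n : ℕ}

/-- `S_1, …, S_n` solve every equation of the system. -/
def IsSolution (E : System n) (S : Fin n → Set ℕ) : Prop :=
  ∀ e ∈ E, e.IsSolution S

def Solvable (E : System n) : Prop :=
  ∃ S : Fin n → Set ℕ, E.IsSolution S

/-- All monomials have degree at most `d`, coefficients at most `M` and orders of derivatives at
most `r`. -/
def Bounded (E : System n) (d M r : ℕ) : Prop :=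
  ∀ e ∈ E, ∀ P ∈ e.family, Multiset.card P ≤ d ∧ e.coeff P ≤ M ∧ ∀ q ∈ P, q.2 ≤ r

end System

/-! ### Encodings as words over the alphabet `{blank, 0, 1, (, ), ','}` -/

open Computability (Γ' encodingNatΓ')

/-- A derivative `x_i^{(j)}` is written `(i,j)`, with `i` and `j` in binary. -/
def encodeFactor {n : ℕ} (q : Fin n × ℕ) : List Γ' :=
  [Γ'.bra] ++ encodingNatΓ'.encode q.1 ++ [Γ'.comma] ++ encodingNatΓ'.encode q.2 ++ [Γ'.ket]

/-- A term `a + ∑ x_i^{(j)}` is written `(a(i,j)(i',j')…)`, with `a` in binary. -/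
def encodeTerm {n : ℕ} (t : ℕ × List (Fin n × ℕ)) : List Γ' :=
  [Γ'.bra] ++ encodingNatΓ'.encode t.1 ++ t.2.flatMap encodeFactor ++ [Γ'.ket]

def encodeEquation {n : ℕ} (l : List (ℕ × List (Fin n × ℕ))) : List Γ' :=
  [Γ'.bra] ++ l.flatMap encodeTerm ++ [Γ'.ket]

/-- The number `n` of variables in unary (`n` commas), followed by the equations. -/
def encodeSystem {n : ℕ} (L : List (List (ℕ × List (Fin n × ℕ)))) : List Γ' :=
  List.replicate n Γ'.comma ++ L.flatMap encodeEquation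

/-- The word `w` is a code of the system `E`. -/
def System.IsCode {n : ℕ} (E : System n) (w : List Γ') : Prop :=
  ∃ L : List (List (ℕ × List (Fin n × ℕ))),
    List.Forall₂ Equation.IsListing E L ∧ w = encodeSystem L

/-- The decision problem: the set of all codes of solvable systems, the number of variables being
part of the input. Words that are not codes of systems do not belong to it. -/
def solvabilityProblem : Set (List Γ') :=
  {w | ∃ (n : ℕ) (E : System n), E.IsCode w ∧ E.Solvable}

/-- A finite description of sets `S_1, …, S_n ⊆ ℕ`: for each `i` a finite list of elements, and
either a number `m_i` from which on all natural numbers belong to `S_i`, or nothing. -/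
structure Certificate (n : ℕ) where
  initial : Fin n → List ℕ
  tail : Fin n → Option ℕ

namespace Certificate

variable {n : ℕ}

/-- The sets described by the certificate, `S_i = initial i ∪ [m_i, ∞)`, or `S_i = initial i`
if there is no `m_i`. -/
def sets (C : Certificate n) (i : Fin n) : Set ℕ :=
  {s | s ∈ C.initial i ∨ ∃ m ∈ C.tail i, m ≤ s}

/-- The part of the certificate that describes `S_i`: `((s)(s')…,m_i)` or `((s)(s')…)`, with all
numbers in binary. -/
def encodeEntry (C : Certificate n) (i : Fin n) : List Γ' :=
  [Γ'.bra] ++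
    (C.initial i).flatMap (fun s => [Γ'.bra] ++ encodingNatΓ'.encode s ++ [Γ'.ket]) ++
    (C.tail i).elim [] (fun m => [Γ'.comma] ++ encodingNatΓ'.encode m) ++ [Γ'.ket]

def encode (C : Certificate n) : List Γ' :=
  (List.ofFn C.encodeEntry).flatten

end Certificate

/-- The word `c` is a certificate describing a solution of the system whose code is `w`. -/
def Certifies (w c : List Γ') : Prop :=
  ∃ (n : ℕ) (E : System n) (C : Certificate n),
    E.IsCode w ∧ c = C.encode ∧ E.IsSolution C.sets

end TropDiff

/-!
Small solutions. Cut the sets `S_i` of a solution at `r`. An order `j ≤ r` sees of the part of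
`S_i` in `[r, ∞)` at most its least element, so this part may be replaced by an interval
`[r + z_i, ∞)` without changing any value, and then, as `z` varies, every monomial is either always
infinite or an affine function of `z` with slopes at most `d` and a constant at most `B = M + r d`.
Whether `z` gives a solution depends on the truth of the inequalities `b ≤ ∑ a_i z_i` with `|a_i| ≤ d` and
`|b| ≤ B` only. It therefore suffices to move an integer point `y` to a small integer point that
satisfies all those inequalities that `y` satisfies (`SmallPoint.exists_small_point`): the
polyhedron of these inequalities has a vertex `x`, bounded by Cramer's rule; the cone on which all
bounded forms have the sign that they have at `y - x` contains this vector, and subtracting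
integer multiples of extreme rays, which are given by minors, leads to an integer point `u` of the
cone such that `y - x - u` is still in the cone and is bounded. Then `y - u = x + (y - x - u)` is
the point required. This gives `System.Solvable.exists_small`.

Certificates. Of `S_i ∩ [0, r)` only the elements matter that are the least ones not below an
order that occurs, and there are no more of these than symbols in a code of the system. The numbers
`m_i` have polynomially many digits, so the certificates have polynomial length
(`System.IsCode.exists_short_certificate`).

Verification. The polynomial time Turing machines have to be exhibited. Programs with sequences,
branches and loops compile to multi-stack machines (`StackMachine.Prog`, `Exec.halts`). All data
are represented by binary trees on one stack, and a function is `PolyTime` if a program replaces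
the tree of the argument on top of this stack by the tree of the value in polynomial time, leaving
the rest of the stacks alone. Such functions are closed under composition, pairing, case
distinction and iteration along a list with intermediate results of controlled size
(`PolyTime.foldl`). Binary arithmetic, the parser and the evaluation of equations are built from
these operations, so that `polyTime_verify` is mostly a matter of unfolding definitions. A word is
recognized as a code by parsing it and printing the result, so the parser only has to be correct
on codes; `verify_iff` states that the verifier is correct.
-/

/-! ### A structured language for multi-stack machines -/

namespace StackMachine

open Turing Function

/-- Programs over stacks indexed by `K`: do nothing, push a symbol, pop a stack and branch on the
outcome (`none` for the empty stack), run two programs in turn, repeat a program as long as the top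
of a stack satisfies a condition. -/
inductive Prog {K : Type} (Γ : K → Type) : Type
  | skip : Prog Γ
  | push (k : K) (a : Γ k) : Prog Γ
  | pop (k : K) (f : Option (Γ k) → Prog Γ) : Prog Γ
  | seq (p q : Prog Γ) : Prog Γ
  | loop (k : K) (c : Option (Γ k) → Bool) (p : Prog Γ) : Prog Γ

variable {K : Type} {Γ : K → Type}

/-- `Exec p s s' n`: run on the stacks `s`, the program `p` ends with the stacks `s'`
after at most `n` steps. All rules allow for slack in the number of steps. -/
inductive Exec [DecidableEq K] :
    Prog Γ → (∀ k, List (Γ k)) → (∀ k, List (Γ k)) → ℕ → Prop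
  | skip {s N} (h : 1 ≤ N) : Exec .skip s s N
  | push {s k a N} (h : 1 ≤ N) : Exec (.push k a) s (update s k (a :: s k)) N
  | pop {s s' k f n N} (h : Exec (f (s k).head?) (update s k (s k).tail) s' n) (hN : n + 1 ≤ N) :
      Exec (.pop k f) s s' N
  | seq {s s' s'' p q n m N} (hp : Exec p s s' n) (hq : Exec q s' s'' m) (hN : n + m ≤ N) :
      Exec (.seq p q) s s'' N
  | loop_done {s k c p N} (hc : c (s k).head? = false) (hN : 1 ≤ N) : Exec (.loop k c p) s s N
  | loop_continue {s s' s'' k c p n m N} (hc : c (s k).head? = true) (hp : Exec p s s' n)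
      (hl : Exec (.loop k c p) s' s'' m) (hN : n + m + 1 ≤ N) : Exec (.loop k c p) s s'' N

theorem Exec.mono [DecidableEq K] {p : Prog Γ} {s s' : ∀ k, List (Γ k)} {n m : ℕ}
    (h : Exec p s s' n) (hnm : n ≤ m) : Exec p s s' m := by
  cases h with
  | skip h => exact .skip (h.trans hnm)
  | push h => exact .push (h.trans hnm)
  | pop h hN => exact .pop h (hN.trans hnm)
  | seq hp hq hN => exact .seq hp hq (hN.trans hnm)
  | loop_done hc hN => exact .loop_done hc (hN.trans hnm)
  | loop_continue hc hp hl hN => exact .loop_continue hc hp hl (hN.trans hnm)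

/-- Each step pushes at most one symbol. -/
theorem Exec.length_le [DecidableEq K] {p : Prog Γ} {s s' : ∀ k, List (Γ k)} {n : ℕ}
    (h : Exec p s s' n) (k : K) : (s' k).length ≤ (s k).length + n := by
  induction h with
  | skip h => omega
  | @push s k' a N h =>
    rcases eq_or_ne k k' with rfl | hk
    · simp; omega
    · simp [update_of_ne hk]
  | @pop s s' k' f n N h hN ih =>
    rcases eq_or_ne k k' with rfl | hk
    · simp at ih; omega
    · simp [update_of_ne hk] at ih; omega
  | seq hp hq hN ih1 ih2 => omega
  | loop_done hc hN => omega
  | loop_continue hc hp hl hN ih1 ih2 => omega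

namespace Prog

/-- The control states of the machine of a program. -/
def Labels : Prog Γ → Type
  | skip => Unit
  | push _ _ => Unit
  | pop k f => Option (Σ o : Option (Γ k), (f o).Labels)
  | seq p q => p.Labels ⊕ q.Labels
  | loop _ _ p => Option p.Labels

theorem finite_labels [∀ k, Finite (Γ k)] : ∀ p : Prog Γ, Finite p.Labels
  | skip => inferInstanceAs (Finite Unit)
  | push _ _ => inferInstanceAs (Finite Unit)
  | pop k f => by
    have := fun o => finite_labels (f o)
    exact inferInstanceAs (Finite (Option (Σ o : Option (Γ k), (f o).Labels)))
  | seq p q => by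
    have := finite_labels p
    have := finite_labels q
    exact inferInstanceAs (Finite (p.Labels ⊕ q.Labels))
  | loop _ _ p => by
    have := finite_labels p
    exact inferInstanceAs (Finite (Option p.Labels))

/-- The control state in which a program starts. -/
def start : ∀ p : Prog Γ, p.Labels
  | skip => ()
  | push _ _ => ()
  | pop _ _ => none
  | seq p _ => .inl p.start
  | loop _ _ _ => none

/-- The code of a program whose control states are embedded into `M` by `ι` and which continues
at `done`. The local variable of the machine only remembers where to jump after a `pop` or
a `peek`. -/
def code {M : Type} : ∀ p : Prog Γ, (p.Labels → M) → M → p.Labels → TM2.Stmt Γ M M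
  | skip, _, done, _ => .goto fun _ => done
  | push k a, _, done, _ => .push k (fun _ => a) (.goto fun _ => done)
  | pop k f, ι, done, l =>
    match l with
    | none => .pop k (fun _ o => ι (some ⟨o, (f o).start⟩)) (.goto id)
    | some ⟨o, l⟩ => (f o).code (fun l => ι (some ⟨o, l⟩)) done l
  | seq p q, ι, done, l =>
    match l with
    | .inl l => p.code (fun l => ι (.inl l)) (ι (.inr q.start)) l
    | .inr l => q.code (fun l => ι (.inr l)) done l
  | loop k c p, ι, done, l =>
    match l with
    | none => .peek k (fun _ o => if c o then ι (some p.start) else done) (.goto id)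
    | some l => p.code (fun l => ι (some l)) (ι none) l

end Prog

/-- The machine `m` leads from the control state `l` and the stacks `s` to the control state `l'`
and the stacks `s'` within `n` steps. -/
def Leads [DecidableEq K] {M : Type} (m : M → TM2.Stmt Γ M M) (l : M) (s : ∀ k, List (Γ k))
    (l' : M) (s' : ∀ k, List (Γ k)) (n : ℕ) : Prop :=
  ∀ v, ∃ v', ∃ j ≤ n, (flip bind (TM2.step m))^[j] (some ⟨some l, v, s⟩) = some ⟨some l', v', s'⟩

theorem Leads.trans [DecidableEq K] {M : Type} {m : M → TM2.Stmt Γ M M} {l₁ l₂ l₃ : M}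
    {s₁ s₂ s₃ : ∀ k, List (Γ k)} {i j n : ℕ} (h : Leads m l₁ s₁ l₂ s₂ i)
    (h' : Leads m l₂ s₂ l₃ s₃ j) (hn : i + j ≤ n) : Leads m l₁ s₁ l₃ s₃ n := by
  intro v
  obtain ⟨v', i', hi, e⟩ := h v
  obtain ⟨v'', j', hj, e'⟩ := h' v'
  exact ⟨v'', j' + i', by omega, by rw [iterate_add_apply, e, e']⟩

theorem Leads.of_step [DecidableEq K] {M : Type} {m : M → TM2.Stmt Γ M M} {l l' : M}
    {s s' : ∀ k, List (Γ k)} {n : ℕ} (hn : 1 ≤ n)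
    (h : ∀ v, ∃ v', TM2.stepAux (m l) v s = ⟨some l', v', s'⟩) : Leads m l s l' s' n := by
  intro v
  obtain ⟨v', e⟩ := h v
  exact ⟨v', 1, hn, by simp [flip, e]⟩

/-- The machine of a program simulates it, wherever the code of the program is embedded. -/
theorem Exec.leads [DecidableEq K] {p : Prog Γ} {s s' : ∀ k, List (Γ k)} {n : ℕ}
    (h : Exec p s s' n) {M : Type} (m : M → TM2.Stmt Γ M M) (ι : p.Labels → M) (done : M)
    (hm : ∀ l, m (ι l) = p.code ι done l) : Leads m (ι p.start) s done s' n := by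
  induction h generalizing done with
  | skip h => exact .of_step h fun v => ⟨v, by rw [hm]; simp [Prog.code]⟩
  | push h => exact .of_step h fun v => ⟨v, by rw [hm]; simp [Prog.code]⟩
  | @pop s s' k f n N h hN ih =>
    refine Leads.trans
      (.of_step le_rfl fun v => ⟨ι (some ⟨(s k).head?, (f (s k).head?).start⟩), ?_⟩)
      (ih (fun l => ι (some ⟨_, l⟩)) done fun l => hm _) (by omega)
    rw [hm]; simp [Prog.code, Prog.start]
  | @seq s s' s'' p q n m N hp hq hN ih1 ih2 =>
    exact Leads.trans (ih1 (fun l => ι (.inl l)) _ fun l => hm _)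
      (ih2 (fun l => ι (.inr l)) done fun l => hm _) hN
  | loop_done hc hN =>
    exact .of_step hN fun v => ⟨done, by rw [hm]; simp [Prog.code, Prog.start, hc]⟩
  | @loop_continue s s' s'' k c p n m N hc hp hl hN ih1 ih2 =>
    refine Leads.trans (.of_step le_rfl fun v => ⟨ι (some p.start), ?_⟩)
      (Leads.trans (ih1 (fun l => ι (some l)) _ fun l => hm _) (ih2 ι done hm) le_rfl) (by omega)
    rw [hm]; simp [Prog.code, Prog.start, hc]

/-- The code of the machine of a program: the additional control state `none` is reached at the end
of the program; it clears the local variable and halts. -/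
def Prog.fullCode (p : Prog Γ) : Option p.Labels → TM2.Stmt Γ (Option p.Labels) (Option p.Labels)
  | none => .load (fun _ => none) .halt
  | some l => p.code some none l

theorem Exec.halts [DecidableEq K] {p : Prog Γ} {s s' : ∀ k, List (Γ k)} {n : ℕ}
    (h : Exec p s s' n) : ∃ j ≤ n + 1, (flip bind (TM2.step p.fullCode))^[j]
      (some ⟨some (some p.start), none, s⟩) = some ⟨none, none, s'⟩ := by
  obtain ⟨v', j, hj, e⟩ := h.leads p.fullCode some none (fun l => rfl) none
  refine ⟨j + 1, by omega, ?_⟩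
  rw [iterate_succ_apply', e]
  simp [flip, Prog.fullCode]

/-- The machine of a program, with input and output stacks `k₀` and `k₁`. -/
noncomputable def Prog.machine [DecidableEq K] [Fintype K] [∀ k, Fintype (Γ k)] (p : Prog Γ)
    (k₀ k₁ : K) : FinTM2 :=
  haveI := p.finite_labels
  { k₀ := k₀
    k₁ := k₁
    Γ := Γ
    Λ := Option p.Labels
    ΛFin := Fintype.ofFinite _
    main := some p.start
    σ := Option p.Labels
    σFin := Fintype.ofFinite _
    initialState := none
    m := p.fullCode }

theorem update_nil_eq_dite [DecidableEq K] (k₀ : K) (l : List (Γ k₀)) :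
    update (fun _ => []) k₀ l = fun k => @dite (List (Γ k)) (k = k₀) (inferInstance)
      (fun h => by rw [h]; exact l) fun _ => [] := by
  funext k
  by_cases hk : k = k₀
  · subst hk
    simp
  · rw [update_of_ne hk, dif_neg hk]

theorem initList_machine [DecidableEq K] [Fintype K] [∀ k, Fintype (Γ k)] (p : Prog Γ)
    (k₀ k₁ : K) (l : List (Γ k₀)) : initList (p.machine k₀ k₁) l =
      (⟨some (some p.start), none, update (fun _ => []) k₀ l⟩ : TM2.Cfg Γ _ _) := by
  rw [update_nil_eq_dite]
  rfl

theorem haltList_machine [DecidableEq K] [Fintype K] [∀ k, Fintype (Γ k)] (p : Prog Γ)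
    (k₀ k₁ : K) (l : List (Γ k₁)) : haltList (p.machine k₀ k₁) l =
      (⟨none, none, update (fun _ => []) k₁ l⟩ : TM2.Cfg Γ (Option p.Labels) _) := by
  rw [update_nil_eq_dite]
  rfl

/-- A program that transforms the initial stacks for the input into the final stacks for the
output within polynomial time gives a polynomial time machine. -/
theorem nonempty_computableInPolyTime [DecidableEq K] [Fintype K] [∀ k, Fintype (Γ k)]
    {α β A B : Type} {ea : α → List A} {eb : β → List B} {f : α → β}
    (p : Prog Γ) (k₀ k₁ : K) (eA : Γ k₀ ≃ A) (eB : Γ k₁ ≃ B) (q : Polynomial ℕ)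
    (h : ∀ a, Exec p (update (fun _ => []) k₀ ((ea a).map eA.symm))
      (update (fun _ => []) k₁ ((eb (f a)).map eB.symm)) (q.eval (ea a).length)) :
    Nonempty (TM2ComputableInPolyTime ea eb f) := by
  refine ⟨{ tm := p.machine k₀ k₁, inputAlphabet := eA, outputAlphabet := eB, time := q + 1,
            outputsFun := fun a => Classical.choice ?_ }⟩
  obtain ⟨j, hj, e⟩ := (h a).halts
  rw [← initList_machine p k₀ k₁, ← haltList_machine p k₀ k₁] at e
  exact ⟨⟨⟨j, e⟩, by simpa using hj⟩⟩

end StackMachine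

/-! ### Binary trees on a stack -/

namespace StackMachine

open Turing Function Computability

/-- Binary trees, the universal data type: every value handled below is represented by one. -/
inductive Data : Type
  | nil : Data
  | cons (a b : Data) : Data
  deriving DecidableEq

namespace Data

/-- The prefix code of a tree. Codes consist of symbols `some b`; the symbol `none` is left for
marking positions on a stack. -/
def code : Data → List (Option Bool)
  | nil => [some false]
  | cons a b => some true :: (a.code ++ b.code)

/-- The length of the code of a tree. -/
def size (t : Data) : ℕ := t.code.length

@[simp] theorem size_nil : nil.size = 1 := rfl

@[simp] theorem size_cons (a b : Data) : (cons a b).size = a.size + b.size + 1 := by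
  simp [size, code]

theorem none_notMem_code (t : Data) : none ∉ t.code := by
  induction t with
  | nil => simp [code]
  | cons a b iha ihb => simp [code, iha, ihb]

end Data

/-- The stacks of the machines: input, output, a stack `main` for the values of a computation,
and two auxiliary stacks. -/
inductive Stk : Type
  | inp | out | main | aux | cnt
  deriving DecidableEq

instance : Fintype Stk :=
  ⟨{.inp, .out, .main, .aux, .cnt}, fun k => by cases k <;> decide⟩

/-- The alphabets of the stacks; the input consists of two words over `Γ'`. -/
abbrev Sym : Stk → Type
  | .inp => Γ' ⊕ Γ'
  | .out => Bool
  | .main => Option Bool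
  | .aux => Option Bool
  | .cnt => Option Bool

instance : ∀ k, Fintype (Sym k)
  | .inp => inferInstanceAs (Fintype (Γ' ⊕ Γ'))
  | .out => inferInstanceAs (Fintype Bool)
  | .main => inferInstanceAs (Fintype (Option Bool))
  | .aux => inferInstanceAs (Fintype (Option Bool))
  | .cnt => inferInstanceAs (Fintype (Option Bool))

/-- The stacks with the given contents. -/
def store (i : List (Γ' ⊕ Γ')) (o : List Bool) (m a c : List (Option Bool)) :
    ∀ k, List (Sym k)
  | .inp => i
  | .out => o
  | .main => m
  | .aux => a
  | .cnt => c

section Basic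

variable {i : List (Γ' ⊕ Γ')} {o : List Bool} {m a c : List (Option Bool)}
  {s : ∀ k, List (Sym k)} {n N : ℕ}

theorem update_inp (x : List (Γ' ⊕ Γ')) :
    update (store i o m a c) .inp x = store x o m a c := by
  funext k; cases k <;> rfl

theorem update_out (x : List Bool) : update (store i o m a c) .out x = store i x m a c := by
  funext k; cases k <;> rfl

theorem update_main (x : List (Option Bool)) :
    update (store i o m a c) .main x = store i o x a c := by
  funext k; cases k <;> rfl

theorem update_aux (x : List (Option Bool)) :
    update (store i o m a c) .aux x = store i o m x c := by
  funext k; cases k <;> rfl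

theorem update_cnt (x : List (Option Bool)) :
    update (store i o m a c) .cnt x = store i o m a x := by
  funext k; cases k <;> rfl

theorem exec_push_main (x : Option Bool) :
    Exec (.push (Γ := Sym) .main x) (store i o m a c) (store i o (x :: m) a c) 1 := by
  rw [← update_main (m := m) (x :: m)]; exact .push (K := Stk) le_rfl

theorem exec_push_aux (x : Option Bool) :
    Exec (.push (Γ := Sym) .aux x) (store i o m a c) (store i o m (x :: a) c) 1 := by
  rw [← update_aux (a := a) (x :: a)]; exact .push (K := Stk) le_rfl

theorem exec_push_cnt (x : Option Bool) :
    Exec (.push (Γ := Sym) .cnt x) (store i o m a c) (store i o m a (x :: c)) 1 := by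
  rw [← update_cnt (c := c) (x :: c)]; exact .push (K := Stk) le_rfl

theorem exec_push_out (x : Bool) :
    Exec (.push (Γ := Sym) .out x) (store i o m a c) (store i (x :: o) m a c) 1 := by
  rw [← update_out (o := o) (x :: o)]; exact .push (K := Stk) le_rfl

theorem exec_pop_main {x : Option Bool} {f : Option (Option Bool) → Prog Sym}
    (h : Exec (f (some x)) (store i o m a c) s n) :
    Exec (.pop .main f) (store i o (x :: m) a c) s (n + 1) :=
  .pop (n := n) (by rw [update_main]; exact h) le_rfl

theorem exec_pop_aux {x : Option Bool} {f : Option (Option Bool) → Prog Sym}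
    (h : Exec (f (some x)) (store i o m a c) s n) :
    Exec (.pop .aux f) (store i o m (x :: a) c) s (n + 1) :=
  .pop (n := n) (by rw [update_aux]; exact h) le_rfl

theorem exec_pop_cnt {x : Option Bool} {f : Option (Option Bool) → Prog Sym}
    (h : Exec (f (some x)) (store i o m a c) s n) :
    Exec (.pop .cnt f) (store i o m a (x :: c)) s (n + 1) :=
  .pop (n := n) (by rw [update_cnt]; exact h) le_rfl

theorem exec_pop_inp {x : Γ' ⊕ Γ'} {f : Option (Γ' ⊕ Γ') → Prog Sym}
    (h : Exec (f (some x)) (store i o m a c) s n) :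
    Exec (.pop .inp f) (store (x :: i) o m a c) s (n + 1) :=
  .pop (n := n) (by rw [update_inp]; exact h) le_rfl

theorem exec_skip : Exec (.skip : Prog Sym) s s 1 := .skip le_rfl

theorem Exec.then {p q : Prog Sym} {s s' s'' : ∀ k, List (Sym k)} {n m : ℕ} (hp : Exec p s s' n)
    (hq : Exec q s' s'' m) : Exec (.seq p q) s s'' (n + m) := .seq hp hq le_rfl

theorem Exec.mono' {p : Prog Sym} {s s' s'' : ∀ k, List (Sym k)} {n m : ℕ} (h : Exec p s s' n)
    (hs : s' = s'') (hnm : n ≤ m) : Exec p s s'' m :=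
  hs ▸ h.mono hnm

/-- Reads the codes of as many trees on `main` as there are symbols `some true` on top of `cnt`,
running `w b` for every symbol `some b`. -/
def walk (w : Bool → Prog Sym) : Prog Sym :=
  .loop .cnt (fun x : Option (Option Bool) => x == some (some true))
    (.pop .cnt fun _ => .pop .main fun x : Option (Option Bool) => match x with
      | some (some true) =>
        .seq (w true) (.seq (.push .cnt (some true : Option Bool))
          (.push .cnt (some true : Option Bool)))
      | some (some false) => w false
      | _ => .skip)

/-- The number of trees that remain to be read is kept on `cnt` in unary: a symbol `some true` of a
code replaces one tree by two, a symbol `some false` completes one. -/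
theorem exec_walk {w : Bool → Prog Sym} {g : Option Bool → List (Option Bool) → List (Option Bool)}
    (hw : ∀ b m a c, Exec (w b) (store i o m a c) (store i o m (g (some b) a) c) 1) (t : Data)
    (h : Exec (walk w) (store i o m (t.code.foldl (fun a x => g x a) a) c) s n) :
    Exec (walk w) (store i o (t.code ++ m) a (some true :: c)) s (n + 6 * t.size) := by
  induction t generalizing m a c n with
  | nil =>
    refine .loop_continue rfl (exec_pop_cnt (exec_pop_main (hw false _ _ _))) h ?_
    simp; omega
  | cons t₁ t₂ ih₁ ih₂ =>
    simp only [Data.code, List.cons_append, List.append_assoc, List.foldl_cons,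
      List.foldl_append] at h ⊢
    refine .loop_continue rfl (exec_pop_cnt (exec_pop_main ((hw true _ _ _).then
      ((exec_push_cnt _).then (exec_push_cnt _))))) (ih₁ (ih₂ h)) ?_
    simp; omega

theorem exec_walk_done {w : Bool → Prog Sym} :
    Exec (walk w) (store i o m a (none :: c)) (store i o m a (none :: c)) 1 :=
  .loop_done rfl le_rfl

/-- Moves a tree from `main` to `aux`, reversed and above a mark. -/
def moveTree : Prog Sym :=
  .seq (.push .aux (none : Option Bool)) (.seq (.push .cnt (none : Option Bool))
    (.seq (.push .cnt (some true : Option Bool))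
      (.seq (walk fun b => .push .aux (some b : Option Bool)) (.pop .cnt fun _ => .skip))))

theorem exec_moveTree (t : Data) : Exec moveTree (store i o (t.code ++ m) a c)
    (store i o m (t.code.reverse ++ none :: a) c) (6 * t.size + 6) := by
  have h := exec_walk (i := i) (o := o) (m := m) (a := none :: a) (c := none :: c)
    (w := fun b => .push .aux (some b : Option Bool)) (g := fun x a => x :: a)
    (fun b m a c => exec_push_aux (some b)) t exec_walk_done
  have e : t.code.foldl (fun a x => x :: a) (none :: a) = t.code.reverse ++ none :: a := by
    generalize none :: a = a'
    induction t.code generalizing a' with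
    | nil => rfl
    | cons x l ih => simp [ih]
  rw [e] at h
  exact ((exec_push_aux none).then ((exec_push_cnt none).then ((exec_push_cnt _).then
    (h.then (exec_pop_cnt exec_skip))))).mono (by omega)

/-- Removes the tree on top of `main`. -/
def dropTree : Prog Sym :=
  .seq (.push .cnt (none : Option Bool)) (.seq (.push .cnt (some true : Option Bool))
    (.seq (walk fun _ => .skip) (.pop .cnt fun _ => .skip)))

theorem exec_dropTree (t : Data) : Exec dropTree (store i o (t.code ++ m) a c)
    (store i o m a c) (6 * t.size + 5) := by
  have h := exec_walk (i := i) (o := o) (m := m) (a := a) (c := none :: c)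
    (w := fun _ => .skip) (g := fun x a => a) (fun b m a c => exec_skip) t exec_walk_done
  have e : t.code.foldl (fun a _ => a) a = a := by
    rw [List.foldl_const]
    exact congrFun (iterate_id _) a
  rw [e] at h
  exact ((exec_push_cnt none).then ((exec_push_cnt _).then
    (h.then (exec_pop_cnt exec_skip)))).mono (by omega)

/-- Moves the symbols of `aux` above the topmost mark to `main`, and removes the mark. -/
def restore : Prog Sym :=
  .seq (.loop .aux (fun x : Option (Option Bool) => x != some none)
    (.pop .aux fun x : Option (Option Bool) => .push .main (x.getD none)))
    (.pop .aux fun _ => .skip)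

theorem exec_restore {l : List (Option Bool)} (hl : none ∉ l) :
    Exec restore (store i o m (l ++ none :: a) c) (store i o (l.reverse ++ m) a c)
      (3 * l.length + 3) := by
  have : Exec (.loop .aux (fun x : Option (Option Bool) => x != some none)
      (.pop .aux fun x : Option (Option Bool) => .push (Γ := Sym) .main (x.getD none)))
      (store i o m (l ++ none :: a) c) (store i o (l.reverse ++ m) (none :: a) c)
      (3 * l.length + 1) := by
    induction l generalizing m with
    | nil => exact .loop_done rfl le_rfl
    | cons x l ih =>
      rw [List.mem_cons, not_or] at hl
      have h := ih (m := x :: m) hl.2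
      rw [List.reverse_cons, List.append_assoc]
      refine .loop_continue ?_ (exec_pop_aux (exec_push_main _)) h (by simp; omega)
      cases x
      · exact absurd rfl hl.1
      · rfl
  exact (this.then (exec_pop_aux exec_skip)).mono (by omega)

/-- Moves the symbols of `aux` above the topmost mark both to `main` and, above a new mark, to
`cnt`, and removes the old mark. -/
def restoreTwice : Prog Sym :=
  .seq (.push .cnt (none : Option Bool))
  (.seq (.loop .aux (fun x : Option (Option Bool) => x != some none)
    (.pop .aux fun x : Option (Option Bool) => .seq (.push .main (x.getD none))
      (.push .cnt (x.getD none)))) (.pop .aux fun _ => .skip))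

theorem exec_restoreTwice {l : List (Option Bool)} (hl : none ∉ l) :
    Exec restoreTwice (store i o m (l ++ none :: a) c)
      (store i o (l.reverse ++ m) a (l.reverse ++ none :: c)) (4 * l.length + 4) := by
  have (c : List (Option Bool)) : Exec (.loop .aux (fun x : Option (Option Bool) => x != some none)
      (.pop .aux fun x : Option (Option Bool) => .seq (.push (Γ := Sym) .main (x.getD none))
        (.push .cnt (x.getD none))))
      (store i o m (l ++ none :: a) c) (store i o (l.reverse ++ m) (none :: a) (l.reverse ++ c))
      (4 * l.length + 1) := by
    induction l generalizing m c with
    | nil => exact .loop_done rfl le_rfl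
    | cons x l ih =>
      rw [List.mem_cons, not_or] at hl
      have h := ih (m := x :: m) (c := x :: c) hl.2
      rw [List.reverse_cons, List.append_assoc, List.append_assoc]
      refine .loop_continue ?_ (exec_pop_aux ((exec_push_main _).then (exec_push_cnt _))) h
        (by simp; omega)
      cases x
      · exact absurd rfl hl.1
      · rfl
  exact ((exec_push_cnt none).then ((this _).then (exec_pop_aux exec_skip))).mono (by omega)

/-- Moves the symbols of `cnt` above the topmost mark to `aux`, above a new mark, and removes the
old mark. -/
def transfer : Prog Sym :=
  .seq (.push .aux (none : Option Bool))
  (.seq (.loop .cnt (fun x : Option (Option Bool) => x != some none)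
    (.pop .cnt fun x : Option (Option Bool) => .push .aux (x.getD none)))
    (.pop .cnt fun _ => .skip))

theorem exec_transfer {l : List (Option Bool)} (hl : none ∉ l) :
    Exec transfer (store i o m a (l ++ none :: c)) (store i o m (l.reverse ++ none :: a) c)
      (3 * l.length + 4) := by
  have (a : List (Option Bool)) : Exec (.loop .cnt (fun x : Option (Option Bool) => x != some none)
      (.pop .cnt fun x : Option (Option Bool) => .push (Γ := Sym) .aux (x.getD none)))
      (store i o m a (l ++ none :: c)) (store i o m (l.reverse ++ a) (none :: c))
      (3 * l.length + 1) := by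
    induction l generalizing a with
    | nil => exact .loop_done rfl le_rfl
    | cons x l ih =>
      rw [List.mem_cons, not_or] at hl
      have h := ih (a := x :: a) hl.2
      rw [List.reverse_cons, List.append_assoc]
      refine .loop_continue ?_ (exec_pop_cnt (exec_push_aux _)) h (by simp; omega)
      cases x
      · exact absurd rfl hl.1
      · rfl
  exact ((exec_push_aux none).then ((this _).then (exec_pop_cnt exec_skip))).mono (by omega)

/-- Restores a tree from `aux` to `main`. -/
theorem exec_restore_tree (t : Data) : Exec restore (store i o m (t.code.reverse ++ none :: a) c)
    (store i o (t.code ++ m) a c) (3 * t.size + 3) := by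
  simpa [Data.size] using exec_restore (i := i) (o := o) (m := m) (a := a) (c := c)
    (l := t.code.reverse) (by simpa using t.none_notMem_code)

/-- Duplicates the tree on top of `main`. -/
def dupTree : Prog Sym := .seq moveTree (.seq restoreTwice (.seq transfer restore))

theorem exec_dupTree (t : Data) : Exec dupTree (store i o (t.code ++ m) a c)
    (store i o (t.code ++ (t.code ++ m)) a c) (16 * t.size + 17) := by
  have h := exec_restoreTwice (i := i) (o := o) (m := m) (a := a) (c := c) (l := t.code.reverse)
    (by simpa using t.none_notMem_code)
  simp only [List.reverse_reverse, List.length_reverse] at h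
  have h' := exec_transfer (i := i) (o := o) (m := t.code ++ m) (a := a) (c := c)
    t.none_notMem_code
  refine ((exec_moveTree t).then (h.then (h'.then (exec_restore_tree t)))).mono ?_
  simp only [Data.size]
  omega

/-- Pushes a fixed tree. -/
def pushTree : Data → Prog Sym
  | .nil => .push .main (some false : Option Bool)
  | .cons a b => .seq (pushTree b) (.seq (pushTree a) (.push .main (some true : Option Bool)))

theorem exec_pushTree (t : Data) : Exec (pushTree t) (store i o m a c)
    (store i o (t.code ++ m) a c) t.size := by
  induction t generalizing m with
  | nil => exact exec_push_main _
  | cons t₁ t₂ ih₁ ih₂ =>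
    simp only [Data.code, List.cons_append, List.append_assoc]
    exact (ih₂.then (ih₁.then (exec_push_main _))).mono (by simp; omega)

end Basic

end StackMachine

/-! ### Polynomial time functions -/

namespace StackMachine

open Turing Function Computability

/-- A representation of the elements of a type by trees. -/
class ToData (α : Type) where
  toData : α → Data

open ToData

/-- The size of the representation of `a`. -/
def size {α : Type} [ToData α] (a : α) : ℕ := (toData a).size

/-- The function `f` is computable in polynomial time: a program replaces the code of `a` on top of
the stack `main` by the code of `f a`, in time polynomial in the size of `a`. Whatever else is on
the stacks is kept, so programs for different functions can be combined freely. -/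
@[fun_prop]
def PolyTime {α β : Type} [ToData α] [ToData β] (f : α → β) : Prop :=
  ∃ (P : Prog Sym) (q : Polynomial ℕ), ∀ a i o m x c,
    Exec P (store i o ((toData a).code ++ m) x c) (store i o ((toData (f a)).code ++ m) x c)
      (q.eval (size a))

theorem eval_mono (q : Polynomial ℕ) {a b : ℕ} (h : a ≤ b) : q.eval a ≤ q.eval b := by
  induction q using Polynomial.induction_on' with
  | add p q hp hq => simpa using add_le_add hp hq
  | monomial n c => simpa using Nat.mul_le_mul_left c (Nat.pow_le_pow_left h n)

instance : ToData Data := ⟨id⟩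

instance : ToData Unit := ⟨fun _ => .nil⟩

/-- Both truth values have the same size. -/
instance : ToData Bool :=
  ⟨fun b => if b then .cons (.cons .nil .nil) .nil else .cons .nil (.cons .nil .nil)⟩

instance {α β : Type} [ToData α] [ToData β] : ToData (α × β) :=
  ⟨fun x => .cons (toData x.1) (toData x.2)⟩

/-- A list `[a, b, …]` is represented by `cons a (cons b (…))`. -/
def listToData {α : Type} [ToData α] : List α → Data
  | [] => .nil
  | a :: l => .cons (toData a) (listToData l)

instance {α : Type} [ToData α] : ToData (List α) := ⟨listToData⟩

instance {α : Type} [ToData α] : ToData (Option α) := ⟨fun o => toData o.toList⟩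

instance {α β : Type} [ToData α] [ToData β] : ToData (α ⊕ β) :=
  ⟨Sum.elim (fun a => toData (false, a)) (fun b => toData (true, b))⟩

/-- Natural numbers are represented in binary, starting with the least significant digit. -/
instance : ToData ℕ := ⟨fun n => toData n.bits⟩

instance {n : ℕ} : ToData (Fin n) := ⟨fun i => toData (List.replicate i ())⟩

instance : ToData Γ' :=
  ⟨fun x => toData (match x with
    | .blank => []
    | .bit b => [b]
    | .bra => [false, false]
    | .ket => [false, true]
    | .comma => [true, true])⟩

section

variable {α β γ δ : Type} [ToData α] [ToData β] [ToData γ] [ToData δ]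

@[simp] theorem size_data (t : Data) : size t = t.size := rfl

@[simp] theorem size_bool (b : Bool) : size b = 5 := by cases b <;> rfl

@[simp] theorem size_unit (b : Unit) : size b = 1 := rfl

@[simp] theorem size_prod (x : α × β) : size x = size x.1 + size x.2 + 1 :=
  Data.size_cons _ _

@[simp] theorem size_listNil : size ([] : List α) = 1 := rfl

@[simp] theorem size_listCons (a : α) (l : List α) : size (a :: l) = size a + size l + 1 :=
  Data.size_cons _ _

@[simp] theorem size_none : size (none : Option α) = 1 := rfl

@[simp] theorem size_some (a : α) : size (some a) = size a + 2 :=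
  Data.size_cons _ _

theorem size_pos (a : α) : 0 < size a := by
  unfold size Data.size
  cases toData a <;> simp [Data.code]

theorem length_lt_size (l : List α) : l.length < size l := by
  induction l with
  | nil => simp
  | cons a l ih => simp; omega

theorem size_append (l l' : List α) : size (l ++ l') + 1 = size l + size l' := by
  induction l with
  | nil => simp; omega
  | cons a l ih => simp; omega

theorem size_reverse (l : List α) : size l.reverse = size l := by
  induction l with
  | nil => rfl
  | cons a l ih =>
    have := size_append l.reverse [a]
    simp at this ⊢; try omega

theorem size_le_of_mem {a : α} {l : List α} (h : a ∈ l) : size a < size l := by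
  induction l with
  | nil => simp at h
  | cons b l ih =>
    rcases List.mem_cons.1 h with rfl | h
    · rw [size_listCons]; omega
    · have := ih h
      simp
      omega

/-- The size of the value of a polynomial time function is polynomially bounded. -/
theorem PolyTime.size_le {f : α → β} (hf : PolyTime f) :
    ∃ q : Polynomial ℕ, ∀ a, size (f a) ≤ q.eval (size a) := by
  obtain ⟨P, q, h⟩ := hf
  refine ⟨.X + q, fun a => ?_⟩
  simpa [store, size, Data.size] using (h a [] [] [] [] []).length_le .main

theorem PolyTime.of_toData_eq {f : α → β} (h : ∀ a, toData (f a) = toData a) : PolyTime f :=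
  ⟨.skip, 1, fun a i o m x c => by rw [h]; simpa using exec_skip⟩

theorem PolyTime.congr_toData {γ : Type} [ToData γ] {f : α → β} {g : α → γ} (hg : PolyTime g)
    (h : ∀ a, toData (f a) = toData (g a)) : PolyTime f := by
  obtain ⟨P, q, hP⟩ := hg
  exact ⟨P, q, fun a i o m x c => by rw [h]; exact hP a i o m x c⟩

@[fun_prop]
theorem PolyTime.id : PolyTime fun a : α => a := .of_toData_eq fun _ => rfl

@[fun_prop]
theorem PolyTime.const (b : β) : PolyTime fun _ : α => b := by
  refine ⟨.seq dropTree (pushTree (toData b)), 6 * .X + 5 + .C (size b), fun a i o m x c => ?_⟩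
  simpa [size] using (exec_dropTree (toData a)).then (exec_pushTree (toData b))

@[fun_prop]
theorem PolyTime.comp {g : β → γ} {f : α → β} (hg : PolyTime g) (hf : PolyTime f) :
    PolyTime fun a => g (f a) := by
  obtain ⟨q', hq'⟩ := hf.size_le
  obtain ⟨P, p, hP⟩ := hf
  obtain ⟨Q, q, hQ⟩ := hg
  refine ⟨.seq P Q, p + q.comp q', fun a i o m x c => ?_⟩
  refine ((hP a i o m x c).then (hQ (f a) i o m x c)).mono ?_
  simpa using eval_mono q (hq' a)

@[fun_prop]
theorem PolyTime.pair {f : α → β} {g : α → γ} (hf : PolyTime f) (hg : PolyTime g) :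
    PolyTime fun a => (f a, g a) := by
  obtain ⟨q', hq'⟩ := hf.size_le
  obtain ⟨P, p, hP⟩ := hf
  obtain ⟨Q, q, hQ⟩ := hg
  -- `f a` is computed from a copy of `a` and put aside while `g a` is computed.
  refine ⟨.seq dupTree (.seq P (.seq moveTree (.seq Q (.seq restore
    (.push .main (some true : Option Bool)))))), 16 * .X + 27 + p + q + 9 * q',
    fun a i o m x c => ?_⟩
  refine ((exec_dupTree (toData a)).then ((hP a i o _ x c).then ((exec_moveTree _).then
    ((hQ a i o m _ c).then ((exec_restore_tree (toData (f a))).then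
      (exec_push_main (some true))))))).mono' ?_ ?_
  · simp [toData, Data.code]
  · have := hq' a
    simp only [size] at *
    simp
    omega

@[fun_prop]
theorem PolyTime.fst {f : α → β × γ} (hf : PolyTime f) : PolyTime fun a => (f a).1 := by
  have : PolyTime (Prod.fst : β × γ → β) := by
    refine ⟨.pop .main fun _ => .seq moveTree (.seq dropTree restore), 15 * .X + 15,
      fun b i o m x c => ?_⟩
    simp only [toData, Data.code, List.cons_append, List.append_assoc]
    refine (exec_pop_main ((exec_moveTree _).then ((exec_dropTree _).then
      (exec_restore_tree _)))).mono ?_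
    simp
    simp [size]
    omega
  exact this.comp hf

@[fun_prop]
theorem PolyTime.snd {f : α → β × γ} (hf : PolyTime f) : PolyTime fun a => (f a).2 := by
  have : PolyTime (Prod.snd : β × γ → γ) := by
    refine ⟨.pop .main fun _ => dropTree, 6 * .X + 6, fun b i o m x c => ?_⟩
    simp only [toData, Data.code, List.cons_append, List.append_assoc]
    refine (exec_pop_main (exec_dropTree _)).mono ?_
    simp
    simp [size]
    omega
  exact this.comp hf

/-- Branching on whether the first argument is represented by `nil`. Trees, lists and optional
values are all covered: `α` is the type of the data of the elements that are not. -/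
theorem PolyTime.cases {f : δ × β → γ} {g : β → γ} {h : α × β → γ} (hg : PolyTime g)
    (hh : PolyTime h) (H : ∀ d, toData d = .nil ∧ (∀ b, f (d, b) = g b) ∨
      ∃ e : α, toData d = toData e ∧ toData e ≠ .nil ∧ ∀ b, f (d, b) = h (e, b)) :
    PolyTime f := by
  obtain ⟨P, p, hP⟩ := hg
  obtain ⟨Q, q, hQ⟩ := hh
  refine ⟨.pop .main fun _ => .pop .main fun x : Option (Option Bool) => if x = some (some true)
    then .seq (.push .main (some true : Option Bool))
      (.seq (.push .main (some true : Option Bool)) Q)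
    else P, p + q + 4, fun ⟨d, b⟩ i o m x c => ?_⟩
  rcases H d with ⟨h0, h1⟩ | ⟨e, h0, h1, h2⟩
  · have hs : toData (d, b) = .cons .nil (toData b) := by rw [← h0]; rfl
    have hs' : size (d, b) = size b + 2 := by rw [size, hs]; simp [size]; omega
    rw [h1, hs, hs']
    refine (exec_pop_main (exec_pop_main (n := p.eval (size b)) ?_)).mono ?_
    · exact hP b i o m x c
    · have := eval_mono p (show size b ≤ size b + 2 by omega)
      simp only [Polynomial.eval_add, Polynomial.eval_ofNat]
      omega
  · have hs : toData (d, b) = toData (e, b) := by simp only [toData] at h0 ⊢; rw [h0]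
    have hs' : size (d, b) = size (e, b) := by rw [size, hs, size]
    rw [h2, hs, hs']
    have hQ := hQ (e, b) i o m x c
    have he : toData (e, b) = .cons (toData e) (toData b) := rfl
    rw [he] at hQ ⊢
    generalize toData e = t at *
    cases t with
    | nil => exact absurd rfl h1
    | cons t₁ t₂ =>
      refine (exec_pop_main (exec_pop_main (((exec_push_main _).then
        ((exec_push_main _).then hQ))))).mono ?_
      simp only [Polynomial.eval_add, Polynomial.eval_ofNat]
      omega

theorem PolyTime.data_cases {f : Data × β → γ} (h0 : PolyTime fun b => f (.nil, b))
    (h1 : PolyTime fun x : (Data × Data) × β => f (.cons x.1.1 x.1.2, x.2)) : PolyTime f := by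
  refine .cases h0 h1 fun d => ?_
  cases d with
  | nil => exact .inl ⟨rfl, fun _ => rfl⟩
  | cons a b => exact .inr ⟨(a, b), rfl, Data.noConfusion, fun _ => rfl⟩

theorem PolyTime.list_cases {f : List α × β → γ} (h0 : PolyTime fun b => f ([], b))
    (h1 : PolyTime fun x : (α × List α) × β => f (x.1.1 :: x.1.2, x.2)) : PolyTime f := by
  refine .cases h0 h1 fun d => ?_
  cases d with
  | nil => exact .inl ⟨rfl, fun _ => rfl⟩
  | cons a b => exact .inr ⟨(a, b), rfl, Data.noConfusion, fun _ => rfl⟩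

theorem PolyTime.bool_cases {f : Bool × β → γ} (h0 : PolyTime fun b => f (false, b))
    (h1 : PolyTime fun b => f (true, b)) : PolyTime f := by
  have key : PolyTime fun x : Data × β => match x.1 with
      | .nil => f (false, x.2)
      | .cons _ _ => f (true, x.2) :=
    .data_cases h0 (h1.comp (f := fun x : (Data × Data) × β => x.2) (by fun_prop))
  have hd : PolyTime fun x : Bool × β => (match x.1 with
      | true => Data.cons .nil .nil
      | false => .nil, x.2) := by
    refine PolyTime.pair ?_ (by fun_prop)
    have : PolyTime fun b : Bool => (toData b : Data) := .of_toData_eq fun _ => rfl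
    have h2 : PolyTime fun x : Data × Unit => match x.1 with
        | .nil => Data.nil
        | .cons a _ => a := .data_cases (by fun_prop) (by fun_prop)
    have h3 : PolyTime fun x : Bool × β => (toData x.1, ()) := by fun_prop
    convert h2.comp h3 with x
    cases x.1 <;> rfl
  convert key.comp hd with x
  obtain ⟨_ | _, b⟩ := x <;> rfl

theorem PolyTime.ite {c : α → Bool} {f g : α → β} (hc : PolyTime c) (hf : PolyTime f)
    (hg : PolyTime g) : PolyTime fun a => if c a then f a else g a := by
  have : PolyTime fun x : Bool × α => if x.1 then f x.2 else g x.2 :=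
    .bool_cases (by simpa using hg) (by simpa using hf)
  exact this.comp (hc.pair .id)

/-- Comparison with a fixed tree. -/
theorem PolyTime.data_eq (t : Data) : ∃ f : Data → Bool, PolyTime f ∧ ∀ x, f x = true ↔ x = t := by
  induction t with
  | nil =>
    have : PolyTime fun x : Data × Unit => match x.1 with
        | .nil => true
        | .cons _ _ => false := .data_cases (.const _) (.const _)
    refine ⟨_, this.comp (PolyTime.id.pair (.const ())), fun x => ?_⟩
    cases x <;> simp
  | cons t₁ t₂ ih₁ ih₂ =>
    obtain ⟨f₁, h₁, e₁⟩ := ih₁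
    obtain ⟨f₂, h₂, e₂⟩ := ih₂
    have : PolyTime fun x : Data × Unit => match x.1 with
        | .nil => false
        | .cons a b => if f₁ a then f₂ b else false :=
      .data_cases (.const _) (.ite (by fun_prop) (by fun_prop) (.const _))
    refine ⟨_, this.comp (PolyTime.id.pair (.const ())), fun x => ?_⟩
    cases x <;> simp [e₁, e₂]

/-- Case distinction on an argument from a finite type. -/
theorem PolyTime.finite_cases [Finite δ] (hδ : Injective (toData : δ → Data)) {f : δ × α → β}
    (h : ∀ d, PolyTime fun a => f (d, a)) : PolyTime f := by
  classical
  have := Fintype.ofFinite δ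
  rcases isEmpty_or_nonempty δ with hE | ⟨⟨d₀⟩⟩
  · exact ⟨.skip, 0, fun x => (hE.false x.1).elim⟩
  have key (l : List δ) : ∃ g : δ × α → β, PolyTime g ∧ ∀ d ∈ l, ∀ a, g (d, a) = f (d, a) := by
    induction l with
    | nil => exact ⟨fun x => f (d₀, x.2), (h d₀).comp (by fun_prop), by simp⟩
    | cons d l ih =>
      obtain ⟨g, hg, e⟩ := ih
      obtain ⟨t, ht, et⟩ := PolyTime.data_eq (toData d)
      have hd : PolyTime fun d : δ => (toData d : Data) := .of_toData_eq fun _ => rfl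
      refine ⟨fun x => if t (toData x.1) then f (d, x.2) else g x, .ite (by fun_prop)
        ((h d).comp (by fun_prop)) hg, fun d' hd' a => ?_⟩
      by_cases hdd : d' = d
      · subst hdd
        simp [et]
      · have : ¬ toData d' = toData d := fun h => hdd (hδ h)
        simp [et, this, e d' ((List.mem_cons.1 hd').resolve_left hdd)]
  obtain ⟨g, hg, e⟩ := key (Finset.univ : Finset δ).toList
  have : g = f := funext fun x => e x.1 (by simp) x.2
  exact this ▸ hg

/-- Any function on a finite type is computable in polynomial time. -/
theorem PolyTime.of_finite [Finite α] (hα : Injective (toData : α → Data)) (f : α → β) :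
    PolyTime f := by
  have : PolyTime fun x : α × Unit => f x.1 := .finite_cases hα fun a => .const (f a)
  exact this.comp (PolyTime.id.pair (.const ()))

/-- Iteration along a list, provided that the intermediate results are of polynomial size. -/
theorem PolyTime.foldl_of_size_le {step : α → β → γ → β}
    (h : PolyTime fun x : α × β × γ => step x.1 x.2.1 x.2.2) (B : Polynomial ℕ)
    (hB : ∀ a b l l', l' <+: l → size (l'.foldl (step a) b) ≤ B.eval (size (a, b, l))) :
    PolyTime fun x : α × β × List γ => x.2.2.foldl (step x.1) x.2.1 := by
  have hbody : PolyTime fun x : (γ × List γ) × (α × β) =>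
      (x.1.2, x.2.1, step x.2.1 x.2.2 x.1.1) :=
    .pair (by fun_prop) (.pair (by fun_prop) (h.comp
      (g := fun x : α × β × γ => step x.1 x.2.1 x.2.2)
      (f := fun x : (γ × List γ) × (α × β) => (x.2.1, x.2.2, x.1.1)) (by fun_prop)))
  obtain ⟨P, p, hP⟩ := hbody
  -- The list is kept first, so that the symbol on top of `main` tells whether it is empty.
  have key : PolyTime fun x : List γ × α × β => x.1.foldl (step x.2.1) x.2.2 := by
    refine ⟨.seq (.pop .main fun _ => .skip) (.seq
      (.loop .main (fun x : Option (Option Bool) => x == some (some true))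
        (.seq (.push .main (some true : Option Bool)) (.seq P (.pop .main fun _ => .skip))))
      (.pop .main fun _ => .pop .main fun _ => dropTree)),
      .X * (p.comp (.X + B.comp .X + 1) + 10) + 6 * .X + 20, fun ⟨l, a, b⟩ i o m x c => ?_⟩
    -- `M` bounds the sizes of all states to which the step is applied.
    have loop (M : ℕ) (l : List γ) (b : β)
        (hM : ∀ l', l' <+: l → size l + size a + size (l'.foldl (step a) b) + 2 ≤ M) :
        Exec (.loop .main (fun x : Option (Option Bool) => x == some (some true))
          (.seq (.push .main (some true : Option Bool)) (.seq P (.pop .main fun _ => .skip))))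
        (store i o ((toData l).code ++ ((toData (a, b)).code ++ m)) x c)
        (store i o (some false :: ((toData (a, l.foldl (step a) b)).code ++ m)) x c)
        (l.length * (p.eval M + 4) + 1) := by
      induction l generalizing b with
      | nil => exact .loop_done rfl (by simp)
      | cons y l ih =>
        have h1 := hP ((y, l), (a, b)) i o m x c
        have h2 := ih (step a b y) fun l' hl' => by
          have := hM (y :: l') (by simpa using hl')
          simp only [size_listCons, List.foldl_cons] at this
          omega
        have h3 : size ((y, l), (a, b)) ≤ M := by
          have := hM [] (by simp)
          simp only [size_listCons, List.foldl_nil] at this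
          simp only [size_prod]
          omega
        have e : (toData ((y, l), (a, b))).code =
            some true :: ((toData (y :: l)).code ++ (toData (a, b)).code) := rfl
        have e' : (toData (l, a, step a b y)).code =
            some true :: ((toData l).code ++ (toData (a, step a b y)).code) := rfl
        rw [e, e', List.cons_append, List.append_assoc, List.cons_append, List.append_assoc] at h1
        refine .loop_continue rfl
          ((exec_push_main _).then (h1.then (exec_pop_main exec_skip))) h2 ?_
        have := eval_mono p h3
        rw [List.length_cons, Nat.succ_mul]
        omega
    have h1 := loop (size (l, a, b) + B.eval (size (l, a, b)) + 1) l b fun l' hl' => by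
      have h0 := hB a b l l' hl'
      have e : size (a, b, l) = size (l, a, b) := by simp only [size_prod]; omega
      have := size_pos b
      rw [e] at h0
      simp only [size_prod] at *
      omega
    have e : (toData (l, a, b)).code = some true :: ((toData l).code ++ (toData (a, b)).code) := rfl
    rw [e, List.cons_append, List.append_assoc]
    have e' (b : β) :
      (toData (a, b)).code = some true :: ((toData a).code ++ (toData b).code) := rfl
    rw [e' (l.foldl (step a) b), List.cons_append, List.append_assoc] at h1
    refine ((exec_pop_main exec_skip).then (h1.then (exec_pop_main (exec_pop_main
      (exec_dropTree _))))).mono ?_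
    have h2 := length_lt_size l
    have h3 : size l ≤ size (l, a, b) := by simp only [size_prod]; omega
    have h4 : size a ≤ size (l, a, b) := by simp only [size_prod]; omega
    have h5 := Nat.mul_le_mul_right
      (p.eval (size (l, a, b) + B.eval (size (l, a, b)) + 1) + 4) (h2.le.trans h3)
    have h6 : (toData a).size = size a := rfl
    simp only [Polynomial.eval_add, Polynomial.eval_mul, Polynomial.eval_X, Polynomial.eval_comp,
      Polynomial.eval_ofNat, Polynomial.eval_one]
    rw [h6]
    nlinarith
  exact key.comp (f := fun x : α × β × List γ => (x.2.2, x.1, x.2.1)) (by fun_prop)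

/-- Iteration along a list of a step that increases the size by a controlled amount only. -/
theorem PolyTime.foldl {step : α → β → γ → β}
    (h : PolyTime fun x : α × β × γ => step x.1 x.2.1 x.2.2) (q : Polynomial ℕ)
    (hq : ∀ a b c, size (step a b c) ≤ size b + q.eval (size a + size c)) :
    PolyTime fun x : α × β × List γ => x.2.2.foldl (step x.1) x.2.1 := by
  refine foldl_of_size_le h (.X + .X * q) fun a b l l' hl => ?_
  have key (N : ℕ) (hN : ∀ c ∈ l', size a + size c ≤ N) :
      size (l'.foldl (step a) b) ≤ size b + l'.length * q.eval N := by
    clear hl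
    induction l' generalizing b with
    | nil => simp
    | cons c l' ih =>
      have h1 := ih (step a b c) fun d hd => hN d (by simp [hd])
      have h2 := hq a b c
      have h3 := eval_mono q (hN c (by simp))
      rw [List.length_cons, Nat.succ_mul, List.foldl_cons]
      omega
  have h1 := key (size (a, b, l)) fun c hc => by
    have := size_le_of_mem (hl.subset hc)
    simp only [size_prod]
    omega
  have h2 : l'.length ≤ size (a, b, l) := by
    have := hl.length_le
    have := length_lt_size l
    simp only [size_prod]
    omega
  have h3 := Nat.mul_le_mul_right (q.eval (size (a, b, l))) h2
  have h4 : size b ≤ size (a, b, l) := by simp only [size_prod]; omega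
  simp only [Polynomial.eval_add, Polynomial.eval_mul, Polynomial.eval_X]
  omega

/-! ### Lists -/

@[fun_prop]
theorem PolyTime.cons {f : α → β} {g : α → List β} (hf : PolyTime f) (hg : PolyTime g) :
    PolyTime fun a => f a :: g a := by
  have : PolyTime fun x : β × List β => x.1 :: x.2 := .of_toData_eq fun _ => rfl
  exact this.comp (hf.pair hg)

@[fun_prop]
theorem PolyTime.reverse {f : α → List β} (hf : PolyTime f) : PolyTime fun a => (f a).reverse := by
  have : PolyTime fun x : Unit × List β × List β => x.2.2.foldl (fun l b => b :: l) x.2.1 := by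
    refine .foldl (step := fun _ l b => b :: l) (by fun_prop) (.X) fun a b c => ?_
    simp
    omega
  convert this.comp (f := fun a => ((), [], f a)) (by fun_prop) with a
  generalize f a = l
  simp

@[fun_prop]
theorem PolyTime.append {f g : α → List β} (hf : PolyTime f) (hg : PolyTime g) :
    PolyTime fun a => f a ++ g a := by
  have : PolyTime fun x : Unit × List β × List β => x.2.2.foldl (fun l b => b :: l) x.2.1 := by
    refine .foldl (step := fun _ l b => b :: l) (by fun_prop) (.X) fun a b c => ?_
    simp
    omega
  convert this.comp (f := fun a => ((), g a, (f a).reverse)) (by fun_prop) with a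
  simp

@[fun_prop]
theorem PolyTime.flatMap {f : α → List β} {g : α → β → List γ} (hf : PolyTime f)
    (hg : PolyTime fun x : α × β => g x.1 x.2) : PolyTime fun a => (f a).flatMap (g a) := by
  obtain ⟨q, hq⟩ := hg.size_le
  have : PolyTime fun x : α × List γ × List β =>
      x.2.2.foldl (fun l b => (g x.1 b).reverse ++ l) x.2.1 := by
    refine .foldl (step := fun a l b => (g a b).reverse ++ l) ?_ (q.comp (.X + 1)) fun a b c => ?_
    · have := hg.comp (f := fun x : α × List γ × β => (x.1, x.2.2)) (by fun_prop)
      fun_prop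
    · have h1 := size_append (g a c).reverse b
      have h2 := hq (a, c)
      rw [size_reverse] at h1
      simp at h2 ⊢
      omega
  convert (this.comp (f := fun a => (a, [], f a)) (by fun_prop)).reverse with a
  simp only
  generalize f a = l
  suffices ∀ l', (l.foldl (fun l b => (g a b).reverse ++ l) l').reverse =
      l'.reverse ++ l.flatMap (g a) by
    simpa using (this []).symm
  induction l with
  | nil => simp
  | cons b l ih =>
    intro l'
    rw [List.foldl_cons, ih]
    simp

@[fun_prop]
theorem PolyTime.map {f : α → List β} {g : α → β → γ} (hf : PolyTime f)
    (hg : PolyTime fun x : α × β => g x.1 x.2) : PolyTime fun a => (f a).map (g a) := by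
  have : PolyTime fun a => (f a).flatMap fun b => [g a b] := by fun_prop
  convert this with a
  rw [List.map_eq_flatMap]

@[fun_prop]
theorem PolyTime.and {f g : α → Bool} (hf : PolyTime f) (hg : PolyTime g) :
    PolyTime fun a => f a && g a := by
  convert hf.ite hg (.const false) with a
  cases f a <;> rfl

@[fun_prop]
theorem PolyTime.or {f g : α → Bool} (hf : PolyTime f) (hg : PolyTime g) :
    PolyTime fun a => f a || g a := by
  convert hf.ite (.const true) hg with a
  cases f a <;> rfl

@[fun_prop]
theorem PolyTime.not {f : α → Bool} (hf : PolyTime f) :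
    PolyTime fun a => !f a := by
  convert hf.ite (.const false) (.const true) with a
  cases f a <;> rfl

@[fun_prop]
theorem PolyTime.all {f : α → List β} {g : α → β → Bool} (hf : PolyTime f)
    (hg : PolyTime fun x : α × β => g x.1 x.2) : PolyTime fun a => (f a).all (g a) := by
  have : PolyTime fun x : α × Bool × List β => x.2.2.foldl (fun c b => c && g x.1 b) x.2.1 := by
    refine .foldl (step := fun a c b => c && g a b) ?_ 0 fun a b c => by simp
    have := hg.comp (f := fun x : α × Bool × β => (x.1, x.2.2)) (by fun_prop)
    fun_prop
  convert this.comp (f := fun a => (a, true, f a)) (by fun_prop) with a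
  simp only
  generalize f a = l
  suffices ∀ c, l.foldl (fun c b => c && g a b) c = (c && l.all (g a)) by simp [this]
  induction l with
  | nil => simp
  | cons b l ih => simp [ih, Bool.and_assoc]

@[fun_prop]
theorem PolyTime.option_some {f : α → β} (hf : PolyTime f) : PolyTime fun a => some (f a) :=
  .congr_toData (g := fun a => [f a]) (by fun_prop) fun _ => rfl

theorem PolyTime.option_cases {f : Option α × β → γ} (h0 : PolyTime fun b => f (none, b))
    (h1 : PolyTime fun x : α × β => f (some x.1, x.2)) : PolyTime f := by
  refine .cases h0 (h := fun x : (α × Unit) × β => f (some x.1.1, x.2)) (h1.comp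
    (f := fun x : (α × Unit) × β => (x.1.1, x.2)) (by fun_prop)) fun d => ?_
  cases d with
  | none => exact .inl ⟨rfl, fun _ => rfl⟩
  | some a => exact .inr ⟨(a, ()), rfl, Data.noConfusion, fun _ => rfl⟩

@[fun_prop]
theorem PolyTime.isEmpty {f : α → List β} (hf : PolyTime f) : PolyTime fun a => (f a).isEmpty := by
  have : PolyTime fun x : List β × Unit => x.1.isEmpty := .list_cases (.const true) (.const false)
  exact this.comp (hf.pair (.const ()))

@[fun_prop]
theorem PolyTime.tail {f : α → List β} (hf : PolyTime f) : PolyTime fun a => (f a).tail := by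
  have : PolyTime fun x : List β × Unit => x.1.tail := .list_cases (.const []) (by
    simp only [List.tail_cons]; fun_prop)
  exact this.comp (hf.pair (.const ()))

@[fun_prop]
theorem PolyTime.headI [Inhabited β] {f : α → List β} (hf : PolyTime f) :
    PolyTime fun a => (f a).headI := by
  have : PolyTime fun x : List β × Unit => x.1.headI :=
    .list_cases (.const default) (by simp only [List.headI_cons]; fun_prop)
  exact this.comp (hf.pair (.const ()))

end

end StackMachine

namespace StackMachine

open Turing Function Computability ToData

variable {α β γ : Type} [ToData α] [ToData β] [ToData γ]

/-! ### Binary arithmetic -/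

theorem size_nat (n : ℕ) : size n = 6 * n.size + 1 := by
  have (l : List Bool) : size l = 6 * l.length + 1 := by
    induction l with
    | nil => rfl
    | cons b l ih => simp [ih]; omega
  rw [← Nat.size_eq_bits_len]
  exact this n.bits

theorem size_nat_mono {m n : ℕ} (h : m ≤ n) : size m ≤ size n := by
  have := Nat.size_le_size h
  rw [size_nat, size_nat]
  omega

theorem size_add_le (m n : ℕ) : size (m + n) ≤ size m + size n := by
  have h : (m + n).size ≤ m.size + n.size := by
    rw [Nat.size_le]
    have h1 := Nat.lt_size_self m
    have h2 := Nat.lt_size_self n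
    rw [pow_add]
    nlinarith
  rw [size_nat, size_nat, size_nat]
  omega

@[fun_prop]
theorem PolyTime.bits {f : α → ℕ} (hf : PolyTime f) : PolyTime fun a => (f a).bits :=
  .congr_toData hf fun _ => rfl

@[fun_prop]
theorem PolyTime.div2 {f : α → ℕ} (hf : PolyTime f) : PolyTime fun a => (f a).div2 :=
  .congr_toData (hf.bits.tail) fun a => by
    rw [← Nat.div2_bits_eq_tail]; rfl

@[fun_prop]
theorem PolyTime.bodd {f : α → ℕ} (hf : PolyTime f) : PolyTime fun a => (f a).bodd :=
  .congr_toData (hf.bits.headI) fun a => by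
    rw [← Nat.bodd_eq_bits_head]

@[fun_prop]
theorem PolyTime.bit {f : α → Bool} {g : α → ℕ} (hf : PolyTime f) (hg : PolyTime g) :
    PolyTime fun a => Nat.bit (f a) (g a) := by
  refine .congr_toData (g := fun a => if !(f a) && (g a).bits.isEmpty then []
    else f a :: (g a).bits) (.ite (by fun_prop) (by fun_prop) (by fun_prop)) fun a => ?_
  generalize f a = b
  generalize g a = n
  change toData (Nat.bit b n).bits = _
  congr 1
  cases b
  · rcases eq_or_ne n 0 with rfl | hn
    · simp
    · have : n.bits ≠ [] := fun h => hn (by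
        have := congrArg List.length h
        rw [Nat.size_eq_bits_len] at this
        exact Nat.size_eq_zero.1 (by simpa using this))
      rw [Nat.bits_append_bit _ _ (fun h => absurd h hn)]
      simp [this]
  · rw [Nat.bits_append_bit _ _ (fun _ => rfl)]
    simp

@[fun_prop]
theorem PolyTime.xor {f g : α → Bool} (hf : PolyTime f) (hg : PolyTime g) :
    PolyTime fun a => Bool.xor (f a) (g a) := by
  convert hf.ite hg.not hg with a
  cases f a <;> simp

/-- The number with the given binary digits, the most significant digit coming first, preceded by
the digits of `n`. -/
def ofDigits (l : List Bool) (n : ℕ) : ℕ := l.foldl (fun n b => Nat.bit b n) n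

theorem size_bit_le (b : Bool) (n : ℕ) : size (Nat.bit b n) ≤ size n + 6 := by
  have h : (Nat.bit b n).size ≤ n.size + 1 := by
    rw [Nat.size_le, pow_succ]
    have := Nat.lt_size_self n
    rw [Nat.bit_val]
    have := b.toNat_lt
    omega
  rw [size_nat, size_nat]
  omega

@[fun_prop]
theorem PolyTime.ofDigits {f : α → List Bool} {g : α → ℕ} (hf : PolyTime f) (hg : PolyTime g) :
    PolyTime fun a => ofDigits (f a) (g a) := by
  have : PolyTime fun x : Unit × ℕ × List Bool => x.2.2.foldl (fun n b => Nat.bit b n) x.2.1 := by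
    refine .foldl (step := fun _ n b => Nat.bit b n) (by fun_prop) .X fun a b c => ?_
    have := size_bit_le c b
    simp
    omega
  exact this.comp (f := fun a => ((), g a, f a)) (by fun_prop)

/-- A step of the addition or subtraction of two numbers `x.2.1` and `x.2.2.1`, with carry `x.1`
and digits `x.2.2.2` of the result so far. -/
def arithStep (carry : Bool → Bool → Bool → Bool) (x : Bool × ℕ × ℕ × List Bool) :
    Bool × ℕ × ℕ × List Bool :=
  (carry x.1 x.2.1.bodd x.2.2.1.bodd, x.2.1.div2, x.2.2.1.div2,
    Bool.xor x.1 (Bool.xor x.2.1.bodd x.2.2.1.bodd) :: x.2.2.2)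

theorem PolyTime.arith {carry : Bool → Bool → Bool → Bool}
    (hc : PolyTime fun x : Bool × Bool × Bool => carry x.1 x.2.1 x.2.2) {f g : α → ℕ}
    (hf : PolyTime f) (hg : PolyTime g) : PolyTime fun a =>
      ((f a).bits ++ (g a).bits).foldl (fun x _ => arithStep carry x) (false, f a, g a, []) := by
  have : PolyTime fun x : Unit × (Bool × ℕ × ℕ × List Bool) × List Bool =>
      x.2.2.foldl (fun x _ => arithStep carry x) x.2.1 := by
    refine .foldl (step := fun _ x _ => arithStep carry x) ?_ (.X) fun a x c => ?_
    · have := hc.comp (f := fun x : Unit × (Bool × ℕ × ℕ × List Bool) × Bool =>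
        (x.2.1.1, x.2.1.2.1.bodd, x.2.1.2.2.1.bodd)) (by fun_prop)
      unfold arithStep
      fun_prop
    · have h1 : size x.2.1.div2 ≤ size x.2.1 := size_nat_mono (by rw [Nat.div2_val]; omega)
      have h2 : size x.2.2.1.div2 ≤ size x.2.2.1 := size_nat_mono (by rw [Nat.div2_val]; omega)
      simp [arithStep]
      omega
  exact this.comp (f := fun a => ((), (false, f a, g a, []), (f a).bits ++ (g a).bits))
    (by fun_prop)

/-- The digit by digit addition is correct, with the majority of the three bits as the new carry. -/
theorem foldl_arithStep_add (l : List Bool) (c : Bool) (m n : ℕ) (d : List Bool)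
    (hm : m < 2 ^ l.length) (hn : n < 2 ^ l.length) :
    let y := l.foldl (fun x _ => arithStep (fun c a b => if c then a || b else a && b) x)
      (c, m, n, d)
    ofDigits y.2.2.2 y.1.toNat = ofDigits d (m + n + c.toNat) := by
  induction l generalizing c m n d with
  | nil =>
    simp at hm hn
    simp [hm, hn]
  | cons b l ih =>
    rw [List.length_cons, pow_succ] at hm hn
    simp only [List.foldl_cons]
    rw [arithStep, ih _ _ _ _ (by simp only [Nat.div2_val]; omega)
      (by simp only [Nat.div2_val]; omega)]
    simp only [ofDigits, List.foldl_cons]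
    congr 1
    have h1 := Nat.bodd_add_div2 m
    have h2 := Nat.bodd_add_div2 n
    rw [Nat.bit_val]
    generalize m.bodd = x at *
    generalize n.bodd = y at *
    cases c <;> cases x <;> cases y <;> simp at * <;> omega

/-- One step of the subtraction, by its effect on the comparison and on the difference. -/
theorem borrow_spec (c x y : Bool) {m n m' n' : ℕ} (hm : x.toNat + 2 * m' = m)
    (hn : y.toNat + 2 * n' = n) :
    (n' + (if x then c && y else c || y).toNat ≤ m' ↔ n + c.toNat ≤ m) ∧
      (n + c.toNat ≤ m → 2 * (m' - n' - (if x then c && y else c || y).toNat) +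
        (Bool.xor c (Bool.xor x y)).toNat = m - n - c.toNat) := by
  subst hm hn
  cases c <;> cases x <;> cases y <;>
    simp only [Bool.toNat_true, Bool.toNat_false, Bool.and_true, Bool.and_false, Bool.or_true,
      Bool.or_false, Bool.xor_true, Bool.xor_false, Bool.not_true, Bool.not_false, if_true,
      Bool.false_eq_true, if_false] <;> omega

/-- The digit by digit subtraction is correct; the final borrow tells whether the difference would
be negative. -/
theorem foldl_arithStep_sub (l : List Bool) (c : Bool) (m n : ℕ) (d : List Bool)
    (hm : m < 2 ^ l.length) (hn : n < 2 ^ l.length) :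
    let y := l.foldl (fun x _ => arithStep (fun c a b => if a then c && b else c || b) x)
      (c, m, n, d)
    (y.1 = true ↔ m < n + c.toNat) ∧
      (n + c.toNat ≤ m → ofDigits y.2.2.2 0 = ofDigits d (m - n - c.toNat)) := by
  induction l generalizing c m n d with
  | nil =>
    simp at hm hn
    simp [hm, hn]
    cases c <;> simp
  | cons b l ih =>
    rw [List.length_cons, pow_succ] at hm hn
    simp only [List.foldl_cons]
    obtain ⟨h3, h4⟩ := ih (if m.bodd then c && n.bodd else c || n.bodd) m.div2 n.div2
      (Bool.xor c (Bool.xor m.bodd n.bodd) :: d)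
      (by rw [Nat.div2_val]; omega) (by rw [Nat.div2_val]; omega)
    rw [arithStep]
    obtain ⟨h1, h2⟩ := borrow_spec c m.bodd n.bodd (Nat.bodd_add_div2 m) (Nat.bodd_add_div2 n)
    refine ⟨h3.trans ?_, fun h => (h4 (h1.2 h)).trans ?_⟩
    · rw [← not_le, ← not_le, h1]
    · simp only [ofDigits, List.foldl_cons]
      rw [Nat.bit_val, h2 h]

theorem lt_two_pow_bits_length (m n : ℕ) :
    m < 2 ^ (m.bits ++ n.bits).length ∧ n < 2 ^ (m.bits ++ n.bits).length := by
  rw [List.length_append, Nat.size_eq_bits_len, Nat.size_eq_bits_len]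
  exact ⟨(Nat.lt_size_self m).trans_le (Nat.pow_le_pow_right (by omega) (by omega)),
    (Nat.lt_size_self n).trans_le (Nat.pow_le_pow_right (by omega) (by omega))⟩

@[fun_prop]
theorem PolyTime.toNat {f : α → Bool} (hf : PolyTime f) : PolyTime fun a => (f a).toNat := by
  convert hf.ite (.const 1) (.const 0) with a
  cases f a <;> rfl

@[fun_prop]
theorem PolyTime.add {f g : α → ℕ} (hf : PolyTime f) (hg : PolyTime g) :
    PolyTime fun a => f a + g a := by
  have := PolyTime.arith (carry := fun c a b => if c then a || b else a && b)
    (.ite (by fun_prop) (by fun_prop) (by fun_prop)) hf hg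
  convert this.snd.snd.snd.ofDigits this.fst.toNat with a
  have h := lt_two_pow_bits_length (f a) (g a)
  rw [foldl_arithStep_add _ _ _ _ _ h.1 h.2]
  simp [StackMachine.ofDigits]

@[fun_prop]
theorem PolyTime.sub {f g : α → ℕ} (hf : PolyTime f) (hg : PolyTime g) :
    PolyTime fun a => f a - g a := by
  have := PolyTime.arith (carry := fun c a b => if a then c && b else c || b)
    (.ite (by fun_prop) (by fun_prop) (by fun_prop)) hf hg
  convert this.fst.ite (.const 0) (this.snd.snd.snd.ofDigits (.const 0)) with a
  have h := lt_two_pow_bits_length (f a) (g a)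
  obtain ⟨h1, h2⟩ := foldl_arithStep_sub _ false (f a) (g a) [] h.1 h.2
  split_ifs with hc
  · rw [h1] at hc
    simp at hc
    omega
  · rw [h1, not_lt] at hc
    rw [h2 hc]
    simp [StackMachine.ofDigits]

@[fun_prop]
theorem PolyTime.ble {f g : α → ℕ} (hf : PolyTime f) (hg : PolyTime g) :
    PolyTime fun a => Nat.ble (f a) (g a) := by
  convert (hf.sub hg).bits.isEmpty with a
  rw [Bool.eq_iff_iff, Nat.ble_eq, List.isEmpty_iff, ← List.length_eq_zero_iff,
    Nat.size_eq_bits_len, Nat.size_eq_zero]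
  omega

@[fun_prop]
theorem PolyTime.beq {f g : α → ℕ} (hf : PolyTime f) (hg : PolyTime g) :
    PolyTime fun a => Nat.beq (f a) (g a) := by
  convert (hf.ble hg).and (hg.ble hf) with a
  rw [Bool.eq_iff_iff, Nat.beq_eq, Bool.and_eq_true, Nat.ble_eq, Nat.ble_eq]
  omega

@[fun_prop]
theorem PolyTime.countP {f : α → List β} {g : α → β → Bool} (hf : PolyTime f)
    (hg : PolyTime fun x : α × β => g x.1 x.2) : PolyTime fun a => (f a).countP (g a) := by
  have : PolyTime fun x : α × ℕ × List β => x.2.2.foldl (fun n b => n + (g x.1 b).toNat) x.2.1 := by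
    refine .foldl (step := fun a n b => n + (g a b).toNat) ?_ 7 fun a b c => ?_
    · have := hg.comp (f := fun x : α × ℕ × β => (x.1, x.2.2)) (by fun_prop)
      fun_prop
    · have h1 := size_add_le b (g a c).toNat
      have h2 := size_nat_mono (show (g a c).toNat ≤ 1 from Bool.toNat_le _)
      have h3 : size 1 = 7 := rfl
      simp
      omega
  convert this.comp (f := fun a => (a, 0, f a)) (by fun_prop) with a
  simp only
  generalize f a = l
  suffices ∀ n, l.foldl (fun n b => n + (g a b).toNat) n = n + l.countP (g a) by simp [this]
  induction l with
  | nil => simp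
  | cons b l ih =>
    intro n
    rw [List.foldl_cons, ih, List.countP_cons]
    cases g a b
    · simp
    · simp; omega

@[fun_prop]
theorem PolyTime.length {f : α → List β} (hf : PolyTime f) : PolyTime fun a => (f a).length := by
  convert hf.countP (g := fun _ _ => true) (.const true) with a
  simp

end StackMachine

/-! ### Parsing and printing -/

namespace TropDiff

open Computability StackMachine ToData Function

/-- Terms whose variables are given by arbitrary numbers. -/
abbrev RawTerm : Type := ℕ × List (ℕ × ℕ)

/-- The description of one set by a certificate. -/
abbrev RawEntry : Type := List ℕ × Option ℕ

theorem encodeNat_eq_bits (n : ℕ) : encodeNat n = n.bits := by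
  have pos (p : PosNum) : encodePosNum p = (p : ℕ).bits := by
    induction p with
    | one => simp [encodePosNum]
    | bit0 p ih =>
      rw [encodePosNum, ih, PosNum.cast_bit0, ← two_mul]
      rw [Nat.bit0_bits _ (PosNum.cast_pos p).ne']
    | bit1 p ih =>
      rw [encodePosNum, ih, PosNum.cast_bit1, ← two_mul]
      rw [Nat.bit1_bits]
  have num (m : Num) : encodeNum m = (m : ℕ).bits := by
    cases m with
    | zero => simp [encodeNum]
    | pos p => exact pos p
  rw [encodeNat, num]
  simp

/-- The binary code of a number. -/
def printNat (n : ℕ) : List Γ' := n.bits.map Γ'.bit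

theorem encode_eq_printNat (n : ℕ) : encodingNatΓ'.encode n = printNat n := by
  change List.map inclusionBoolΓ' (encodeNat n) = _
  rw [encodeNat_eq_bits]
  rfl

/-- The code `(i,j)` of a factor. -/
def printFactor (q : ℕ × ℕ) : List Γ' :=
  [Γ'.bra] ++ printNat q.1 ++ [Γ'.comma] ++ printNat q.2 ++ [Γ'.ket]

/-- The code `(a(i,j)(i',j')…)` of a term. -/
def printTerm (t : RawTerm) : List Γ' :=
  [Γ'.bra] ++ printNat t.1 ++ t.2.flatMap printFactor ++ [Γ'.ket]

/-- The code of the list of the terms of an equation. -/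
def printEquation (l : List RawTerm) : List Γ' :=
  [Γ'.bra] ++ l.flatMap printTerm ++ [Γ'.ket]

/-- The code of a system; the number of variables is given by a list of that length. -/
def printSystem (S : List Unit × List (List RawTerm)) : List Γ' :=
  S.1.map (fun _ => Γ'.comma) ++ S.2.flatMap printEquation

/-- The code `((s)(s')…,m)` or `((s)(s')…)` of an entry. -/
def printEntry (x : RawEntry) : List Γ' :=
  [Γ'.bra] ++ x.1.flatMap (fun s => [Γ'.bra] ++ printNat s ++ [Γ'.ket]) ++
    x.2.toList.flatMap (fun m => [Γ'.comma] ++ printNat m) ++ [Γ'.ket]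

/-- The code of a list of entries. -/
def printCertificate (l : List RawEntry) : List Γ' := l.flatMap printEntry

/-- Codes of systems are read from right to left. The state of the parser consists of the current
depth of nesting, the variables and equations read so far, the terms of the current equation, the
factors of the current term, the order of the current factor, and the current number. -/
abbrev SystemState : Type :=
  Fin 4 × List Unit × List (List RawTerm) × List RawTerm × List (ℕ × ℕ) × ℕ × ℕ

/-- A step of the parser. Reading from right to left, `)` opens a group and `(` closes it, and
binary digits arrive with the most significant digit first. What is done with words that are not
codes does not matter. -/
def systemStep : SystemState → Γ' → SystemState
  | (0, u, L, e, f, j, k), .comma => (0, () :: u, L, e, f, j, k)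
  | (0, s), .ket => (1, s)
  | (1, s), .ket => (2, s)
  | (2, s), .ket => (3, s)
  | (3, u, L, e, f, _, k), .comma => (3, u, L, e, f, k, 0)
  | (d, u, L, e, f, j, k), .bit b => (d, u, L, e, f, j, Nat.bit b k)
  | (3, u, L, e, f, j, k), .bra => (2, u, L, e, (k, j) :: f, 0, 0)
  | (2, u, L, e, f, j, k), .bra => (1, u, L, (k, f) :: e, [], j, 0)
  | (1, u, L, e, f, j, k), .bra => (0, u, e :: L, [], f, j, k)
  | s, _ => s

/-- Recovers the number of variables (in unary) and the terms of the equations from a code. -/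
def parseSystem (w : List Γ') : List Unit × List (List RawTerm) :=
  let s := w.reverse.foldl systemStep (0, [], [], [], [], 0, 0)
  (s.2.1, s.2.2.1)

/-- The state of the parser for certificates consists of the current depth of nesting, the entries
read so far, the elements and the end of the current entry, and the current number. -/
abbrev CertificateState : Type := Fin 4 × List RawEntry × List ℕ × Option ℕ × ℕ

/-- A step of the parser for certificates, which also reads from right to left. -/
def certificateStep : CertificateState → Γ' → CertificateState
  | (0, s), .ket => (1, s)
  | (1, s), .ket => (2, s)
  | (d, l, A, t, k), .bit b => (d, l, A, t, Nat.bit b k)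
  | (1, l, A, _, k), .comma => (1, l, A, some k, 0)
  | (2, l, A, t, k), .bra => (1, l, k :: A, t, 0)
  | (1, l, A, t, _), .bra => (0, (A, t) :: l, [], none, 0)
  | s, _ => s

/-- Recovers the entries from a code. -/
def parseCertificate (c : List Γ') : List RawEntry :=
  (c.reverse.foldl certificateStep (0, [], [], none, 0)).2.1

theorem bit_foldr_bits (n : ℕ) : n.bits.foldr Nat.bit 0 = n := by
  induction n using Nat.binaryRec' with
  | zero => simp
  | bit b n h ih => rw [Nat.bits_append_bit _ _ h, List.foldr_cons, ih]

theorem foldr_systemStep_printNat (n : ℕ) (d u L e f j) :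
    (printNat n).foldr (fun x s => systemStep s x) (d, u, L, e, f, j, 0) =
      (d, u, L, e, f, j, n) := by
  conv_rhs => rw [← bit_foldr_bits n]
  rw [printNat]
  induction n.bits with
  | nil => rfl
  | cons b l ih =>
    rw [List.map_cons, List.foldr_cons, ih]
    fin_cases d <;> rfl

theorem parseSystem_printSystem (S : List Unit × List (List RawTerm)) :
    parseSystem (printSystem S) = S := by
  have ket0 (s) : systemStep (0, s) .ket = (1, s) := rfl
  have ket1 (s) : systemStep (1, s) .ket = (2, s) := rfl
  have ket2 (s) : systemStep (2, s) .ket = (3, s) := rfl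
  have comma3 (u L e f j k) :
    systemStep (3, u, L, e, f, j, k) .comma = (3, u, L, e, f, k, 0) := rfl
  have bra3 (u L e f j k) :
    systemStep (3, u, L, e, f, j, k) .bra = (2, u, L, e, (k, j) :: f, 0, 0) := rfl
  have bra2 (u L e f j k) :
    systemStep (2, u, L, e, f, j, k) .bra = (1, u, L, (k, f) :: e, [], j, 0) := rfl
  have bra1 (u L e f j k) :
    systemStep (1, u, L, e, f, j, k) .bra = (0, u, e :: L, [], f, j, k) := rfl
  have factor (q : ℕ × ℕ) (u L e f) :
      (printFactor q).foldr (fun x s => systemStep s x) (2, u, L, e, f, 0, 0) =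
        (2, u, L, e, q :: f, 0, 0) := by
    simp only [printFactor, List.foldr_append, List.foldr_cons, List.foldr_nil, ket2, comma3, bra3,
      foldr_systemStep_printNat]
  have factors (l : List (ℕ × ℕ)) (u L e) :
      (l.flatMap printFactor).foldr (fun x s => systemStep s x) (2, u, L, e, [], 0, 0) =
        (2, u, L, e, l, 0, 0) := by
    induction l with
    | nil => rfl
    | cons q l ih => rw [List.flatMap_cons, List.foldr_append, ih, factor]
  have term (t : RawTerm) (u L e) :
      (printTerm t).foldr (fun x s => systemStep s x) (1, u, L, e, [], 0, 0) =
        (1, u, L, t :: e, [], 0, 0) := by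
    simp only [printTerm, List.foldr_append, List.foldr_cons, List.foldr_nil, ket1, bra2,
      foldr_systemStep_printNat, factors]
  have terms (l : List RawTerm) (u L) :
      (l.flatMap printTerm).foldr (fun x s => systemStep s x) (1, u, L, [], [], 0, 0) =
        (1, u, L, l, [], 0, 0) := by
    induction l with
    | nil => rfl
    | cons q l ih => rw [List.flatMap_cons, List.foldr_append, ih, term]
  have equations (l : List (List RawTerm)) :
      (l.flatMap printEquation).foldr (fun x s => systemStep s x) (0, [], [], [], [], 0, 0) =
        (0, [], l, [], [], 0, 0) := by
    induction l with
    | nil => rfl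
    | cons q l ih =>
      rw [List.flatMap_cons, List.foldr_append, ih]
      simp only [printEquation, List.foldr_append, List.foldr_cons, List.foldr_nil, ket0, bra1,
        terms]
  obtain ⟨u, L⟩ := S
  rw [parseSystem, List.foldl_reverse, printSystem, List.foldr_append, equations]
  have (s) (u' : List Unit) : (u.map fun _ => Γ'.comma).foldr (fun x s => systemStep s x)
      (0, u', s) = (0, u ++ u', s) := by
    induction u with
    | nil => rfl
    | cons a u ih => rw [List.map_cons, List.foldr_cons, ih]; rfl
  rw [this]
  simp

theorem foldr_certificateStep_printNat (n : ℕ) (d l A t) :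
    (printNat n).foldr (fun x s => certificateStep s x) (d, l, A, t, 0) = (d, l, A, t, n) := by
  conv_rhs => rw [← bit_foldr_bits n]
  rw [printNat]
  induction n.bits with
  | nil => rfl
  | cons b l ih =>
    rw [List.map_cons, List.foldr_cons, ih]
    fin_cases d <;> rfl

theorem parseCertificate_printCertificate (l : List RawEntry) :
    parseCertificate (printCertificate l) = l := by
  have ket0 (s) : certificateStep (0, s) .ket = (1, s) := rfl
  have ket1 (s) : certificateStep (1, s) .ket = (2, s) := rfl
  have bra2 (l A t k) : certificateStep (2, l, A, t, k) .bra = (1, l, k :: A, t, 0) := rfl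
  have bra1 (l A t k) : certificateStep (1, l, A, t, k) .bra = (0, (A, t) :: l, [], none, 0) := rfl
  have elements (A : List ℕ) (l t) :
      (A.flatMap (fun s => [Γ'.bra] ++ printNat s ++ [Γ'.ket])).foldr
        (fun x s => certificateStep s x) (1, l, [], t, 0) = (1, l, A, t, 0) := by
    induction A with
    | nil => rfl
    | cons q l ih =>
      rw [List.flatMap_cons, List.foldr_append, ih]
      simp only [List.foldr_append, List.foldr_cons, List.foldr_nil, ket1, bra2,
        foldr_certificateStep_printNat]
  have tail (t : Option ℕ) (l) :
      (t.toList.flatMap (fun m => [Γ'.comma] ++ printNat m)).foldr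
        (fun x s => certificateStep s x) (1, l, [], none, 0) = (1, l, [], t, 0) := by
    cases t
    · rfl
    · simp only [Option.toList_some, List.flatMap_cons, List.flatMap_nil, List.append_nil,
        List.foldr_append, foldr_certificateStep_printNat]
      rfl
  have key (l : List RawEntry) : (l.flatMap printEntry).foldr (fun x s => certificateStep s x)
      (0, [], [], none, 0) = (0, l, [], none, 0) := by
    induction l with
    | nil => rfl
    | cons q l ih =>
      rw [List.flatMap_cons, List.foldr_append, ih]
      simp only [printEntry, List.foldr_append, List.foldr_cons, List.foldr_nil]
      rw [ket0, tail, elements, bra1]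
  rw [parseCertificate, List.foldl_reverse, printCertificate, key]

end TropDiff

namespace TropDiff

open Computability StackMachine ToData Function

/-! ### The verifier -/

/-- Equality of two words, decided symbol by symbol. -/
def eqWord (l l' : List Γ') : Bool :=
  let s := l.foldl (fun s x => (s.1 && !s.2.isEmpty && decide (x = s.2.headI), s.2.tail)) (true, l')
  s.1 && s.2.isEmpty

theorem eqWord_iff {l l' : List Γ'} : eqWord l l' = true ↔ l = l' := by
  have key (l l' : List Γ') (b : Bool) : (let s := l.foldl (fun s x =>
      (s.1 && !s.2.isEmpty && decide (x = s.2.headI), s.2.tail)) (b, l')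
      (s.1 && s.2.isEmpty) = true) ↔ b = true ∧ l = l' := by
    induction l generalizing b l' with
    | nil =>
      cases l'
      · simp
      · simp
    | cons x l ih =>
      rw [List.foldl_cons, ih]
      cases l' with
      | nil => simp
      | cons y l' =>
        simp only [List.isEmpty_cons, Bool.not_false, Bool.and_true, List.headI_cons,
          Bool.and_eq_true, List.tail_cons, List.cons.injEq, and_assoc]
        exact and_congr .rfl (and_congr decide_eq_true_iff .rfl)
  rw [eqWord, key]
  exact and_iff_right rfl

/-- The minimum of two values, where `none` is infinite. -/
def optMin : Option ℕ → ℕ → Option ℕ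
  | none, v => some v
  | some u, v => some (if Nat.ble u v then u else v)

/-- The sum of two values, where `none` is infinite. -/
def optAdd : Option ℕ → Option ℕ → Option ℕ
  | none, _ => none
  | some _, none => none
  | some u, some v => some (u + v)

/-- Comparison of two values, where `none` is infinite. -/
def optLe : Option ℕ → Option ℕ → Bool
  | _, none => true
  | none, some _ => false
  | some u, some v => Nat.ble u v

/-- The valuation of the set described by `x` at `j`. -/
def entryVal (x : RawEntry) (j : ℕ) : Option ℕ :=
  x.1.foldl (fun v s => if Nat.ble j s then optMin v (s - j) else v)
    (x.2.toList.foldl (fun _ m => some (m - j)) none)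

/-- The entry of number `i`. -/
def lookup (l : List RawEntry) (i : ℕ) : RawEntry :=
  (l.foldl (fun s x => (s.1 + 1, if Nat.beq s.1 i then x else s.2)) (0, ([], none))).2

/-- The value of a factor. -/
def factorVal (l : List RawEntry) (q : ℕ × ℕ) : Option ℕ := entryVal (lookup l q.1) q.2

/-- The value of a term. -/
def termVal (l : List RawEntry) (t : RawTerm) : Option ℕ :=
  t.2.foldl (fun v q => optAdd v (factorVal l q)) (some t.1)

/-- Equality of two factors. -/
def eqFactor (q q' : ℕ × ℕ) : Bool := Nat.beq q.1 q'.1 && Nat.beq q.2 q'.2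

/-- Whether two lists of factors agree up to order. -/
def eqMonomial (f f' : List (ℕ × ℕ)) : Bool :=
  (f ++ f').all fun q => Nat.beq (f.countP (eqFactor q)) (f'.countP (eqFactor q))

/-- Whether a list of terms describes an equation that is solved by the sets described by `l`: all
variables exist, no monomial is repeated, and for every term of finite value at least two terms
have at most this value. -/
def checkEquation (l : List RawEntry) (e : List RawTerm) : Bool :=
  (e.all fun t => t.2.all fun q => Nat.ble (q.1 + 1) l.length) &&
  (e.all fun t => Nat.ble (e.countP fun t' => eqMonomial t.2 t'.2) 1) &&
  e.all fun t => (termVal l t).toList.isEmpty ||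
    Nat.ble 2 (e.countP fun t' => optLe (termVal l t') (termVal l t))

/-- The verifier. That the two words are codes is checked by parsing and printing them: a word that
is not a code does not reappear. -/
def verify (w c : List Γ') : Bool :=
  eqWord (printSystem (parseSystem w)) w && eqWord (printCertificate (parseCertificate c)) c &&
    Nat.beq (parseCertificate c).length (parseSystem w).1.length &&
    (parseSystem w).2.all fun e => checkEquation (parseCertificate c) e

/-! ### The verifier runs in polynomial time -/

section

variable {α β γ : Type} [ToData α] [ToData β] [ToData γ]

theorem injective_toData_sym : Injective (toData : Γ' → Data) := by decide

theorem injective_toData_pair : Injective (toData : Γ' × Γ' → Data) := by decide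

theorem injective_toData_fin : Injective (toData : Fin 4 → Data) := by decide

theorem injective_toData_sum : Injective (toData : Γ' ⊕ Γ' → Data) := by decide

@[fun_prop]
theorem PolyTime.toList {f : α → Option β} (hf : PolyTime f) : PolyTime fun a => (f a).toList :=
  .congr_toData hf fun _ => rfl

@[fun_prop]
theorem PolyTime.printNat {f : α → ℕ} (hf : PolyTime f) : PolyTime fun a => printNat (f a) := by
  have : PolyTime fun b : Bool => Γ'.bit b := .of_finite (by decide) _
  unfold TropDiff.printNat
  fun_prop

@[fun_prop]
theorem PolyTime.printSystem {f : α → List Unit × List (List RawTerm)} (hf : PolyTime f) :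
    PolyTime fun a => printSystem (f a) := by
  unfold TropDiff.printSystem printEquation printTerm printFactor
  fun_prop

@[fun_prop]
theorem PolyTime.printCertificate {f : α → List RawEntry} (hf : PolyTime f) :
    PolyTime fun a => printCertificate (f a) := by
  unfold TropDiff.printCertificate printEntry
  fun_prop

@[fun_prop]
theorem PolyTime.eqWord {f g : α → List Γ'} (hf : PolyTime f) (hg : PolyTime g) :
    PolyTime fun a => eqWord (f a) (g a) := by
  have h : PolyTime fun x : Γ' × Γ' => decide (x.1 = x.2) := .of_finite injective_toData_pair _
  have : PolyTime fun x : Unit × (Bool × List Γ') × List Γ' => x.2.2.foldl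
      (fun s x => (s.1 && !s.2.isEmpty && decide (x = s.2.headI), s.2.tail)) x.2.1 := by
    refine .foldl (step := fun (_ : Unit) (s : Bool × List Γ') x =>
      (s.1 && !s.2.isEmpty && decide (x = s.2.headI), s.2.tail)) ?_ 0 fun a b c => ?_
    · have := h.comp (f := fun x : Unit × (Bool × List Γ') × Γ' => (x.2.2, x.2.1.2.headI))
        (by fun_prop)
      fun_prop
    · obtain ⟨b, _ | ⟨x, l⟩⟩ := b
      · simp
      · simp; omega
  have := this.comp (f := fun a => ((), (true, g a), f a)) (by fun_prop)
  unfold TropDiff.eqWord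
  fun_prop

theorem polyTime_systemStep :
    PolyTime fun x : SystemState × Γ' => systemStep x.1 x.2 := by
  have : PolyTime fun x : Fin 4 × Γ' × List Unit × List (List RawTerm) × List RawTerm ×
      List (ℕ × ℕ) × ℕ × ℕ => systemStep (x.1, x.2.2) x.2.1 := by
    refine .finite_cases injective_toData_fin fun d =>
      .finite_cases injective_toData_sym fun x => ?_
    rcases x with _ | b | _ | _ | _ <;> fin_cases d <;> simp only [systemStep] <;> fun_prop
  exact this.comp (f := fun x : SystemState × Γ' => (x.1.1, x.2, x.1.2)) (by fun_prop)

theorem size_fin_le (d : Fin 4) : size d ≤ 7 := by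
  fin_cases d <;> decide

theorem size_systemStep_le (s : SystemState) (x : Γ') : size (systemStep s x) ≤ size s + 10 := by
  obtain ⟨d, u, L, e, f, j, k⟩ := s
  have hu := size_pos u
  have hL := size_pos L
  have he := size_pos e
  have hf := size_pos f
  have hk := size_pos k
  have hj := size_pos j
  have h0 : size 0 = 1 := rfl
  have hb (b) := size_bit_le b k
  have hd := size_fin_le
  have hd' := size_pos d
  rcases x with _ | b | _ | _ | _
  · rw [systemStep] <;> simp
  · have := hb b
    rw [systemStep]
    simp only [size_prod]
    omega
  all_goals
    fin_cases d
    all_goals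
      have := hd 0
      have := hd 1
      have := hd 2
      have := hd 3
      simp only [systemStep, size_prod, size_listCons, size_listNil, size_unit, Fin.zero_eta,
        Fin.mk_one, Fin.reduceFinMk] at *
      omega

theorem polyTime_certificateStep :
    PolyTime fun x : CertificateState × Γ' => certificateStep x.1 x.2 := by
  have : PolyTime fun x : Fin 4 × Γ' × List RawEntry × List ℕ × Option ℕ × ℕ =>
      certificateStep (x.1, x.2.2) x.2.1 := by
    refine .finite_cases injective_toData_fin fun d =>
      .finite_cases injective_toData_sym fun x => ?_
    rcases x with _ | b | _ | _ | _ <;> fin_cases d <;> simp only [certificateStep] <;> fun_prop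
  exact this.comp (f := fun x : CertificateState × Γ' => (x.1.1, x.2, x.1.2)) (by fun_prop)

theorem size_certificateStep_le (s : CertificateState) (x : Γ') :
    size (certificateStep s x) ≤ size s + 10 := by
  obtain ⟨d, l, A, t, k⟩ := s
  have hl := size_pos l
  have hA := size_pos A
  have ht := size_pos t
  have hk := size_pos k
  have h0 : size 0 = 1 := rfl
  have hb (b) := size_bit_le b k
  have hd := size_fin_le
  have hd' := size_pos d
  rcases x with _ | b | _ | _ | _
  · rw [certificateStep] <;> simp
  · have := hb b
    rw [certificateStep]
    simp only [size_prod]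
    omega
  all_goals
    fin_cases d
    all_goals
      have := hd 0
      have := hd 1
      have := hd 2
      have := hd 3
      simp only [certificateStep, size_prod, size_listCons, size_listNil, size_none, size_some,
        Fin.zero_eta, Fin.mk_one, Fin.reduceFinMk] at *
      omega

@[fun_prop]
theorem PolyTime.parseSystem {f : α → List Γ'} (hf : PolyTime f) :
    PolyTime fun a => parseSystem (f a) := by
  have : PolyTime fun x : Unit × SystemState × List Γ' => x.2.2.foldl systemStep x.2.1 := by
    refine .foldl (step := fun (_ : Unit) => systemStep) (polyTime_systemStep.comp
      (f := fun x : Unit × SystemState × Γ' => (x.2.1, x.2.2)) (by fun_prop)) 10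
      fun a s x => ?_
    rw [Polynomial.eval_ofNat]
    exact size_systemStep_le s x
  have := this.comp (f := fun a => ((), (0, [], [], [], [], 0, 0), (f a).reverse)) (by fun_prop)
  unfold TropDiff.parseSystem
  fun_prop

@[fun_prop]
theorem PolyTime.parseCertificate {f : α → List Γ'} (hf : PolyTime f) :
    PolyTime fun a => parseCertificate (f a) := by
  have : PolyTime fun x : Unit × CertificateState × List Γ' =>
      x.2.2.foldl certificateStep x.2.1 := by
    refine .foldl (step := fun (_ : Unit) => certificateStep) (polyTime_certificateStep.comp
      (f := fun x : Unit × CertificateState × Γ' => (x.2.1, x.2.2)) (by fun_prop)) 10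
      fun a s x => ?_
    rw [Polynomial.eval_ofNat]
    exact size_certificateStep_le s x
  have := this.comp (f := fun a => ((), (0, [], [], none, 0), (f a).reverse)) (by fun_prop)
  unfold TropDiff.parseCertificate
  fun_prop

@[fun_prop]
theorem PolyTime.optMin {f : α → Option ℕ} {g : α → ℕ} (hf : PolyTime f) (hg : PolyTime g) :
    PolyTime fun a => optMin (f a) (g a) := by
  have : PolyTime fun x : Option ℕ × ℕ => TropDiff.optMin x.1 x.2 :=
    .option_cases (by simp only [TropDiff.optMin]; fun_prop)
      (.option_some (.ite (by fun_prop) (by fun_prop) (by fun_prop)))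
  exact this.comp (hf.pair hg)

@[fun_prop]
theorem PolyTime.optAdd {f g : α → Option ℕ} (hf : PolyTime f) (hg : PolyTime g) :
    PolyTime fun a => optAdd (f a) (g a) := by
  have : PolyTime fun x : Option ℕ × Option ℕ => TropDiff.optAdd x.1 x.2 := by
    refine .option_cases (.const none) ?_
    have : PolyTime fun x : Option ℕ × ℕ => TropDiff.optAdd (some x.2) x.1 :=
      .option_cases (.const none) (.option_some (by fun_prop))
    exact this.comp (f := fun x : ℕ × Option ℕ => (x.2, x.1)) (by fun_prop)
  exact this.comp (hf.pair hg)

@[fun_prop]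
theorem PolyTime.optLe {f g : α → Option ℕ} (hf : PolyTime f) (hg : PolyTime g) :
    PolyTime fun a => optLe (f a) (g a) := by
  have : PolyTime fun x : Option ℕ × Option ℕ => TropDiff.optLe x.2 x.1 := by
    refine .option_cases ((PolyTime.const true).congr_toData fun o => by cases o <;> rfl) ?_
    have : PolyTime fun x : Option ℕ × ℕ => TropDiff.optLe x.1 (some x.2) :=
      .option_cases (.const false) (by simp only [TropDiff.optLe]; fun_prop)
    exact this.comp (f := fun x : ℕ × Option ℕ => (x.2, x.1)) (by fun_prop)
  exact this.comp (hg.pair hf)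

theorem size_optMin_le (u : Option ℕ) (v : ℕ) : size (optMin u v) ≤ size u + size v + 2 := by
  cases u with
  | none => simp [optMin]
  | some u =>
    simp only [optMin, size_some]
    split_ifs <;> omega

theorem size_optAdd_le (u v : Option ℕ) : size (optAdd u v) ≤ size u + size v := by
  cases u with
  | none => simp [optAdd]
  | some u =>
    cases v with
    | none => simp [optAdd]
    | some v =>
      have := size_add_le u v
      simp [optAdd]
      omega

@[fun_prop]
theorem PolyTime.entryVal {f : α → RawEntry} {g : α → ℕ} (hf : PolyTime f) (hg : PolyTime g) :
    PolyTime fun a => entryVal (f a) (g a) := by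
  have h1 : PolyTime fun x : ℕ × Option ℕ × List ℕ => x.2.2.foldl
      (fun v s => if Nat.ble x.1 s then TropDiff.optMin v (s - x.1) else v) x.2.1 := by
    refine .foldl (step := fun j v s => if Nat.ble j s then TropDiff.optMin v (s - j) else v)
      (.ite (by fun_prop) (by fun_prop) (by fun_prop)) (.X + 2) fun j v s => ?_
    have h2 := size_optMin_le v (s - j)
    have h3 := size_nat_mono (Nat.sub_le s j)
    simp only [Polynomial.eval_add, Polynomial.eval_X, Polynomial.eval_ofNat]
    split_ifs <;> omega
  have h2 : PolyTime fun x : ℕ × Option ℕ × List ℕ => x.2.2.foldl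
      (fun _ m => some (m - x.1)) x.2.1 := by
    refine .foldl (step := fun j _ m => some (m - j)) (by fun_prop) (.X + 2) fun j v s => ?_
    have h3 := size_nat_mono (Nat.sub_le s j)
    simp
    omega
  have h3 := h2.comp (f := fun a => (g a, none, (f a).2.toList)) (by fun_prop)
  unfold TropDiff.entryVal
  exact h1.comp (f := fun a => (g a, _, (f a).1)) (by fun_prop)

@[fun_prop]
theorem PolyTime.lookup {f : α → List RawEntry} {g : α → ℕ} (hf : PolyTime f) (hg : PolyTime g) :
    PolyTime fun a => lookup (f a) (g a) := by
  have : PolyTime fun x : ℕ × (ℕ × RawEntry) × List RawEntry => x.2.2.foldl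
      (fun s y => (s.1 + 1, if Nat.beq s.1 x.1 then y else s.2)) x.2.1 := by
    refine .foldl (step := fun i s y => (s.1 + 1, if Nat.beq s.1 i then y else s.2))
      (.pair (by fun_prop) (.ite (by fun_prop) (by fun_prop) (by fun_prop))) (.X + 7)
      fun i s y => ?_
    have h2 := size_add_le s.1 1
    have h3 : size 1 = 7 := rfl
    simp only [Polynomial.eval_add, Polynomial.eval_X, Polynomial.eval_ofNat]
    rw [size_prod, size_prod s]
    dsimp only
    split_ifs <;> omega
  have := this.comp (f := fun a => (g a, (0, ([], none)), f a)) (by fun_prop)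
  unfold TropDiff.lookup
  fun_prop

@[fun_prop]
theorem PolyTime.factorVal {f : α → List RawEntry} {g : α → ℕ × ℕ} (hf : PolyTime f)
    (hg : PolyTime g) : PolyTime fun a => factorVal (f a) (g a) := by
  unfold TropDiff.factorVal
  fun_prop

@[fun_prop]
theorem PolyTime.termVal {f : α → List RawEntry} {g : α → RawTerm} (hf : PolyTime f)
    (hg : PolyTime g) : PolyTime fun a => termVal (f a) (g a) := by
  have h : PolyTime fun x : List RawEntry × ℕ × ℕ => TropDiff.factorVal x.1 x.2 := by fun_prop
  obtain ⟨p, hp⟩ := h.size_le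
  have : PolyTime fun x : List RawEntry × Option ℕ × List (ℕ × ℕ) => x.2.2.foldl
      (fun v q => TropDiff.optAdd v (TropDiff.factorVal x.1 q)) x.2.1 := by
    refine .foldl (step := fun l v q => TropDiff.optAdd v (TropDiff.factorVal l q)) (by fun_prop)
      (p.comp (.X + 1)) fun l v x => ?_
    refine (size_optAdd_le v (TropDiff.factorVal l x)).trans (Nat.add_le_add_left ?_ _)
    have h2 := hp (l, x)
    rw [Polynomial.eval_comp, Polynomial.eval_add, Polynomial.eval_X, Polynomial.eval_one,
      ← (size_prod (l, x) :)]
    exact h2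
  exact this.comp (f := fun a => (f a, some (g a).1, (g a).2)) (by fun_prop)

@[fun_prop]
theorem PolyTime.eqFactor {f g : α → ℕ × ℕ} (hf : PolyTime f) (hg : PolyTime g) :
    PolyTime fun a => eqFactor (f a) (g a) := by
  unfold TropDiff.eqFactor
  fun_prop

@[fun_prop]
theorem PolyTime.eqMonomial {f g : α → List (ℕ × ℕ)} (hf : PolyTime f) (hg : PolyTime g) :
    PolyTime fun a => eqMonomial (f a) (g a) := by
  unfold TropDiff.eqMonomial
  fun_prop

@[fun_prop]
theorem PolyTime.checkEquation {f : α → List RawEntry} {g : α → List RawTerm} (hf : PolyTime f)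
    (hg : PolyTime g) : PolyTime fun a => checkEquation (f a) (g a) := by
  unfold TropDiff.checkEquation
  fun_prop

theorem polyTime_verify : PolyTime fun x : List Γ' × List Γ' => verify x.1 x.2 := by
  unfold verify
  fun_prop

end

end TropDiff

/-! ### From functions on trees to machines -/

namespace StackMachine

open Turing Function Computability ToData

/-- Splits a word over the disjoint union of two alphabets, given in reverse order. -/
def splitWord (z : List (Γ' ⊕ Γ')) : List Γ' × List Γ' :=
  z.foldl (fun s x => match x with
    | .inl a => (a :: s.1, s.2)
    | .inr a => (s.1, a :: s.2)) ([], [])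

theorem splitWord_reverse (w c : List Γ') :
    splitWord (w.map Sum.inl ++ c.map Sum.inr).reverse = (w, c) := by
  rw [splitWord, List.foldl_reverse, List.foldr_append]
  have h1 : (c.map Sum.inr).foldr (fun (x : Γ' ⊕ Γ') (s : List Γ' × List Γ') => match x with
    | .inl a => (a :: s.1, s.2)
    | .inr a => (s.1, a :: s.2)) ([], []) = ([], c) := by
    induction c with
    | nil => rfl
    | cons a c ih => rw [List.map_cons, List.foldr_cons, ih]
  rw [h1]
  induction w with
  | nil => rfl
  | cons a w ih => rw [List.map_cons, List.foldr_cons, ih]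

theorem polyTime_splitWord : PolyTime splitWord := by
  have h1 : PolyTime fun x : Γ' ⊕ Γ' => (x.isLeft, Sum.elim id id x) :=
    .of_finite TropDiff.injective_toData_sum _
  have h2 : PolyTime fun x : Bool × Γ' × List Γ' × List Γ' =>
      if x.1 then (x.2.1 :: x.2.2.1, x.2.2.2) else (x.2.2.1, x.2.1 :: x.2.2.2) :=
    .ite (by fun_prop) (by fun_prop) (by fun_prop)
  have : PolyTime fun x : Unit × (List Γ' × List Γ') × List (Γ' ⊕ Γ') =>
      x.2.2.foldl (fun s x => match x with
        | .inl a => (a :: s.1, s.2)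
        | .inr a => (s.1, a :: s.2)) x.2.1 := by
    refine .foldl (step := fun (_ : Unit) (s : List Γ' × List Γ') (x : Γ' ⊕ Γ') => match x with
        | .inl a => (a :: s.1, s.2)
        | .inr a => (s.1, a :: s.2)) ?_ .X fun a s x => ?_
    · have h3 := h1.comp (f := fun x : Unit × (List Γ' × List Γ') × (Γ' ⊕ Γ') => x.2.2)
        (by fun_prop)
      convert h2.comp (f := fun x : Unit × (List Γ' × List Γ') × (Γ' ⊕ Γ') =>
        (x.2.2.isLeft, Sum.elim id id x.2.2, x.2.1))
        (h3.fst.pair (h3.snd.pair (by fun_prop))) with x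
      rcases x.2.2 with a | a <;> rfl
    · have hl (a : Γ') : size (Sum.inl a : Γ' ⊕ Γ') = size a + 6 := by
        rw [size]; simp [toData, size]; omega
      have hr (a : Γ') : size (Sum.inr a : Γ' ⊕ Γ') = size a + 6 := by
        rw [size]; simp [toData, size]; omega
      rcases x with x | x
      · simp [hl]; omega
      · simp [hr]; omega
  exact this.comp (f := fun z => ((), ([], []), z)) (by fun_prop)

/-- Moves the input to `main`, as the code of a list in reverse order. -/
def readInput : Prog Sym :=
  .seq (.push .main (some false : Option Bool))
    (.loop .inp (fun x : Option (Γ' ⊕ Γ') => x.isSome) (.pop .inp fun x : Option (Γ' ⊕ Γ') =>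
      match x with
      | some x => .seq (pushTree (toData x)) (.push .main (some true : Option Bool))
      | none => .skip))

theorem size_sum_le (x : Γ' ⊕ Γ') : size x ≤ 20 := by
  have : ∀ x : Γ' ⊕ Γ', (toData x).size ≤ 20 := by decide
  exact this x

theorem exec_readInput (z : List (Γ' ⊕ Γ')) :
    Exec readInput (store z [] [] [] []) (store [] [] (toData z.reverse).code [] [])
      (23 * z.length + 2) := by
  have key (y : List (Γ' ⊕ Γ')) : Exec
      (.loop .inp (fun x : Option (Γ' ⊕ Γ') => x.isSome) (.pop .inp fun x : Option (Γ' ⊕ Γ') =>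
        match x with
        | some x => .seq (pushTree (toData x)) (.push .main (some true : Option Bool))
        | none => .skip)) (store z [] (toData y).code [] [])
      (store [] [] (toData (z.reverse ++ y)).code [] []) (23 * z.length + 1) := by
    induction z generalizing y with
    | nil => exact .loop_done rfl le_rfl
    | cons x z ih =>
      have h := ih (x :: y)
      rw [List.reverse_cons, List.append_assoc]
      refine .loop_continue rfl (exec_pop_inp ((exec_pushTree _).then (exec_push_main _))) h ?_
      have : (toData x).size ≤ 20 := size_sum_le x
      rw [List.length_cons]
      omega
  have := key []
  rw [List.append_nil] at this
  exact ((exec_push_main _).then this).mono (by omega)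

/-- Moves a truth value from `main` to the output. -/
def writeOutput : Prog Sym :=
  .pop .main fun _ => .pop .main fun x : Option (Option Bool) => .pop .main fun _ =>
    .pop .main fun _ => .pop .main fun _ => .push .out (x == some (some true) : Bool)

theorem exec_writeOutput (b : Bool) : Exec writeOutput (store [] [] (toData b).code [] [])
    (store [] [b] [] [] []) 6 := by
  cases b <;>
  exact exec_pop_main (exec_pop_main (exec_pop_main (exec_pop_main (exec_pop_main
    (exec_push_out _)))))

/-- A relation that is decided by a polynomial time function on trees is decidable in polynomial
time. -/
theorem PolyTime.polyTimeDecidable {V : List Γ' → List Γ' → Bool}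
    (hV : PolyTime fun x : List Γ' × List Γ' => V x.1 x.2) {R : List Γ' → List Γ' → Prop}
    (hR : ∀ w c, V w c = true ↔ R w c) : Complexity.PolyTimeDecidable R := by
  have h := hV.comp polyTime_splitWord
  obtain ⟨P, q, hP⟩ := h
  refine ⟨fun x => V x.1 x.2, nonempty_computableInPolyTime
    (.seq readInput (.seq P writeOutput)) Stk.inp Stk.out (Equiv.refl _) (Equiv.refl _)
    (23 * .X + 8 + q.comp (21 * .X + 1)) fun ⟨w, c⟩ => ?_, fun w c => hR w c⟩
  have e : (encodingProd (encodingList Γ') (encodingList Γ')).encode (w, c) =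
      w.map Sum.inl ++ c.map Sum.inr := rfl
  rw [e]
  set z := w.map Sum.inl ++ c.map Sum.inr with hz
  have h1 := hP z.reverse [] [] [] [] []
  have h5 : splitWord z.reverse = (w, c) := by rw [hz, splitWord_reverse]
  beta_reduce at h1
  rw [h5, List.append_nil, List.append_nil] at h1
  have e0 : (fun _ => [] : ∀ k, List (Sym k)) = store [] [] [] [] [] := by
    funext k; cases k <;> rfl
  have e1 : (z.map (Equiv.refl (Γ' ⊕ Γ')).symm) = z := by simp
  have e2 : (encodeBool (V w c)).map (Equiv.refl Bool).symm = [V w c] := by simp [encodeBool]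
  have h2 := (exec_readInput z).then (h1.then (exec_writeOutput _))
  refine Exec.mono' (s' := store [] [V w c] [] [] []) ?_ ?_ (le_refl _)
  · rw [e0]
    erw [e1, update_inp]
    refine h2.mono ?_
    -- All symbols have size at most 20, so the tree of the input has linear size.
    have h3 : size z.reverse ≤ 21 * z.length + 1 := by
      rw [size_reverse]
      clear_value z
      clear h1 h2 e1 hz e h5
      induction z with
      | nil => simp
      | cons x z ih =>
        have := size_sum_le x
        rw [size_listCons, List.length_cons]
        omega
    have h4 := eval_mono q h3
    simp
    omega
  · rw [e0]
    erw [e2, update_out]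

end StackMachine

namespace TropDiff

open Computability StackMachine Function

/-! ### Correctness of the verifier -/

/-- The value denoted by an optional number, where `none` is infinite. -/
def toENat : Option ℕ → ℕ∞
  | none => ⊤
  | some n => n

theorem toENat_optMin (u : Option ℕ) (v : ℕ) : toENat (optMin u v) = min (toENat u) v := by
  cases u with
  | none => simp [toENat, optMin]
  | some u =>
    simp only [toENat, optMin, Nat.ble_eq]
    split_ifs with h
    · rw [min_eq_left (by exact_mod_cast h)]
    · rw [min_eq_right (by exact_mod_cast (not_le.1 h).le)]

theorem toENat_optAdd (u v : Option ℕ) : toENat (optAdd u v) = toENat u + toENat v := by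
  cases u <;> cases v <;> simp [toENat, optAdd]

theorem optLe_iff (u v : Option ℕ) : optLe u v = true ↔ toENat u ≤ toENat v := by
  cases u <;> cases v <;> simp [toENat, optLe]

theorem isEmpty_toList_iff (u : Option ℕ) : u.toList.isEmpty = true ↔ toENat u = ⊤ := by
  cases u <;> simp [toENat]

theorem le_val_iff {S : Set ℕ} {j : ℕ} {k : ℕ∞} :
    k ≤ val S j ↔ ∀ s ∈ S, j ≤ s → k ≤ ((s - j : ℕ) : ℕ∞) := by
  simp [val, and_imp]

theorem toENat_entryVal (x : RawEntry) (j : ℕ) :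
    toENat (entryVal x j) = val {s | s ∈ x.1 ∨ ∃ m ∈ x.2, m ≤ s} j := by
  obtain ⟨A, t⟩ := x
  refine eq_of_forall_le_iff fun k => ?_
  have key (v : Option ℕ) : k ≤ toENat (A.foldl (fun v s => if Nat.ble j s then optMin v (s - j)
      else v) v) ↔ k ≤ toENat v ∧ ∀ s ∈ A, j ≤ s → k ≤ ((s - j : ℕ) : ℕ∞) := by
    induction A generalizing v with
    | nil => simp
    | cons s A ih =>
      rw [List.foldl_cons, ih]
      simp only [Nat.ble_eq, List.forall_mem_cons]
      split_ifs with h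
      · rw [toENat_optMin, le_min_iff, and_assoc]
        simp [h]
      · simp [h]
  rw [entryVal, key, le_val_iff]
  simp only [Set.mem_ofPred_eq, or_imp, forall_and]
  rw [and_comm]
  refine and_congr_right fun _ => ?_
  cases t with
  | none => simp [toENat]
  | some m =>
    simp only [toENat, Option.toList_some, List.foldl_cons, List.foldl_nil, Option.mem_def,
      Option.some.injEq, exists_eq_left']
    constructor
    · intro h s hs _
      exact h.trans (by exact_mod_cast Nat.sub_le_sub_right hs j)
    · intro h
      refine (h (max m j) (le_max_left _ _) (le_max_right _ _)).trans ?_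
      norm_cast
      omega

theorem lookup_eq_getElem (l : List RawEntry) (i : ℕ) (hi : i < l.length) :
    lookup l i = l[i] := by
  have key (l : List RawEntry) (k : ℕ) (r : RawEntry) :
      (l.foldl (fun s x => (s.1 + 1, if Nat.beq s.1 i then x else s.2)) (k, r)).2 =
        if k ≤ i then l.getD (i - k) r else r := by
    induction l generalizing k r with
    | nil => simp
    | cons x l ih =>
      rw [List.foldl_cons, ih]
      simp only [Nat.beq_eq]
      rcases lt_trichotomy k i with h | h | h
      · obtain ⟨d, hd⟩ := Nat.exists_eq_add_of_lt h
        rw [if_neg h.ne, if_pos (Nat.succ_le_of_lt h), if_pos h.le, show i - (k + 1) = d by omega,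
          show i - k = d + 1 by omega, List.getD_cons_succ]
      · subst h
        simp
      · rw [if_neg (by omega), if_neg (by omega), if_neg (by omega)]
  rw [lookup, key]
  simp [hi]

theorem eqFactor_iff (q q' : ℕ × ℕ) : eqFactor q q' = true ↔ q = q' := by
  simp [eqFactor, Prod.ext_iff]

theorem eqMonomial_iff (f f' : List (ℕ × ℕ)) : eqMonomial f f' = true ↔ f.Perm f' := by
  have h (q : ℕ × ℕ) (f : List (ℕ × ℕ)) : f.countP (eqFactor q) = f.count q := by
    rw [List.count]
    refine List.countP_congr fun q' _ => ?_
    rw [eqFactor_iff, beq_iff_eq, eq_comm]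
  simp only [eqMonomial, List.all_eq_true, Nat.beq_eq, h, List.perm_iff_count]
  refine ⟨fun H q => ?_, fun H q _ => H q⟩
  by_cases hq : q ∈ f ++ f'
  · exact H q hq
  · rw [List.mem_append, not_or] at hq
    rw [List.count_eq_zero_of_not_mem hq.1, List.count_eq_zero_of_not_mem hq.2]

section Raw

variable {n : ℕ}

/-- A factor with its variable regarded as a number. -/
def rawFactor (q : Fin n × ℕ) : ℕ × ℕ := (q.1, q.2)

theorem injective_rawFactor : Injective (rawFactor (n := n)) := by
  rintro ⟨i, j⟩ ⟨i', j'⟩ h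
  simp only [rawFactor, Prod.mk.injEq] at h
  rw [Fin.ext h.1, h.2]

/-- A term with its variables regarded as numbers. -/
def rawTerm (t : ℕ × List (Fin n × ℕ)) : RawTerm := (t.1, t.2.map rawFactor)

theorem encodeTerm_eq (t : ℕ × List (Fin n × ℕ)) : encodeTerm t = printTerm (rawTerm t) := by
  simp only [encodeTerm, printTerm, rawTerm, List.flatMap_map, encode_eq_printNat]
  congr 3
  funext q
  simp only [encodeFactor, printFactor, rawFactor, encode_eq_printNat]

theorem encodeSystem_eq (L : List (List (ℕ × List (Fin n × ℕ)))) :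
    encodeSystem L = printSystem (List.replicate n (), L.map (List.map rawTerm)) := by
  simp only [encodeSystem, printSystem, List.map_replicate, List.flatMap_map]
  congr 2
  funext l
  simp only [encodeEquation, printEquation, List.flatMap_map]
  congr 3
  funext t
  exact encodeTerm_eq t

/-- The list of the entries of a certificate. -/
def Certificate.toList (C : Certificate n) : List RawEntry :=
  List.ofFn fun i => (C.initial i, C.tail i)

theorem Certificate.encode_eq (C : Certificate n) : C.encode = printCertificate C.toList := by
  rw [Certificate.encode, printCertificate, Certificate.toList, List.flatMap, List.map_ofFn]
  congr 2
  funext i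
  simp only [Certificate.encodeEntry, Function.comp, printEntry, encode_eq_printNat]
  cases C.tail i <;> simp

theorem toENat_termVal (C : Certificate n) (t : ℕ × List (Fin n × ℕ)) :
    toENat (termVal C.toList (rawTerm t)) =
      t.1 + (t.2.map fun q => val (C.sets q.1) q.2).sum := by
  obtain ⟨a, f⟩ := t
  have key (v : Option ℕ) : toENat ((f.map rawFactor).foldl
      (fun v q => optAdd v (factorVal C.toList q)) v) =
      toENat v + (f.map fun q => val (C.sets q.1) q.2).sum := by
    induction f generalizing v with
    | nil => simp
    | cons q f ih =>
      have hq : q.1.val < C.toList.length := by simp [Certificate.toList]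
      rw [List.map_cons, List.foldl_cons, ih, toENat_optAdd, factorVal, toENat_entryVal,
        List.map_cons, List.sum_cons, add_assoc]
      congr 3
      simp only [rawFactor]
      rw [lookup_eq_getElem _ _ hq]
      simp only [Certificate.toList, List.getElem_ofFn]
      rfl
  rw [termVal, rawTerm, key]
  rfl

theorem two_le_countP_iff {α : Type} {l : List α} (hl : l.Nodup) (p : α → Bool) :
    2 ≤ l.countP p ↔ ∃ x ∈ l, ∃ y ∈ l, x ≠ y ∧ p x = true ∧ p y = true := by
  classical
  rw [List.countP_eq_length_filter, ← List.toFinset_card_of_nodup (hl.filter p)]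
  rw [← Nat.lt_iff_add_one_le, Finset.one_lt_card]
  simp only [List.mem_toFinset, List.mem_filter]
  grind

theorem termVal_eq_value {e : Equation n} {l : List (ℕ × List (Fin n × ℕ))} (h : e.IsListing l)
    (C : Certificate n) {t : ℕ × List (Fin n × ℕ)} (ht : t ∈ l) :
    toENat (termVal C.toList (rawTerm t)) = e.value C.sets (t.2 : Monomial n) := by
  rw [toENat_termVal, Equation.value, h.2.2 t ht]
  simp

theorem nodup_iff_check (l : List (ℕ × List (Fin n × ℕ))) :
    (l.map fun t => (t.2 : Monomial n)).Nodup ↔ ((l.map rawTerm).all fun t =>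
      Nat.ble ((l.map rawTerm).countP fun t' => eqMonomial t.2 t'.2) 1) = true := by
  rw [List.nodup_iff_count_le_one]
  simp only [List.all_map, List.all_eq_true, Function.comp, Nat.ble_eq, List.countP_map]
  have h (t : ℕ × List (Fin n × ℕ)) :
      l.countP ((fun t' => eqMonomial (rawTerm t).2 t'.2) ∘ rawTerm) =
        (l.map fun t => (t.2 : Monomial n)).count (t.2 : Monomial n) := by
    rw [List.count, List.countP_map]
    refine List.countP_congr fun t' _ => ?_
    simp only [Function.comp, eqMonomial_iff, rawTerm, beq_iff_eq, Multiset.coe_eq_coe]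
    rw [List.map_perm_map_iff injective_rawFactor, List.perm_comm]
  refine ⟨fun H t _ => (h t).trans_le (H _), fun H P => ?_⟩
  by_cases hP : P ∈ l.map fun t => (t.2 : Monomial n)
  · obtain ⟨t, ht, rfl⟩ := List.mem_map.1 hP
    exact (h t).symm.trans_le (H t ht)
  · rw [List.count_eq_zero_of_not_mem hP]
    exact Nat.zero_le _

/-- The minimum is infinite or attained twice iff for every term of finite value at least two terms
have at most this value. -/
theorem isSolution_iff_check {e : Equation n} {l : List (ℕ × List (Fin n × ℕ))}
    (h : e.IsListing l) (C : Certificate n) : e.IsSolution C.sets ↔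
      ((l.map rawTerm).all fun t => (termVal C.toList t).toList.isEmpty ||
        Nat.ble 2 ((l.map rawTerm).countP fun t' =>
          optLe (termVal C.toList t') (termVal C.toList t))) = true := by
  have hl : l.Nodup := List.Nodup.of_map _ h.1
  have hinj := List.inj_on_of_nodup_map h.1
  simp only [List.all_map, List.all_eq_true, Function.comp, Nat.ble_eq, List.countP_map,
    Bool.or_eq_true, isEmpty_toList_iff, two_le_countP_iff hl, optLe_iff]
  have hval {t} (ht : t ∈ l) := termVal_eq_value h C ht
  have hle {P} (hP : P ∈ e.family) : e.minValue C.sets ≤ e.value C.sets P :=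
    iInf₂_le P hP
  constructor
  · rintro (H | ⟨P, hP, Q, hQ, hPQ, hP', hQ'⟩) t ht
    · left
      have := hle ((h.2.1 _).2 ⟨t, ht, rfl⟩)
      rw [H, top_le_iff] at this
      rw [hval ht, this]
    · right
      obtain ⟨p, hp, rfl⟩ := (h.2.1 P).1 hP
      obtain ⟨q, hq, rfl⟩ := (h.2.1 Q).1 hQ
      refine ⟨p, hp, q, hq, fun hpq => hPQ (by rw [hpq]), ?_, ?_⟩
      · rw [hval hp, hval ht, hP']
        exact hle ((h.2.1 _).2 ⟨t, ht, rfl⟩)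
      · rw [hval hq, hval ht, hQ']
        exact hle ((h.2.1 _).2 ⟨t, ht, rfl⟩)
  · intro H
    by_cases hmin : e.minValue C.sets = ⊤
    · exact .inl hmin
    · right
      have hne : e.family.Nonempty := by
        rw [Finset.nonempty_iff_ne_empty]
        intro h0
        simp [Equation.minValue, h0] at hmin
      obtain ⟨P, hP, hPm⟩ := Finset.exists_min_image e.family (e.value C.sets) hne
      have hPmin : e.value C.sets P = e.minValue C.sets :=
        le_antisymm (le_iInf₂ hPm) (hle hP)
      obtain ⟨t, ht, rfl⟩ := (h.2.1 P).1 hP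
      rcases H t ht with h1 | ⟨x, hx, y, hy, hxy, hx', hy'⟩
      · rw [hval ht, hPmin] at h1
        exact absurd h1 hmin
      · rw [hval ht, hPmin] at hx' hy'
        rw [hval hx] at hx'
        rw [hval hy] at hy'
        have hxf := (h.2.1 _).2 ⟨x, hx, rfl⟩
        have hyf := (h.2.1 _).2 ⟨y, hy, rfl⟩
        exact ⟨_, hxf, _, hyf, fun hxy' => hxy (hinj hx hy hxy'), le_antisymm hx' (hle hxf),
          le_antisymm hy' (hle hyf)⟩

/-- A list of terms with different monomials lists an equation. -/
theorem exists_isListing {l : List (ℕ × List (Fin n × ℕ))}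
    (h : (l.map fun t => (t.2 : Monomial n)).Nodup) : ∃ e : Equation n, e.IsListing l := by
  classical
  have hinj := List.inj_on_of_nodup_map h
  refine ⟨⟨(l.map fun t => (t.2 : Monomial n)).toFinset, fun P =>
    if hP : ∃ t ∈ l, (t.2 : Monomial n) = P then hP.choose.1 else 0⟩, h, fun P => by simp,
    fun t ht => ?_⟩
  have hP : ∃ t' ∈ l, (t'.2 : Monomial n) = (t.2 : Monomial n) := ⟨t, ht, rfl⟩
  have := hinj hP.choose_spec.1 ht hP.choose_spec.2
  simp only [hP, dif_pos, this]

theorem exists_rawTerm {l : List RawTerm} (h : ∀ t ∈ l, ∀ q ∈ t.2, q.1 < n) :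
    ∃ l' : List (ℕ × List (Fin n × ℕ)), l'.map rawTerm = l := by
  have hf (f : List (ℕ × ℕ)) (hf : ∀ q ∈ f, q.1 < n) :
      ∃ f' : List (Fin n × ℕ), f'.map rawFactor = f := by
    have : f ∈ Set.range (List.map (rawFactor (n := n))) := by
      rw [Set.range_list_map]
      exact fun q hq => ⟨(⟨q.1, hf q hq⟩, q.2), rfl⟩
    exact this
  have : l ∈ Set.range (List.map (rawTerm (n := n))) := by
    rw [Set.range_list_map]
    intro t ht
    obtain ⟨f', hf'⟩ := hf t.2 (h t ht)
    exact ⟨(t.1, f'), by rw [rawTerm, hf']⟩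
  exact this

end Raw

theorem checkEquation_iff {n : ℕ} (C : Certificate n) (l : List (ℕ × List (Fin n × ℕ))) :
    checkEquation C.toList (l.map rawTerm) = true ↔
      ∃ e : Equation n, e.IsListing l ∧ e.IsSolution C.sets := by
  have h0 : ((l.map rawTerm).all fun t => t.2.all fun q =>
      Nat.ble (q.1 + 1) C.toList.length) = true := by
    simp [rawTerm, rawFactor, Certificate.toList]
  rw [checkEquation, Bool.and_eq_true, Bool.and_eq_true, ← nodup_iff_check]
  constructor
  · rintro ⟨⟨_, h1⟩, h2⟩
    obtain ⟨e, he⟩ := exists_isListing h1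
    exact ⟨e, he, (isSolution_iff_check he C).2 h2⟩
  · rintro ⟨e, he, hs⟩
    exact ⟨⟨h0, he.1⟩, (isSolution_iff_check he C).1 hs⟩

theorem verify_iff (w c : List Γ') : verify w c = true ↔ Certifies w c := by
  simp only [verify, Bool.and_eq_true, eqWord_iff, List.all_eq_true, Nat.beq_eq]
  constructor
  · rintro ⟨⟨⟨hw, hc⟩, hn⟩, hL⟩
    generalize parseSystem w = S at *
    generalize parseCertificate c = l at *
    obtain ⟨u, L'⟩ := S
    subst hw hc
    obtain ⟨C, hC⟩ : ∃ C : Certificate l.length, C.toList = l :=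
      ⟨⟨fun i => l[i].1, fun i => l[i].2⟩, by simp [Certificate.toList]⟩
    have hu : u = List.replicate l.length () := by
      rw [hn]
      exact List.eq_replicate_of_mem fun _ _ => rfl
    obtain ⟨L, rfl⟩ : ∃ L : List (List (ℕ × List (Fin l.length × ℕ))),
        L.map (List.map rawTerm) = L' := by
      have : L' ∈ Set.range (List.map (List.map (rawTerm (n := l.length)))) := by
        rw [Set.range_list_map]
        intro e he
        have := hL e he
        simp only [checkEquation, Bool.and_eq_true, List.all_eq_true, Nat.ble_eq] at this
        exact exists_rawTerm this.1.1
      exact this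
    have h1 : ∀ e ∈ L, ∃ e' : Equation l.length, e'.IsListing e ∧ e'.IsSolution C.sets :=
      fun e he => (checkEquation_iff C e).1 (by rw [hC]; exact hL _ (List.mem_map_of_mem he))
    have h2 : ∃ E : System l.length, List.Forall₂ Equation.IsListing E L ∧
        E.IsSolution C.sets := by
      clear hL hn
      induction L with
      | nil => exact ⟨[], .nil, by simp [System.IsSolution]⟩
      | cons e L ih =>
        obtain ⟨E, hE, hs⟩ := ih fun e he => h1 e (List.mem_cons_of_mem _ he)
        obtain ⟨e', he', hs'⟩ := h1 e (by simp)
        exact ⟨e' :: E, .cons he' hE, by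
          simpa [System.IsSolution, hs'] using hs⟩
    obtain ⟨E, hE, hs⟩ := h2
    exact ⟨_, E, C, ⟨L, hE, by rw [encodeSystem_eq, hu]⟩, by rw [Certificate.encode_eq, hC], hs⟩
  · rintro ⟨n, E, C, ⟨L, hL, rfl⟩, rfl, hs⟩
    rw [encodeSystem_eq, Certificate.encode_eq, parseSystem_printSystem,
      parseCertificate_printCertificate]
    refine ⟨⟨⟨rfl, rfl⟩, by simp [Certificate.toList]⟩, ?_⟩
    simp only [List.forall_mem_map]
    intro l hl
    rw [checkEquation_iff]
    obtain ⟨k, hk, rfl⟩ := List.mem_iff_getElem.1 hl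
    have hk' : k < E.length := hL.length_eq ▸ hk
    exact ⟨E[k], hL.get hk' hk, hs _ (List.getElem_mem _)⟩

theorem polyTimeDecidable_certifies : Complexity.PolyTimeDecidable Certifies :=
  polyTime_verify.polyTimeDecidable verify_iff

end TropDiff

/-! ### Small integer points in cells of hyperplane arrangements -/

namespace SmallPoint

open Module

variable {n : ℕ}

/-- The linear form with the given integer coefficients. -/
def form (a : Fin n → ℤ) : (Fin n → ℚ) →ₗ[ℚ] ℚ := ∑ i, (a i : ℚ) • LinearMap.proj i

theorem form_apply (a : Fin n → ℤ) (x : Fin n → ℚ) : form a x = ∑ i, (a i : ℚ) * x i := by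
  simp [form]

theorem form_intCast (a u : Fin n → ℤ) : form a (fun i => (u i : ℚ)) = (∑ i, a i * u i : ℤ) := by
  simp [form_apply]

/-- The point `x` satisfies the inequalities `c.2 ≤ form c.1 x`. -/
def Feasible (C : Finset ((Fin n → ℤ) × ℤ)) (x : Fin n → ℚ) : Prop :=
  ∀ c ∈ C, (c.2 : ℚ) ≤ form c.1 x

/-- The directions along which all inequalities that are tight at `x` stay tight: the linear space
of the minimal face that contains `x`. -/
def face (C : Finset ((Fin n → ℤ) × ℤ)) (x : Fin n → ℚ) : Submodule ℚ (Fin n → ℚ) where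
  carrier := {v | ∀ c ∈ C, form c.1 x = c.2 → form c.1 v = 0}
  add_mem' hv hw c hc h := by rw [map_add, hv c hc h, hw c hc h, add_zero]
  zero_mem' c _ _ := map_zero _
  smul_mem' t v hv c hc h := by rw [map_smul, hv c hc h, smul_zero]

theorem mem_face {C : Finset ((Fin n → ℤ) × ℤ)} {x v : Fin n → ℚ} :
    v ∈ face C x ↔ ∀ c ∈ C, form c.1 x = c.2 → form c.1 v = 0 := Iff.rfl

/-- Moving a point along its face until a further inequality becomes tight. -/
theorem exists_step {C : Finset ((Fin n → ℤ) × ℤ)} {x v : Fin n → ℚ} (hx : Feasible C x)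
    (hv : v ∈ face C x) (hneg : ∃ c ∈ C, form c.1 v < 0) :
    ∃ t : ℚ, 0 ≤ t ∧ Feasible C (x + t • v) ∧ face C (x + t • v) < face C x := by
  classical
  obtain ⟨c₀, hc₀, h₀⟩ := hneg
  obtain ⟨c₁, hc₁, hmin⟩ := Finset.exists_min_image (C.filter fun c => form c.1 v < 0)
    (fun c => (form c.1 x - c.2) / (-form c.1 v)) ⟨c₀, by simp [hc₀, h₀]⟩
  rw [Finset.mem_filter] at hc₁
  set t := (form c₁.1 x - c₁.2) / (-form c₁.1 v) with ht
  have ht0 : 0 ≤ t := div_nonneg (sub_nonneg.2 (hx c₁ hc₁.1)) (neg_nonneg.2 hc₁.2.le)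
  have heq (c : (Fin n → ℤ) × ℤ) : form c.1 (x + t • v) = form c.1 x + t * form c.1 v := by
    rw [map_add, map_smul, smul_eq_mul]
  refine ⟨t, ht0, fun c hc => ?_, ?_⟩
  · rw [heq]
    rcases lt_or_ge (form c.1 v) 0 with h | h
    · have := hmin c (by simp [hc, h])
      rw [le_div_iff₀ (neg_pos.2 h)] at this
      linarith
    · have := hx c hc
      have := mul_nonneg ht0 h
      linarith
  · have h1 : form c₁.1 (x + t • v) = c₁.2 := by
      rw [heq, ht]
      have : form c₁.1 v ≠ 0 := hc₁.2.ne
      field_simp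
      ring
    refine lt_of_le_of_ne (fun w hw c hc h => hw c hc ?_) fun h => ?_
    · rw [heq, hv c hc h, h, mul_zero, add_zero]
    · rw [← h] at hv
      exact hc₁.2.ne (hv c₁ hc₁.1 h1)

/-- There are tight inequalities with independent coefficient vectors, as many as the codimension
of the face. -/
theorem exists_tight_rows (C : Finset ((Fin n → ℤ) × ℤ)) (x : Fin n → ℚ) {k : ℕ}
    (hk : k + finrank ℚ (face C x) = n) :
    ∃ R : Fin k → (Fin n → ℤ) × ℤ, (∀ j, R j ∈ C ∧ form (R j).1 x = (R j).2) ∧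
      LinearIndependent ℚ fun j i => ((R j).1 i : ℚ) := by
  classical
  let T := C.filter fun c => form c.1 x = c.2
  let A : Matrix T (Fin n) ℚ := Matrix.of fun c i => (c.1.1 i : ℚ)
  have hker : LinearMap.ker A.mulVecLin = face C x := by
    ext v
    rw [LinearMap.mem_ker, mem_face, funext_iff]
    have h (c : T) : A.mulVecLin v c = form c.1.1 v := by
      simp [A, form_apply, Matrix.mulVec, dotProduct]
    simp [h, T, and_imp]
  have hrank : A.rank = k := by
    have := LinearMap.finrank_range_add_finrank_ker A.mulVecLin
    rw [hker, finrank_fin_fun] at this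
    rw [Matrix.rank]
    omega
  rw [Matrix.rank_eq_finrank_span_row] at hrank
  obtain ⟨b, hb, hspan, hli⟩ := exists_linearIndependent ℚ (Set.range A.row)
  have hfin : b.Finite := (Set.finite_range _).subset hb
  have := hfin.fintype
  have hcard : Fintype.card b = k := by
    rw [← hrank, ← hspan, ← Set.toFinset_card, finrank_span_set_eq_card hli]
  let e := Fintype.equivFinOfCardEq hcard
  have hR (j : Fin k) : ∃ c : T, A.row c = (e.symm j).1 := hb (e.symm j).2
  choose R hR using hR
  refine ⟨fun j => (R j).1, fun j => Finset.mem_filter.1 (R j).2, ?_⟩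
  have h2 := hli.comp e.symm e.symm.injective
  have h3 : (fun j i => ((R j).1.1 i : ℚ)) = (fun x : b => x.1) ∘ e.symm := by
    funext j
    exact hR j
  rw [h3]
  exact h2

/-- A bounded integer matrix has a bounded determinant. -/
theorem abs_det_le {m d : ℕ} (A : Matrix (Fin m) (Fin m) ℤ) (hA : ∀ i j, |A i j| ≤ d) :
    |A.det| ≤ (m.factorial * d ^ m : ℕ) := by
  have := Matrix.det_le (A := A) (abv := AbsoluteValue.abs) (x := (d : ℤ)) hA
  simpa using this

/-- The integer vector of the maximal minors of `m` independent rows of length `m + 1` is nonzero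
and orthogonal to the rows. -/
theorem exists_orthogonal {m d : ℕ} (R : Fin m → Fin (m + 1) → ℤ)
    (hli : LinearIndependent ℚ fun j i => (R j i : ℚ)) (hR : ∀ j i, |R j i| ≤ d) :
    ∃ w : Fin (m + 1) → ℤ, w ≠ 0 ∧ (∀ j, ∑ i, R j i * w i = 0) ∧
      ∀ i, |w i| ≤ (m.factorial * d ^ m : ℕ) := by
  let w : Fin (m + 1) → ℤ := fun i => (-1) ^ (i : ℕ) *
    ((Matrix.of R).submatrix id i.succAbove).det
  have hdet (x : Fin (m + 1) → ℤ) :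
      (Matrix.of (Fin.cons x R : Fin (m + 1) → Fin (m + 1) → ℤ)).det = ∑ i, x i * w i := by
    rw [Matrix.det_succ_row_zero]
    refine Finset.sum_congr rfl fun i _ => ?_
    simp only [w, Matrix.of_apply, Fin.cons_zero]
    have : (Matrix.of (Fin.cons x R : Fin (m + 1) → Fin (m + 1) → ℤ)).submatrix Fin.succ
        i.succAbove = (Matrix.of R).submatrix id i.succAbove := by
      ext j k
      simp
    rw [this]
    ring
  refine ⟨w, fun h0 => ?_, fun j => ?_, fun i => ?_⟩
  · have hlt : finrank ℚ (Submodule.span ℚ (Set.range fun j i => (R j i : ℚ))) <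
        finrank ℚ (Fin (m + 1) → ℚ) := by
      rw [finrank_span_eq_card hli]
      simp
    obtain ⟨i, hi⟩ : ∃ i, Pi.single i (1 : ℚ) ∉
        Submodule.span ℚ (Set.range fun j i => (R j i : ℚ)) := by
      by_contra! H
      refine hlt.ne ?_
      have : Submodule.span ℚ (Set.range fun j i => (R j i : ℚ)) = ⊤ := by
        rw [eq_top_iff, ← (Pi.basisFun ℚ (Fin (m + 1))).span_eq, Submodule.span_le]
        rintro _ ⟨i, rfl⟩
        simpa using H i
      rw [this, finrank_top]
    have h1 : LinearIndependent ℚ (Fin.cons (Pi.single i (1 : ℚ)) (fun j i => (R j i : ℚ)) :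
        Fin (m + 1) → Fin (m + 1) → ℚ) := linearIndependent_finCons.2 ⟨hli, hi⟩
    have h2 := hdet (Pi.single i 1)
    rw [h0] at h2
    simp only [Pi.zero_apply, mul_zero, Finset.sum_const_zero] at h2
    have h3 : (Matrix.of (Fin.cons (Pi.single i 1) R : Fin (m + 1) → Fin (m + 1) → ℤ)).map
        (Int.castRingHom ℚ) = Matrix.of (Fin.cons (Pi.single i (1 : ℚ)) (fun j i => (R j i : ℚ)) :
        Fin (m + 1) → Fin (m + 1) → ℚ) := by
      ext j k
      refine Fin.cases ?_ (fun j => ?_) j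
      · simp [Pi.single_apply, apply_ite]
      · simp
    have h4 := (Int.castRingHom ℚ).map_det
      (Matrix.of (Fin.cons (Pi.single i 1) R : Fin (m + 1) → Fin (m + 1) → ℤ))
    rw [h2, RingHom.mapMatrix_apply, h3, map_zero] at h4
    have h5 := Matrix.linearIndependent_rows_iff_isUnit.1 (show LinearIndependent ℚ (Matrix.of
      (Fin.cons (Pi.single i (1 : ℚ)) (fun j i => (R j i : ℚ)) :
        Fin (m + 1) → Fin (m + 1) → ℚ)).row from h1)
    rw [Matrix.isUnit_iff_isUnit_det, ← h4] at h5
    exact not_isUnit_zero h5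
  · rw [← hdet, Matrix.det_zero_of_row_eq (i := 0) (j := j.succ) (Fin.succ_ne_zero j).symm]
    rfl
  · simp only [w, abs_mul, abs_pow, abs_neg, abs_one, one_pow, one_mul]
    exact abs_det_le _ fun j k => hR _ _

/-- Cramer's rule bounds the solution of a regular system of linear equations. -/
theorem abs_le_of_regular {m d B : ℕ} (R : Fin (m + 1) → (Fin (m + 1) → ℤ) × ℤ)
    (hli : LinearIndependent ℚ fun j i => ((R j).1 i : ℚ)) (hR : ∀ j i, |(R j).1 i| ≤ d)
    (hB : ∀ j, |(R j).2| ≤ B) {x : Fin (m + 1) → ℚ} (hx : ∀ j, form (R j).1 x = (R j).2)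
    (i : Fin (m + 1)) : |x i| ≤ ((m + 1).factorial * d ^ m * B : ℕ) := by
  let A : Matrix (Fin (m + 1)) (Fin (m + 1)) ℤ := Matrix.of fun j => (R j).1
  let b : Fin (m + 1) → ℤ := fun j => (R j).2
  have hcast : A.map (Int.castRingHom ℚ) = Matrix.of fun j i => ((R j).1 i : ℚ) := rfl
  have hdet : A.det ≠ 0 := by
    have h5 := Matrix.linearIndependent_rows_iff_isUnit.1 (show LinearIndependent ℚ
      (A.map (Int.castRingHom ℚ)).row from hli)
    rw [Matrix.isUnit_iff_isUnit_det, ← RingHom.mapMatrix_apply, ← RingHom.map_det] at h5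
    intro h
    rw [h, map_zero] at h5
    exact not_isUnit_zero h5
  have hmul : (A.map (Int.castRingHom ℚ)).mulVec x = fun j => (b j : ℚ) := by
    funext j
    rw [← hx j, form_apply]
    rfl
  have hcr : ((A.updateCol i b).det : ℚ) = A.det * x i := by
    have h1 : (A.map (Int.castRingHom ℚ)).cramer (fun j => (b j : ℚ)) =
        (A.map (Int.castRingHom ℚ)).det • x := by
      rw [← hmul, Matrix.cramer_eq_adjugate_mulVec, Matrix.mulVec_mulVec, Matrix.adjugate_mul,
        Matrix.smul_mulVec, Matrix.one_mulVec]
    have h2 := congrFun h1 i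
    rw [Matrix.cramer_apply, Pi.smul_apply, smul_eq_mul] at h2
    have h3 : (A.map (Int.castRingHom ℚ)).updateCol i (fun j => (b j : ℚ)) =
        (A.updateCol i b).map (Int.castRingHom ℚ) := by
      rw [Matrix.map_updateCol]
      rfl
    rw [h3, ← RingHom.mapMatrix_apply, ← RingHom.mapMatrix_apply, ← RingHom.map_det,
      ← RingHom.map_det] at h2
    exact h2
  have hbound : |(A.updateCol i b).det| ≤ ((m + 1).factorial * d ^ m * B : ℕ) := by
    rw [Matrix.det_succ_column _ i]
    refine (Finset.abs_sum_le_sum_abs _ _).trans ?_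
    have (j : Fin (m + 1)) : |(-1) ^ ((j : ℕ) + i) * A.updateCol i b j i *
        ((A.updateCol i b).submatrix j.succAbove i.succAbove).det| ≤
        (B * (m.factorial * d ^ m) : ℕ) := by
      rw [abs_mul, abs_mul, abs_pow, abs_neg, abs_one, one_pow, one_mul, Nat.cast_mul]
      refine mul_le_mul ?_ (abs_det_le _ fun k l => ?_) (abs_nonneg _) (by positivity)
      · simpa using hB j
      · rw [Matrix.submatrix_apply, Matrix.updateCol_ne (Fin.succAbove_ne _ _)]
        exact hR _ _
    refine (Finset.sum_le_sum fun j _ => this j).trans ?_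
    rw [Finset.sum_const, Finset.card_univ, Fintype.card_fin, nsmul_eq_mul, Nat.factorial_succ]
    push_cast
    exact le_of_eq (by ring)
  have h1 : (1 : ℚ) ≤ |(A.det : ℚ)| := by
    exact_mod_cast Int.one_le_abs hdet
  calc |x i| = 1 * |x i| := (one_mul _).symm
    _ ≤ |(A.det : ℚ)| * |x i| := mul_le_mul_of_nonneg_right h1 (abs_nonneg _)
    _ = |((A.updateCol i b).det : ℚ)| := by rw [hcr, abs_mul]
    _ ≤ _ := by exact_mod_cast hbound

end SmallPoint

namespace SmallPoint

/-! ### Vertices, extreme rays and rounding -/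

open Module

variable {n : ℕ}

/-- A polyhedron without lines has a vertex. -/
theorem exists_vertex {C : Finset ((Fin n → ℤ) × ℤ)}
    (hC : ∀ v : Fin n → ℚ, v ≠ 0 → ∃ c ∈ C, form c.1 v ≠ 0) {x : Fin n → ℚ} (hx : Feasible C x) :
    ∃ y, Feasible C y ∧ face C y = ⊥ := by
  induction hk : finrank ℚ (face C x) using Nat.strong_induction_on generalizing x with
  | _ k ih =>
    by_cases h : face C x = ⊥
    · exact ⟨x, hx, h⟩
    · obtain ⟨v, hv, hv0⟩ := Submodule.exists_mem_ne_zero_of_ne_bot h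
      obtain ⟨c, hc, hcv⟩ := hC v hv0
      obtain ⟨v', hv', hneg⟩ : ∃ v' ∈ face C x, ∃ c ∈ C, form c.1 v' < 0 := by
        rcases lt_or_gt_of_ne hcv with h | h
        · exact ⟨v, hv, c, hc, h⟩
        · exact ⟨-v, neg_mem hv, c, hc, by rw [map_neg]; linarith⟩
      obtain ⟨t, _, h1, h2⟩ := exists_step hx hv' hneg
      exact ih _ (hk ▸ Submodule.finrank_lt_finrank_of_lt h2) h1 rfl

/-- The inequalities `0 ≤ form a z` for the coefficient vectors `a ∈ A`. -/
noncomputable def homogeneous (A : Finset (Fin n → ℤ)) : Finset ((Fin n → ℤ) × ℤ) :=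
  open Classical in A.image fun a => (a, 0)

theorem feasible_homogeneous {A : Finset (Fin n → ℤ)} {z : Fin n → ℚ} :
    Feasible (homogeneous A) z ↔ ∀ a ∈ A, 0 ≤ form a z := by
  simp [Feasible, homogeneous]

theorem mem_face_homogeneous {A : Finset (Fin n → ℤ)} {z v : Fin n → ℚ} :
    v ∈ face (homogeneous A) z ↔ ∀ a ∈ A, form a z = 0 → form a v = 0 := by
  simp [mem_face, homogeneous]

theorem self_mem_face {A : Finset (Fin n → ℤ)} {z : Fin n → ℚ} : z ∈ face (homogeneous A) z :=
  mem_face_homogeneous.2 fun _ _ h => h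

section Cone

variable {m d : ℕ} {A : Finset (Fin (m + 1) → ℤ)}

/-- A nonzero point of a cone without lines has a small integer extreme ray in its face. -/
theorem exists_ray (hA : ∀ v : Fin (m + 1) → ℚ, v ≠ 0 → ∃ a ∈ A, form a v ≠ 0)
    (hd : ∀ a ∈ A, ∀ i, |a i| ≤ d) {z : Fin (m + 1) → ℚ} (hz : Feasible (homogeneous A) z)
    (hz0 : z ≠ 0) : ∃ g : Fin (m + 1) → ℤ, g ≠ 0 ∧ Feasible (homogeneous A) (fun i => (g i : ℚ)) ∧
      (fun i => (g i : ℚ)) ∈ face (homogeneous A) z ∧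
      ∀ i, |g i| ≤ (m.factorial * d ^ m : ℕ) := by
  induction hk : finrank ℚ (face (homogeneous A) z) using Nat.strong_induction_on
    generalizing z with
  | _ k ih =>
    -- If the face is a line, the minors of the tight rows give a generator; otherwise one moves
    -- inside the face, transversally to `z`, to a smaller face.
    by_cases hline : ∀ v ∈ face (homogeneous A) z, ∃ t : ℚ, t • z = v
    · have hfin : finrank ℚ (face (homogeneous A) z) = 1 := by
        refine finrank_eq_one ⟨z, self_mem_face⟩ (fun h => hz0 (congrArg Subtype.val h)) ?_
        intro w
        obtain ⟨t, ht⟩ := hline w w.2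
        exact ⟨t, Subtype.ext ht⟩
      obtain ⟨R, hR, hli⟩ := exists_tight_rows (homogeneous A) z (k := m) (by rw [hfin])
      have hRA (j) : (R j).1 ∈ A ∧ form (R j).1 z = 0 := by
        obtain ⟨h1, h2⟩ := hR j
        simp only [homogeneous, Finset.mem_image] at h1
        obtain ⟨a, ha, h3⟩ := h1
        rw [← h3] at h2 ⊢
        exact ⟨ha, by simpa using h2⟩
      obtain ⟨w, hw0, hw, hwd⟩ := exists_orthogonal (fun j => (R j).1) hli
        fun j => hd _ (hRA j).1
      have hspan : ∃ t : ℚ, t • z = fun i => (w i : ℚ) := by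
        -- The kernel of the rows is a line through `z`, so it contains the vector of the minors.
        let L : (Fin (m + 1) → ℚ) →ₗ[ℚ] (Fin m → ℚ) := LinearMap.pi fun j => form (R j).1
        have hL : finrank ℚ (LinearMap.ker L) = 1 := by
          have h1 := LinearMap.finrank_range_add_finrank_ker L
          have h2 : finrank ℚ (LinearMap.range L) = m := by
            have : L = (Matrix.of fun j i => ((R j).1 i : ℚ)).mulVecLin := by
              refine LinearMap.ext fun v => funext fun j => ?_
              simp [L, form_apply, Matrix.mulVec, dotProduct]
            rw [this, ← Matrix.rank]
            simpa using LinearIndependent.rank_matrix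
              (M := Matrix.of fun j i => ((R j).1 i : ℚ)) hli
          rw [finrank_fin_fun] at h1
          omega
        have hzL : z ∈ LinearMap.ker L := by
          rw [LinearMap.mem_ker]
          exact funext fun j => (hRA j).2
        have hwL : (fun i => (w i : ℚ)) ∈ LinearMap.ker L := by
          rw [LinearMap.mem_ker]
          funext j
          simp only [L, LinearMap.pi_apply, form_intCast, hw j, Int.cast_zero, Pi.zero_apply]
        obtain ⟨t, ht⟩ := exists_smul_eq_of_finrank_eq_one hL (x := ⟨z, hzL⟩)
          (fun h => hz0 (congrArg Subtype.val h)) ⟨_, hwL⟩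
        exact ⟨t, congrArg Subtype.val ht⟩
      obtain ⟨t, ht⟩ := hspan
      have key : ∀ (g : Fin (m + 1) → ℤ) (t : ℚ), 0 ≤ t → t • z = (fun i => (g i : ℚ)) →
          Feasible (homogeneous A) (fun i => (g i : ℚ)) ∧
            (fun i => (g i : ℚ)) ∈ face (homogeneous A) z := by
        intro g t ht0 h
        rw [← h, feasible_homogeneous]
        refine ⟨fun a ha => ?_, Submodule.smul_mem _ _ self_mem_face⟩
        rw [map_smul]
        exact mul_nonneg ht0 (feasible_homogeneous.1 hz a ha)
      rcases le_total 0 t with h | h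
      · obtain ⟨h1, h2⟩ := key w t h ht
        exact ⟨w, hw0, h1, h2, hwd⟩
      · obtain ⟨h1, h2⟩ := key (-w) (-t) (neg_nonneg.2 h) (by
          rw [neg_smul, ht]; funext i; simp)
        exact ⟨-w, neg_ne_zero.2 hw0, h1, h2, by simpa using hwd⟩
    · push Not at hline
      obtain ⟨v, hv, hvz⟩ := hline
      have hv0 : v ≠ 0 := fun h => hvz 0 (by rw [zero_smul, h])
      obtain ⟨a, ha, hav⟩ := hA v hv0
      obtain ⟨v', hv', hvz', hneg⟩ : ∃ v' ∈ face (homogeneous A) z,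
          (∀ t : ℚ, t • z ≠ v') ∧ ∃ c ∈ homogeneous A, form c.1 v' < 0 := by
        have hmem : (a, 0) ∈ homogeneous A := by simp [homogeneous, ha]
        rcases lt_or_gt_of_ne hav with h | h
        · exact ⟨v, hv, hvz, _, hmem, h⟩
        · refine ⟨-v, neg_mem hv, fun t ht => hvz (-t) ?_, _, hmem, ?_⟩
          · rw [neg_smul, ht, neg_neg]
          · rw [map_neg]; linarith
      obtain ⟨t, _, h1, h2⟩ := exists_step hz hv' hneg
      have hne : z + t • v' ≠ 0 := by
        intro h
        rcases eq_or_ne t 0 with rfl | ht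
        · rw [zero_smul, add_zero] at h
          exact hz0 h
        · refine hvz' (-t⁻¹) ?_
          have : z = -(t • v') := eq_neg_of_add_eq_zero_left h
          rw [this, smul_neg, neg_smul, neg_neg, smul_smul, inv_mul_cancel₀ ht, one_smul]
      obtain ⟨g, h3, h4, h5, h6⟩ := ih _ (hk ▸ Submodule.finrank_lt_finrank_of_lt h2) h1 hne rfl
      exact ⟨g, h3, h4, h2.le h5, h6⟩

/-- Up to a bounded remainder in the cone, a point of a cone is an integer point of the cone: a
combination of small integer extreme rays is rounded down. -/
theorem exists_round (hA : ∀ v : Fin (m + 1) → ℚ, v ≠ 0 → ∃ a ∈ A, form a v ≠ 0)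
    (hd : ∀ a ∈ A, ∀ i, |a i| ≤ d) {z : Fin (m + 1) → ℚ} (hz : Feasible (homogeneous A) z) :
    ∃ u : Fin (m + 1) → ℤ, (∀ a ∈ A, 0 ≤ form a (fun i => (u i : ℚ))) ∧
      (∀ a ∈ A, 0 ≤ form a (z - fun i => (u i : ℚ))) ∧
      ∀ i, |z i - u i| ≤ (finrank ℚ (face (homogeneous A) z) * (m.factorial * d ^ m) : ℕ) := by
  induction hk : finrank ℚ (face (homogeneous A) z) using Nat.strong_induction_on
    generalizing z with
  | _ k ih =>
    by_cases hz0 : z = 0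
    · subst hz0
      refine ⟨0, fun a _ => ?_, fun a _ => ?_, fun i => ?_⟩
      · simp [form_apply]
      · simp [form_apply]
      · simp only [Pi.zero_apply, Int.cast_zero, sub_zero, abs_zero]
        positivity
    · obtain ⟨g, hg0, hg, hgz, hgd⟩ := exists_ray hA hd hz hz0
      have hg0' : (fun i => (g i : ℚ)) ≠ 0 := fun h => hg0 (funext fun i => by
        simpa using congrFun h i)
      obtain ⟨a, ha, hag⟩ := hA _ hg0'
      have hpos := lt_of_le_of_ne (feasible_homogeneous.1 hg a ha) hag.symm
      obtain ⟨t, ht, h1, h2⟩ := exists_step (v := -fun i => (g i : ℚ)) hz (neg_mem hgz)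
        ⟨(a, 0), by simp [homogeneous, ha], by rw [map_neg]; linarith⟩
      have hlt := Submodule.finrank_lt_finrank_of_lt h2
      obtain ⟨u, h3, h4, h5⟩ := ih _ (hk ▸ hlt) h1 rfl
      have hfl : (0 : ℚ) ≤ ⌊t⌋ := by exact_mod_cast Int.floor_nonneg.2 ht
      have hu : (fun i => ((u + ⌊t⌋ • g) i : ℚ)) =
          (fun i => (u i : ℚ)) + (⌊t⌋ : ℚ) • fun i => (g i : ℚ) := by
        funext i
        simp
      refine ⟨u + ⌊t⌋ • g, fun a ha => ?_, fun a ha => ?_, fun i => ?_⟩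
      · rw [hu, map_add, map_smul]
        exact add_nonneg (h3 a ha) (mul_nonneg hfl (feasible_homogeneous.1 hg a ha))
      · have : z - (fun i => ((u + ⌊t⌋ • g) i : ℚ)) =
            (z + t • -(fun i => (g i : ℚ)) - fun i => (u i : ℚ)) +
              Int.fract t • fun i => (g i : ℚ) := by
          rw [hu, Int.fract]
          module
        rw [this, map_add, map_smul]
        exact add_nonneg (h4 a ha)
          (mul_nonneg (Int.fract_nonneg t) (feasible_homogeneous.1 hg a ha))
      · have h6 : z i - ((u + ⌊t⌋ • g) i : ℚ) =
            ((z + t • -(fun i => (g i : ℚ))) i - u i) + Int.fract t * g i := by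
          simp only [Int.fract, Pi.add_apply, Pi.smul_apply, Pi.neg_apply, smul_eq_mul]
          push_cast
          ring
        have h7 : |(g i : ℚ)| ≤ (m.factorial * d ^ m : ℕ) := by exact_mod_cast hgd i
        rw [h6]
        refine (abs_add_le _ _).trans ((add_le_add (h5 i) (?_ : _ ≤
          ((m.factorial * d ^ m : ℕ) : ℚ))).trans ?_)
        · rw [abs_mul, abs_of_nonneg (Int.fract_nonneg t)]
          exact (mul_le_of_le_one_left (abs_nonneg _) (Int.fract_lt_one t).le).trans h7
        · rw [← Nat.cast_add, ← Nat.succ_mul, ← hk]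
          exact_mod_cast Nat.mul_le_mul_right _ hlt

end Cone

/-- A point with natural coordinates can be replaced by one with small coordinates that satisfies
the same inequalities with coefficients bounded by `d` and right hand sides bounded by `B`. It is
`x + (y - x - u)` for a vertex `x` of the polyhedron of these inequalities, bounded by Cramer's
rule, and an integer point `u` of a cone that approximates `y - x`. -/
theorem exists_small_point {m d B : ℕ} (hd : 1 ≤ d) (y : Fin (m + 1) → ℕ) :
    ∃ z : Fin (m + 1) → ℕ, (∀ i, z i ≤ (m + 1).factorial * d ^ m * (B + 1)) ∧
      ∀ (a : Fin (m + 1) → ℤ) (b : ℤ), (∀ i, |a i| ≤ d) → |b| ≤ B →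
        b ≤ ∑ i, a i * y i → b ≤ ∑ i, a i * z i := by
  classical
  let rows : Finset (Fin (m + 1) → ℤ) := Finset.Icc (fun _ => -(d : ℤ)) (fun _ => (d : ℤ))
  have hrows (a : Fin (m + 1) → ℤ) : a ∈ rows ↔ ∀ i, |a i| ≤ d := by
    simp only [rows, Finset.mem_Icc, Pi.le_def, abs_le, forall_and]
  let yq : Fin (m + 1) → ℚ := fun i => (y i : ℚ)
  let C := (rows ×ˢ Finset.Icc (-(B : ℤ)) B).filter fun c => (c.2 : ℚ) ≤ form c.1 yq
  have hC (c : (Fin (m + 1) → ℤ) × ℤ) :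
      c ∈ C ↔ ((∀ i, |c.1 i| ≤ d) ∧ |c.2| ≤ B) ∧ (c.2 : ℚ) ≤ form c.1 yq := by
    simp only [C, Finset.mem_filter, Finset.mem_product, hrows, Finset.mem_Icc, abs_le]
  have hsingle (i : Fin (m + 1)) (s : ℤ) (hs : |s| ≤ 1) (j) :
      |(Pi.single i s : Fin (m + 1) → ℤ) j| ≤ d := by
    rw [Pi.single_apply]
    split_ifs
    · exact hs.trans (by exact_mod_cast hd)
    · simp
  have hform (i : Fin (m + 1)) (s : ℤ) (v : Fin (m + 1) → ℚ) :
      form (Pi.single i s) v = s * v i := by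
    rw [form_apply, Finset.sum_eq_single i]
    · simp
    · intro j _ hj
      simp [hj]
    · simp
  obtain ⟨x, hx, hface⟩ := exists_vertex (C := C) (x := yq) (fun v hv => by
    obtain ⟨i, hi⟩ := Function.ne_iff.1 hv
    refine ⟨(Pi.single i 1, 0), (hC _).2 ⟨⟨hsingle i 1 (by simp), by simp⟩, ?_⟩, ?_⟩
    · rw [hform]
      simp [yq]
    · rw [hform]
      simpa using hi) (fun c hc => ((hC c).1 hc).2)
  have hxB (i) : |x i| ≤ ((m + 1).factorial * d ^ m * B : ℕ) := by
    obtain ⟨R, hR, hli⟩ := exists_tight_rows C x (k := m + 1) (by rw [hface]; simp)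
    exact abs_le_of_regular R hli (fun j => ((hC _).1 (hR j).1).1.1)
      (fun j => ((hC _).1 (hR j).1).1.2) (fun j => (hR j).2) i
  -- The cone on which every bounded linear form has the same weak sign as at `y - x`. If `u` is an
  -- integer point of the cone such that `y - x - u` still lies in the cone, the value of a bounded
  -- form at `y - u` lies weakly between its values at `x` and at `y`.
  let A := rows.filter fun a => 0 ≤ form a (yq - x)
  have hA (a) : a ∈ A ↔ (∀ i, |a i| ≤ d) ∧ 0 ≤ form a (yq - x) := by
    simp only [A, Finset.mem_filter, hrows]
  have hpoint (v : Fin (m + 1) → ℚ) (hv : v ≠ 0) : ∃ a ∈ A, form a v ≠ 0 := by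
    obtain ⟨i, hi⟩ := Function.ne_iff.1 hv
    rcases le_total 0 ((yq - x) i) with h | h
    · exact ⟨Pi.single i 1, (hA _).2 ⟨hsingle i 1 (by simp), by rw [hform]; simpa using h⟩, by
        rw [hform]; simpa using hi⟩
    · exact ⟨Pi.single i (-1), (hA _).2 ⟨hsingle i (-1) (by simp), by rw [hform]; simpa using h⟩, by
        rw [hform]; simpa using hi⟩
  obtain ⟨u, hu, hru, hbd⟩ := exists_round hpoint (fun a ha => ((hA a).1 ha).1)
    (z := yq - x) (feasible_homogeneous.2 fun a ha => ((hA a).1 ha).2)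
  let zi : Fin (m + 1) → ℤ := fun i => y i - u i
  have hzi : (fun i => (zi i : ℚ)) = yq - fun i => (u i : ℚ) := by
    funext i
    simp [zi, yq]
  have key (a : Fin (m + 1) → ℤ) (b : ℤ) (ha : ∀ i, |a i| ≤ d) (hb : |b| ≤ B)
      (h : b ≤ ∑ i, a i * (y i : ℤ)) : b ≤ ∑ i, a i * zi i := by
    have hy : (b : ℚ) ≤ form a yq := by
      have : form a yq = (∑ i, a i * (y i : ℤ) : ℤ) := by
        rw [← form_intCast]
        simp [yq]
      rw [this]
      exact_mod_cast h
    have hxb : (b : ℚ) ≤ form a x := hx (a, b) ((hC _).2 ⟨⟨ha, hb⟩, hy⟩)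
    have : (b : ℚ) ≤ form a (fun i => (zi i : ℚ)) := by
      rw [hzi]
      rcases le_total 0 (form a (yq - x)) with h | h
      · have h1 := hru a ((hA a).2 ⟨ha, h⟩)
        have h2 : form a (yq - fun i => (u i : ℚ)) =
            form a x + form a (yq - x - fun i => (u i : ℚ)) := by
          rw [← map_add]
          congr 1
          module
        linarith
      · have hneg (v : Fin (m + 1) → ℚ) : form (-a) v = -form a v := by
          simp [form_apply]
        have h1 := hu (-a) ((hA _).2 ⟨by simpa using ha, by rw [hneg]; linarith⟩)
        rw [hneg] at h1
        rw [map_sub]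
        linarith
    rw [form_intCast] at this
    exact_mod_cast this
  have hz0 (i) : 0 ≤ zi i := by
    have := key (Pi.single i 1) 0 (hsingle i 1 (by simp)) (by simp) (by
      simp [Pi.single_apply])
    simpa [Pi.single_apply] using this
  refine ⟨fun i => (zi i).toNat, fun i => ?_, fun a b ha hb h => ?_⟩
  · have h1 : ((zi i : ℤ) : ℚ) = x i + ((yq - x) i - u i) := by
      rw [Pi.sub_apply, congrFun hzi i, Pi.sub_apply]
      ring
    have h2 := (abs_le.1 (hxB i)).2
    have h3 := (abs_le.1 (hbd i)).2
    have h4 : finrank ℚ (face (homogeneous A) (yq - x)) * (m.factorial * d ^ m) ≤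
        (m + 1).factorial * d ^ m := by
      rw [Nat.factorial_succ, mul_assoc]
      refine Nat.mul_le_mul_right _ ?_
      simpa using Submodule.finrank_le (face (homogeneous A) (yq - x))
    have h5 : ((zi i : ℤ) : ℚ) ≤ ((m + 1).factorial * d ^ m * (B + 1) : ℕ) := by
      have h4' : ((finrank ℚ (face (homogeneous A) (yq - x)) * (m.factorial * d ^ m) : ℕ) : ℚ) ≤
        ((m + 1).factorial * d ^ m : ℕ) := by exact_mod_cast h4
      rw [mul_add, mul_one, Nat.cast_add]
      linarith
    have h6 : zi i ≤ ((m + 1).factorial * d ^ m * (B + 1) : ℕ) := by exact_mod_cast h5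
    exact Int.toNat_le.2 h6
  · simp only [Int.toNat_of_nonneg (hz0 _)]
    exact key a b ha hb h

end SmallPoint

namespace TropDiff

/-! ### Small solutions -/

theorem val_le_val {S T : Set ℕ} {j : ℕ} (h : ∀ s ∈ S, j ≤ s → ∃ t ∈ T, j ≤ t ∧ t ≤ s) :
    val T j ≤ val S j := by
  refine le_val_iff.2 fun s hs hj => ?_
  obtain ⟨t, ht, hjt, hts⟩ := h s hs hj
  exact (le_val_iff.1 le_rfl t ht hjt).trans (by exact_mod_cast Nat.sub_le_sub_right hts j)

theorem val_eq_sub {S : Set ℕ} {j s : ℕ} (hs : s ∈ S) (hj : j ≤ s)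
    (h : ∀ t ∈ S, j ≤ t → s ≤ t) : val S j = ((s - j : ℕ) : ℕ∞) :=
  le_antisymm (le_val_iff.1 le_rfl s hs hj) (le_val_iff.2 fun t ht hjt => by
    exact_mod_cast Nat.sub_le_sub_right (h t ht hjt) j)

theorem val_eq_top {S : Set ℕ} {j : ℕ} (h : ∀ s ∈ S, s < j) : val S j = ⊤ :=
  top_le_iff.1 (le_val_iff.2 fun s hs hj => absurd (h s hs) hj.not_gt)

/-- Whether an equation is solved depends only on the order of the values of its monomials and on
which of them are infinite. -/
theorem Equation.IsSolution.of_value_le {n : ℕ} {e : Equation n} {S T : Fin n → Set ℕ}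
    (hS : e.IsSolution S) (htop : ∀ P ∈ e.family, e.value S P = ⊤ → e.value T P = ⊤)
    (hle : ∀ P ∈ e.family, ∀ Q ∈ e.family,
      e.value S P ≤ e.value S Q → e.value T P ≤ e.value T Q) : e.IsSolution T := by
  rcases hS with h | ⟨P, hP, Q, hQ, hPQ, hP', hQ'⟩
  · refine .inl ?_
    simp only [minValue, iInf_eq_top] at h ⊢
    exact fun P hP => htop P hP (h P hP)
  · have key {P} (hP : P ∈ e.family) (h : e.value S P = e.minValue S) :
        e.value T P = e.minValue T :=
      le_antisymm (le_iInf₂ fun R hR => hle P hP R hR (h.trans_le (iInf₂_le R hR)))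
        (iInf₂_le P hP)
    exact .inr ⟨P, hP, Q, hQ, hPQ, key hP hP', key hQ hQ'⟩

/-- The sets `S_i` with their parts in `[r, ∞)` replaced by `[r + z_i, ∞)`, unless these parts are
empty. -/
def replaceTail {n : ℕ} (S : Fin n → Set ℕ) (r : ℕ) (z : Fin n → ℕ) (i : Fin n) : Set ℕ :=
  {s | s ∈ S i ∧ s < r ∨ (∃ t ∈ S i, r ≤ t) ∧ r + z i ≤ s}

section ReplaceTail

variable {n r : ℕ} (S : Fin n → Set ℕ)

theorem val_replaceTail (i : Fin n) {j : ℕ} (hj : j ≤ r) :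
    (∀ z, val (replaceTail S r z i) j = ⊤) ∨
      ∃ c ≤ r, ∃ k ≤ 1, ∀ z, val (replaceTail S r z i) j = ((c + k * z i : ℕ) : ℕ∞) := by
  classical
  by_cases h : ∃ s, s ∈ S i ∧ j ≤ s ∧ s < r
  · obtain ⟨h1, h2, h3⟩ := Nat.find_spec h
    refine .inr ⟨Nat.find h - j, by omega, 0, by simp, fun z => ?_⟩
    rw [zero_mul, add_zero]
    refine val_eq_sub (.inl ⟨h1, h3⟩) h2 ?_
    rintro t (⟨ht, htr⟩ | ⟨-, ht⟩) hjt
    · exact Nat.find_min' h ⟨ht, hjt, htr⟩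
    · omega
  by_cases h' : ∃ t ∈ S i, r ≤ t
  · refine .inr ⟨r - j, by omega, 1, le_rfl, fun z => ?_⟩
    rw [one_mul, ← Nat.sub_add_comm hj]
    refine val_eq_sub (.inr ⟨h', le_rfl⟩) (by omega) ?_
    rintro t (⟨ht, htr⟩ | ⟨-, ht⟩) hjt
    · exact absurd ⟨t, ht, hjt, htr⟩ h
    · exact ht
  · refine .inl fun z => val_eq_top ?_
    rintro t (⟨ht, htr⟩ | ⟨ht, -⟩)
    · by_contra hjt
      exact h ⟨t, ht, not_lt.1 hjt, htr⟩
    · exact absurd ht h'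

/-- The values of the monomials do not change if `[r, ∞) ∩ S_i` is filled up above its least
element. -/
theorem exists_val_replaceTail_eq :
    ∃ y : Fin n → ℕ, ∀ i, ∀ j ≤ r, val (replaceTail S r y i) j = val (S i) j := by
  classical
  refine ⟨fun i => sInf {s | s ∈ S i ∧ r ≤ s} - r, fun i j hj => le_antisymm ?_ ?_⟩
  · refine val_le_val fun s hs hjs => ?_
    by_cases hsr : s < r
    · exact ⟨s, .inl ⟨hs, hsr⟩, hjs, le_rfl⟩
    · have h1 : sInf {s | s ∈ S i ∧ r ≤ s} ≤ s := Nat.sInf_le ⟨hs, not_lt.1 hsr⟩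
      exact ⟨s, .inr ⟨⟨s, hs, not_lt.1 hsr⟩, by beta_reduce; omega⟩, hjs, le_rfl⟩
  · refine val_le_val ?_
    rintro s (⟨hs, hsr⟩ | ⟨⟨t, ht, hrt⟩, hs⟩) hjs
    · exact ⟨s, hs, hjs, le_rfl⟩
    · have h1 : sInf {s | s ∈ S i ∧ r ≤ s} ∈ {s | s ∈ S i ∧ r ≤ s} := Nat.sInf_mem ⟨t, ht, hrt⟩
      exact ⟨_, h1.1, hj.trans h1.2, by have := h1.2; dsimp only at hs; omega⟩

/-- As a function of the lengths `z_i` of the gaps, the value of a monomial is affine with small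
coefficients. -/
theorem value_replaceTail {d M : ℕ} {e : Equation n} {P : Monomial n}
    (hd : Multiset.card P ≤ d) (hM : e.coeff P ≤ M) (hr : ∀ q ∈ P, q.2 ≤ r) :
    (∀ z, e.value (replaceTail S r z) P = ⊤) ∨
      ∃ c ≤ M + r * d, ∃ k : Fin n → ℕ, (∀ i, k i ≤ d) ∧
        ∀ z, e.value (replaceTail S r z) P = ((c + ∑ i, k i * z i : ℕ) : ℕ∞) := by
  have key : (∀ z, (P.map fun q => val (replaceTail S r z q.1) q.2).sum = ⊤) ∨
      ∃ c ≤ r * Multiset.card P, ∃ k : Fin n → ℕ, (∀ i, k i ≤ Multiset.card P) ∧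
        ∀ z, (P.map fun q => val (replaceTail S r z q.1) q.2).sum =
          ((c + ∑ i, k i * z i : ℕ) : ℕ∞) := by
    clear hd hM
    induction P using Multiset.induction_on with
    | empty => exact .inr ⟨0, by simp, fun _ => 0, by simp, by simp⟩
    | cons q P ih =>
      simp only [Multiset.map_cons, Multiset.sum_cons, Multiset.card_cons]
      rcases val_replaceTail S q.1 (hr q (by simp)) with h | ⟨c, hc, k, hk, h⟩
      · exact .inl fun z => by rw [h, top_add]
      rcases ih fun q hq => hr q (Multiset.mem_cons_of_mem hq) with h' | ⟨c', hc', k', hk', h'⟩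
      · exact .inl fun z => by rw [h', add_top]
      · refine .inr ⟨c + c', by rw [mul_add, mul_one]; omega, k' + Pi.single q.1 k,
          fun i => ?_, fun z => ?_⟩
        · rw [Pi.add_apply, Pi.single_apply]
          have := hk' i
          split_ifs <;> omega
        · rw [h, h', ← Nat.cast_add]
          congr 1
          simp only [Pi.add_apply, add_mul, Finset.sum_add_distrib]
          rw [Finset.sum_eq_single (f := fun i => (Pi.single q.1 k : Fin n → ℕ) i * z i) q.1]
          · rw [Pi.single_eq_same]
            ring
          · intro i _ hi
            simp [hi]
          · simp
  rcases key with h | ⟨c, hc, k, hk, h⟩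
  · exact .inl fun z => by rw [Equation.value, h, add_top]
  · refine .inr ⟨e.coeff P + c, add_le_add hM (hc.trans (Nat.mul_le_mul_left r hd)), k,
      fun i => (hk i).trans hd, fun z => ?_⟩
    rw [Equation.value, h, ← Nat.cast_add, add_assoc]

end ReplaceTail

/-- The bound for a small point, in the form needed for the ends of the gaps. -/
theorem exists_small_lengths {n d M r : ℕ} (hd : 2 ≤ d) (y : Fin n → ℕ) :
    ∃ z : Fin n → ℕ, (∀ i, r + z i ≤ n.factorial * (M + r * d) * d ^ n) ∧
      ∀ (a : Fin n → ℤ) (b : ℤ), (∀ i, |a i| ≤ d) → |b| ≤ (M + r * d : ℕ) →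
        b ≤ ∑ i, a i * y i → b ≤ ∑ i, a i * z i := by
  rcases n with _ | m
  · exact ⟨y, fun i => i.elim0, fun a b _ _ h => h⟩
  rcases Nat.eq_zero_or_pos (M + r * d) with hB | hB
  · refine ⟨0, fun i => ?_, fun a b _ hb _ => ?_⟩
    · have : r = 0 := by
        have : r * d = 0 := by omega
        rcases Nat.mul_eq_zero.1 this with h | h <;> omega
      simp [this]
    · rw [hB] at hb
      have : b = 0 := by simpa using hb
      simp [this]
  · obtain ⟨z, hz, h⟩ := SmallPoint.exists_small_point (B := M + r * d) (by omega : 1 ≤ d) y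
    refine ⟨z, fun i => ?_, h⟩
    have h1 : r * 2 ≤ M + r * d := (Nat.mul_le_mul_left r hd).trans (Nat.le_add_left _ _)
    have hF : 1 ≤ (m + 1).factorial * d ^ m :=
      Nat.mul_pos (Nat.factorial_pos _) (pow_pos (by omega) _)
    have hzi := hz i
    generalize M + r * d = B at *
    rw [show (m + 1).factorial * B * d ^ (m + 1) = (m + 1).factorial * d ^ m * B * d by ring]
    generalize (m + 1).factorial * d ^ m = F at *
    -- `r + F (B + 1) ≤ 2 F B` since `r + 1 ≤ B` unless `r = 0`
    have h2 : F * B * 2 ≤ F * B * d := Nat.mul_le_mul_left _ hd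
    have h3 : r + F ≤ F * B := by
      obtain ⟨b, rfl⟩ := Nat.exists_eq_add_of_lt hB
      have h4 : b ≤ F * b := Nat.le_mul_of_pos_left b hF
      rw [show F * (0 + b + 1) = F * b + F by ring]
      omega
    rw [mul_add, mul_one] at hzi
    omega

/-- On the sets `replaceTail S r z` the values of the monomials are affine functions of `z`, so any
`z` that satisfies the same small inequalities between their differences as the given solution is a
solution as well. -/
theorem System.Solvable.exists_small {n d M r : ℕ} {E : System n} (hd : 2 ≤ d)
    (hE : E.Bounded d M r) (hsol : E.Solvable) :
    ∃ S : Fin n → Set ℕ, E.IsSolution S ∧ ∀ i, (∀ s ∈ S i, s < r) ∨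
      ∃ m, r ≤ m ∧ m ≤ n.factorial * (M + r * d) * d ^ n ∧ ∀ s, r ≤ s → (s ∈ S i ↔ m ≤ s) := by
  obtain ⟨S, hS⟩ := hsol
  obtain ⟨y, hy⟩ := exists_val_replaceTail_eq (r := r) S
  obtain ⟨z, hz, hzy⟩ := exists_small_lengths (M := M) (r := r) hd y
  refine ⟨replaceTail S r z, fun e he => ?_, fun i => ?_⟩
  · have hval {P} (hP : P ∈ e.family) : e.value S P = e.value (replaceTail S r y) P := by
      simp only [Equation.value]
      congr 2
      exact Multiset.map_congr rfl fun q hq => (hy q.1 q.2 ((hE e he P hP).2.2 q hq)).symm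
    have haff {P} (hP : P ∈ e.family) := value_replaceTail S (hE e he P hP).1
      (hE e he P hP).2.1 (hE e he P hP).2.2
    refine (hS e he).of_value_le (fun P hP h => ?_) fun P hP Q hQ h => ?_
    · rw [hval hP] at h
      rcases haff hP with h' | ⟨c, -, k, -, h'⟩
      · exact h' z
      · rw [h'] at h
        exact absurd h (ENat.natCast_ne_top _)
    · rw [hval hP, hval hQ] at h
      rcases haff hQ with h' | ⟨c', hc', k', hk', h'⟩
      · rw [h' z]
        exact le_top
      rcases haff hP with h'' | ⟨c, hc, k, hk, h''⟩
      · rw [h'', h', top_le_iff] at h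
        exact absurd h (ENat.natCast_ne_top _)
      rw [h', h'', Nat.cast_le] at h ⊢
      have h1 := hzy (fun i => (k' i : ℤ) - k i) (c - c' : ℤ) (fun i => by
        have := hk i
        have := hk' i
        rw [abs_le]
        omega) (by rw [abs_le]; omega)
      simp only [sub_mul, Finset.sum_sub_distrib] at h1
      zify at h ⊢
      linarith [h1 (by linarith)]
  · by_cases h : ∃ t ∈ S i, r ≤ t
    · refine .inr ⟨r + z i, Nat.le_add_right _ _, hz i, fun s hs => ?_⟩
      simp only [replaceTail, Set.mem_ofPred_eq, h, true_and, hs.not_gt, and_false, false_or]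
    · left
      rintro s (⟨-, hs⟩ | ⟨h', -⟩)
      · exact hs
      · exact absurd h' h

end TropDiff

namespace TropDiff

open Computability

/-! ### Short certificates -/

theorem Equation.value_congr {n : ℕ} {e : Equation n} {S T : Fin n → Set ℕ} {P : Monomial n}
    (h : ∀ q ∈ P, val (S q.1) q.2 = val (T q.1) q.2) : e.value S P = e.value T P := by
  simp only [Equation.value]
  congr 2
  exact Multiset.map_congr rfl h

theorem System.IsSolution.congr {n : ℕ} {E : System n} {S T : Fin n → Set ℕ}
    (hS : E.IsSolution S)
    (h : ∀ e ∈ E, ∀ P ∈ e.family, ∀ q ∈ P, val (S q.1) q.2 = val (T q.1) q.2) :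
    E.IsSolution T := by
  intro e he
  have hval {P} (hP : P ∈ e.family) := Equation.value_congr (e := e) (h e he P hP)
  refine (hS e he).of_value_le (fun P hP => ?_) fun P hP Q hQ => ?_
  · rw [hval hP]
    exact id
  · rw [hval hP, hval hQ]
    exact id

/-- A bounded system has a least bound for each of the three parameters. -/
theorem System.Bounded.exists_least {n d M r : ℕ} {E : System n} (h : E.Bounded d M r)
    (hd : 2 ≤ d) : ∃ d₀ M₀ r₀, 2 ≤ d₀ ∧ E.Bounded d₀ M₀ r₀ ∧
      ∀ d M r, 2 ≤ d → E.Bounded d M r → d₀ ≤ d ∧ M₀ ≤ M ∧ r₀ ≤ r := by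
  classical
  have h1 : ∃ d, 2 ≤ d ∧ ∀ e ∈ E, ∀ P ∈ e.family, Multiset.card P ≤ d :=
    ⟨d, hd, fun e he P hP => (h e he P hP).1⟩
  have h2 : ∃ M, ∀ e ∈ E, ∀ P ∈ e.family, e.coeff P ≤ M := ⟨M, fun e he P hP => (h e he P hP).2.1⟩
  have h3 : ∃ r, ∀ e ∈ E, ∀ P ∈ e.family, ∀ q ∈ P, q.2 ≤ r :=
    ⟨r, fun e he P hP => (h e he P hP).2.2⟩
  refine ⟨Nat.find h1, Nat.find h2, Nat.find h3, (Nat.find_spec h1).1,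
    fun e he P hP => ⟨(Nat.find_spec h1).2 e he P hP, Nat.find_spec h2 e he P hP,
      Nat.find_spec h3 e he P hP⟩, fun d M r hd h => ⟨?_, ?_, ?_⟩⟩
  · exact Nat.find_min' h1 ⟨hd, fun e he P hP => (h e he P hP).1⟩
  · exact Nat.find_min' h2 fun e he P hP => (h e he P hP).2.1
  · exact Nat.find_min' h3 fun e he P hP => (h e he P hP).2.2

/-- If only the orders in `J` occur, a solution with simple tails can be thinned out: for every
order `j` below `r` only the element of `S_i` that determines `Val_{S_i}(j)` is kept. -/
theorem System.IsSolution.exists_certificate {n r B : ℕ} {E : System n} {S : Fin n → Set ℕ}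
    (hS : E.IsSolution S) (htail : ∀ i, (∀ s ∈ S i, s < r) ∨
      ∃ m, r ≤ m ∧ m ≤ B ∧ ∀ s, r ≤ s → (s ∈ S i ↔ m ≤ s)) {J : List ℕ}
    (hJ : ∀ e ∈ E, ∀ P ∈ e.family, ∀ q ∈ P, q.2 ∈ J) :
    ∃ C : Certificate n, E.IsSolution C.sets ∧ ∀ i, (C.initial i).length ≤ J.length ∧
      (∀ s ∈ C.initial i, s < r) ∧ ∀ m ∈ C.tail i, m ≤ B := by
  classical
  have htail' (i) : ∃ t : Option ℕ, (∀ m ∈ t, r ≤ m ∧ m ≤ B) ∧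
      ∀ s, r ≤ s → (s ∈ S i ↔ ∃ m ∈ t, m ≤ s) := by
    rcases htail i with h | ⟨m, h1, h2, h3⟩
    · exact ⟨none, by simp, fun s hs => by simpa using fun hs' => (h s hs').not_ge hs⟩
    · exact ⟨some m, by simp [h1, h2], fun s hs => by simp [h3 s hs]⟩
  choose t ht ht' using htail'
  let next (i : Fin n) (j : ℕ) : Option ℕ :=
    if h : ∃ s, s ∈ S i ∧ j ≤ s ∧ s < r then some (Nat.find h) else none
  have hnext {i : Fin n} {j s : ℕ} (h : s ∈ next i j) : s ∈ S i ∧ j ≤ s ∧ s < r := by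
    simp only [next, Option.mem_def] at h
    split_ifs at h with h'
    rw [← Option.some.inj h]
    exact Nat.find_spec h'
  refine ⟨⟨fun i => J.filterMap (next i), t⟩, hS.congr fun e he P hP q hq => ?_, fun i =>
    ⟨List.length_filterMap_le _ _, fun s hs => ?_, fun m hm => (ht i m hm).2⟩⟩
  · have hj := hJ e he P hP q hq
    obtain ⟨i, j⟩ := q
    dsimp only at hj ⊢
    refine le_antisymm (val_le_val ?_) (val_le_val fun s hs hjs => ?_)
    · rintro s (hs | ⟨m, hm, hms⟩) hjs
      · obtain ⟨k, -, hk⟩ := List.mem_filterMap.1 hs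
        exact ⟨s, (hnext hk).1, hjs, le_rfl⟩
      · exact ⟨s, (ht' i s ((ht i m hm).1.trans hms)).2 ⟨m, hm, hms⟩, hjs, le_rfl⟩
    · by_cases hsr : s < r
      · have h : ∃ s, s ∈ S i ∧ j ≤ s ∧ s < r := ⟨s, hs, hjs, hsr⟩
        exact ⟨Nat.find h, .inl (List.mem_filterMap.2 ⟨j, hj, by simp only [next, dif_pos h]⟩),
          (Nat.find_spec h).2.1, Nat.find_min' h ⟨hs, hjs, hsr⟩⟩
      · exact ⟨s, .inr ((ht' i s (not_lt.1 hsr)).1 hs), hjs, le_rfl⟩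
  · obtain ⟨k, -, hk⟩ := List.mem_filterMap.1 hs
    exact (hnext hk).2.2

theorem length_encode (a : ℕ) : (encodingNatΓ'.encode a).length = a.size := by
  rw [encode_eq_printNat, printNat, List.length_map, Nat.size_eq_bits_len]

theorem length_le_length_flatMap {α β : Type} {l : List α} {f : α → List β} {x : α} (hx : x ∈ l) :
    (f x).length ≤ (l.flatMap f).length := by
  rw [List.length_flatMap]
  exact List.le_sum_of_mem (List.mem_map_of_mem hx)

theorem length_flatMap_le_of_forall {α β γ : Type} {l : List α} {f : α → List β}
    {g : α → List γ} (h : ∀ x ∈ l, (f x).length ≤ (g x).length) :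
    (l.flatMap f).length ≤ (l.flatMap g).length := by
  rw [List.length_flatMap, List.length_flatMap]
  exact List.sum_le_sum h

/-- The parameters of a system are bounded in terms of the length of a code, and the orders that
occur form a list that is not longer than the code. -/
theorem System.IsCode.exists_bounds {n : ℕ} {E : System n} {w : List Γ'} (h : E.IsCode w) :
    n ≤ w.length ∧ E.Bounded w.length (2 ^ w.length) (2 ^ w.length) ∧
      ∃ J : List ℕ, J.length ≤ w.length ∧ ∀ e ∈ E, ∀ P ∈ e.family, ∀ q ∈ P, q.2 ∈ J := by
  obtain ⟨L, hL, rfl⟩ := h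
  have hlen : (encodeSystem L : List Γ').length = n + (L.flatMap encodeEquation).length := by
    simp [encodeSystem]
  have hequation {l : List (ℕ × List (Fin n × ℕ))} :
      (encodeEquation l).length = (l.flatMap encodeTerm).length + 2 := by
    simp only [encodeEquation, List.length_append, List.length_singleton]
    omega
  have hterm {t : ℕ × List (Fin n × ℕ)} :
      (encodeTerm t).length = t.1.size + (t.2.flatMap encodeFactor).length + 2 := by
    simp only [encodeTerm, List.length_append, List.length_singleton, length_encode]
    omega
  have hfactor {q : Fin n × ℕ} : (encodeFactor q).length = (q.1 : ℕ).size + q.2.size + 3 := by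
    simp only [encodeFactor, List.length_append, List.length_singleton, length_encode]
    omega
  have hfactors (f : List (Fin n × ℕ)) : f.length ≤ (f.flatMap encodeFactor).length := by
    simpa [List.flatMap_singleton'] using length_flatMap_le_of_forall (f := fun q => [q])
      (g := encodeFactor) (l := f) fun q _ => by rw [hfactor, List.length_singleton]; omega
  have hmem {e} (he : e ∈ E) {P} (hP : P ∈ e.family) :
      ∃ l ∈ L, ∃ t ∈ l, (t.2 : Monomial n) = P ∧ e.coeff P = t.1 := by
    obtain ⟨k, hk, rfl⟩ := List.mem_iff_getElem.1 he
    have hk' : k < L.length := hL.length_eq ▸ hk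
    have hl := hL.get hk hk'
    obtain ⟨t, ht, rfl⟩ := (hl.2.1 P).1 hP
    exact ⟨_, List.getElem_mem hk', t, ht, rfl, hl.2.2 t ht⟩
  have hle {l} (hl : l ∈ L) {t} (ht : t ∈ l) :
      (encodeTerm t).length ≤ (encodeSystem L : List Γ').length := by
    have h1 := length_le_length_flatMap (f := encodeTerm) ht
    have h2 := length_le_length_flatMap (f := encodeEquation) hl
    rw [hequation] at h2
    omega
  refine ⟨by omega, fun e he P hP => ?_, L.flatMap fun l => l.flatMap fun t => t.2.map Prod.snd,
    ?_, fun e he P hP q hq => ?_⟩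
  · obtain ⟨l, hl, t, ht, rfl, ha⟩ := hmem he hP
    have h1 := hle hl ht
    rw [hterm] at h1
    refine ⟨?_, ?_, fun q hq => ?_⟩
    · have := hfactors t.2
      rw [Multiset.coe_card]
      omega
    · rw [ha]
      exact (Nat.lt_size_self _).le.trans (Nat.pow_le_pow_right (by simp) (by omega))
    · have h2 := length_le_length_flatMap (f := encodeFactor) (Multiset.mem_coe.1 hq)
      rw [hfactor] at h2
      exact (Nat.lt_size_self _).le.trans (Nat.pow_le_pow_right (by simp) (by omega))
  · have h1 := length_flatMap_le_of_forall (l := L)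
      (f := fun l => l.flatMap fun t => t.2.map Prod.snd) (g := encodeEquation) fun l _ => by
        have h2 := length_flatMap_le_of_forall (l := l)
          (f := fun t => t.2.map Prod.snd) (g := encodeTerm) fun t _ => by
            have := hfactors t.2
            rw [hterm, List.length_map]
            omega
        rw [hequation]
        omega
    omega
  · obtain ⟨l, hl, t, ht, rfl, -⟩ := hmem he hP
    exact List.mem_flatMap.2 ⟨l, hl, List.mem_flatMap.2 ⟨t, ht,
      List.mem_map_of_mem (Multiset.mem_coe.1 hq)⟩⟩

theorem length_flatMap_le_mul {α β : Type} {l : List α} {f : α → List β} {k : ℕ}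
    (h : ∀ x ∈ l, (f x).length ≤ k) : (l.flatMap f).length ≤ l.length * k := by
  rw [List.length_flatMap]
  simpa using List.sum_le_card_nsmul (l.map fun x => (f x).length) k (by simpa using h)

theorem Certificate.length_encode_le {n k a b : ℕ} {C : Certificate n}
    (h : ∀ i, (C.initial i).length ≤ k ∧ (∀ s ∈ C.initial i, s.size ≤ a) ∧
      ∀ m ∈ C.tail i, m.size ≤ b) : C.encode.length ≤ n * (k * (a + 2) + b + 3) := by
  have h1 : C.encode = (List.finRange n).flatMap C.encodeEntry := by
    rw [encode, List.ofFn_eq_map, List.flatMap]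
  have h2 (i : Fin n) : (C.encodeEntry i).length ≤ k * (a + 2) + b + 3 := by
    obtain ⟨h3, h4, h5⟩ := h i
    have h6 : ((C.initial i).flatMap fun s =>
        [Γ'.bra] ++ encodingNatΓ'.encode s ++ [Γ'.ket]).length ≤ k * (a + 2) := by
      refine (length_flatMap_le_mul fun s hs => ?_).trans (Nat.mul_le_mul_right _ h3)
      have := h4 s hs
      simp only [List.length_append, List.length_singleton, length_encode]
      omega
    have h7 : ((C.tail i).elim [] fun m => [Γ'.comma] ++ encodingNatΓ'.encode m).length
        ≤ b + 1 := by
      cases ht : C.tail i with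
      | none => simp
      | some m =>
        have := h5 m ht
        simp only [Option.elim_some, List.length_append, List.length_singleton, length_encode]
        omega
    simp only [encodeEntry, List.length_append, List.length_singleton]
    omega
  rw [h1]
  simpa using length_flatMap_le_mul (l := List.finRange n) fun i _ => h2 i

theorem factorial_mul_lt_two_pow {n d M r l : ℕ} (hn : n ≤ l) (hd : d ≤ l + 2) (hM : M ≤ 2 ^ l)
    (hr : r ≤ 2 ^ l) :
    n.factorial * (M + r * d) * d ^ n < 2 ^ (2 * l ^ 2 + 3 * l + 3) := by
  have h1 : n.factorial ≤ 2 ^ (l ^ 2) := by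
    calc n.factorial ≤ l.factorial := Nat.factorial_le hn
      _ ≤ l ^ l := Nat.factorial_le_pow l
      _ ≤ (2 ^ l) ^ l := Nat.pow_le_pow_left Nat.lt_two_pow_self.le l
      _ = 2 ^ (l ^ 2) := by rw [← pow_mul, sq]
  have h2 : l + 2 ≤ 2 ^ (l + 1) := Nat.lt_two_pow_self (n := l + 1)
  have h3 : d ^ n ≤ 2 ^ (l ^ 2 + l) := by
    calc d ^ n ≤ (l + 2) ^ n := Nat.pow_le_pow_left hd n
      _ ≤ (l + 2) ^ l := Nat.pow_le_pow_right (by omega) hn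
      _ ≤ (2 ^ (l + 1)) ^ l := Nat.pow_le_pow_left h2 l
      _ = 2 ^ (l ^ 2 + l) := by rw [← pow_mul]; ring_nf
  have h4 : M + r * d ≤ 2 ^ (2 * l + 2) := by
    calc M + r * d ≤ 2 ^ l + 2 ^ l * (l + 2) := add_le_add hM (Nat.mul_le_mul hr hd)
      _ = 2 ^ l * (l + 3) := by ring
      _ ≤ 2 ^ l * 2 ^ (l + 2) :=
        Nat.mul_le_mul_left _ (Nat.lt_two_pow_self (n := l + 2))
      _ = 2 ^ (2 * l + 2) := by rw [← pow_add]; ring_nf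
  calc n.factorial * (M + r * d) * d ^ n
      ≤ 2 ^ (l ^ 2) * 2 ^ (2 * l + 2) * 2 ^ (l ^ 2 + l) :=
        Nat.mul_le_mul (Nat.mul_le_mul h1 h4) h3
    _ = 2 ^ (2 * l ^ 2 + 3 * l + 2) := by rw [← pow_add, ← pow_add]; ring_nf
    _ < 2 ^ (2 * l ^ 2 + 3 * l + 3) := Nat.pow_lt_pow_right (by simp) (by omega)

/-- One certificate serves for all bounds `d`, `M`, `r` at once, since it is built from a small
solution with respect to the least ones. -/
theorem System.IsCode.exists_short_certificate {n : ℕ} {E : System n} {w : List Γ'}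
    (h : E.IsCode w) (hsol : E.Solvable) :
    ∃ C : Certificate n, E.IsSolution C.sets ∧
      C.encode.length ≤ w.length * (3 * w.length ^ 2 + 6 * w.length + 6) ∧
      ∀ d M r : ℕ, 2 ≤ d → E.Bounded d M r → ∀ i, (∀ s ∈ C.initial i, s ≤ r) ∧
        ∀ m ∈ C.tail i, m ≤ n.factorial * (M + r * d) * d ^ n := by
  obtain ⟨hn, hb, J, hJ, hJE⟩ := h.exists_bounds
  generalize w.length = l at *
  have hb' : E.Bounded (l + 2) (2 ^ l) (2 ^ l) := fun e he P hP =>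
    ⟨(hb e he P hP).1.trans (Nat.le_add_right _ _), (hb e he P hP).2⟩
  obtain ⟨d, M, r, hd, hE, hmin⟩ := hb'.exists_least (Nat.le_add_left 2 l)
  obtain ⟨hdl, hMl, hrl⟩ := hmin _ _ _ (Nat.le_add_left 2 l) hb'
  obtain ⟨S, hS, htail⟩ := hsol.exists_small hd hE
  obtain ⟨C, hC, hCi⟩ := hS.exists_certificate htail hJE
  refine ⟨C, hC, ?_, fun d' M' r' hd' hE' i => ⟨fun s hs => ?_, fun m hm => ?_⟩⟩
  · refine (C.length_encode_le (k := l) (a := l) (b := 2 * l ^ 2 + 3 * l + 3) fun i =>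
      ⟨(hCi i).1.trans hJ, fun s hs => ?_, fun m hm => ?_⟩).trans ?_
    · exact Nat.size_le.2 (((hCi i).2.1 s hs).trans_le hrl)
    · exact Nat.size_le.2 (((hCi i).2.2 m hm).trans_lt
        (factorial_mul_lt_two_pow hn hdl hMl hrl))
    · refine Nat.mul_le_mul hn ?_
      nlinarith
  · exact ((hCi i).2.1 s hs).le.trans (hmin d' M' r' hd' hE').2.2
  · obtain ⟨h1, h2, h3⟩ := hmin d' M' r' hd' hE'
    refine ((hCi i).2.2 m hm).trans ?_
    gcongr

end TropDiff

theorem mainTheorem4 :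
    -- the solvability problem lies in NP
    Complexity.InNP TropDiff.solvabilityProblem ∧
    -- a solvable system has a small solution
    (∀ (n d M r : ℕ) (E : TropDiff.System n), 2 ≤ d → E.Bounded d M r → E.Solvable →
      ∃ S : Fin n → Set ℕ, E.IsSolution S ∧
        ∀ i, (∀ s ∈ S i, s < r) ∨
          ∃ m, r ≤ m ∧ m ≤ n.factorial * (M + r * d) * d ^ n ∧
            ∀ s, r ≤ s → (s ∈ S i ↔ m ≤ s)) ∧
    -- descriptions of small solutions are short, polynomial time verifiable certificates
    Complexity.PolyTimeDecidable TropDiff.Certifies ∧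
    ∃ p : Polynomial ℕ, ∀ (n : ℕ) (E : TropDiff.System n) (w : List Computability.Γ'),
      E.IsCode w → E.Solvable →
      ∃ C : TropDiff.Certificate n, E.IsSolution C.sets ∧
        C.encode.length ≤ p.eval w.length ∧
        ∀ d M r : ℕ, 2 ≤ d → E.Bounded d M r →
          ∀ i, (∀ s ∈ C.initial i, s ≤ r) ∧
            ∀ m ∈ C.tail i, m ≤ n.factorial * (M + r * d) * d ^ n := by
  let p : Polynomial ℕ :=
    Polynomial.X * (3 * Polynomial.X ^ 2 + 6 * Polynomial.X + 6)
  have hp (l : ℕ) : p.eval l = l * (3 * l ^ 2 + 6 * l + 6) := by simp [p]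
  refine ⟨⟨Computability.Γ', inferInstance, TropDiff.Certifies, p,
    TropDiff.polyTimeDecidable_certifies, fun w => ⟨?_, ?_⟩⟩,
    fun n d M r E hd hE hsol => hsol.exists_small hd hE,
    TropDiff.polyTimeDecidable_certifies, p, fun n E w hw hsol => ?_⟩
  · rintro ⟨n, E, hw, hsol⟩
    obtain ⟨C, hC, hlen, -⟩ := hw.exists_short_certificate hsol
    exact ⟨C.encode, by rwa [hp], n, E, C, hw, rfl, hC⟩
  · rintro ⟨c, -, n, E, C, hw, -, hC⟩
    exact ⟨n, E, hw, C.sets, hC⟩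
  · rw [hp]
    exact hw.exists_short_certificate hsol
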